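/- Let $\mathbb H$ and $\mathbb U$ be (real or complex) Hilbert spaces, let $(S(t))_{t\in\mathbb R}\subset\mathcal L(\mathbb H)$ be a strongly continuous group with infinitesimal generator $(A,\mathcal D(A))$, equip $\mathcal D(A^*)$ with the graph scalar product, and let $\mathcal D(A^*)'$ be its dual with respect to the pivot space $\mathbb H$. Let $B\in\mathcal L(\mathbb U,\mathcal D(A^*)')$ be an admissible control operator: for all $T>0$ and $u\in L^2((0,T);\mathbb U)$ the function $t\mapsto\int_0^tS(t-s)Bu(s)\,ds$ belongs to $C([0,T];\mathbb H)$. A weak solution $y\in C([0,T];\mathbb H)$ of $y'=Ay+h+Bu$ in $(0,T)$, $y(0)=y_0$, satisfies $y(0)=y_0$ and, for all $\varphi\in\mathcal D(A^*)$, $\frac{d}{dt}\langle y,\varphi\rangle=\langle y,A^*\varphi\rangle+\langle h,\varphi\rangle+\langle u,B^*\varphi\rangle$ in the sense of distributions on $(0,T)$. Weak solutions of $z'=-A^*z-g$ are defined similarly, with test vectors in $\mathcal D(A)$; for such a $z\in C([0,T];\mathbb H)$ with $g\in L^1((0,T);\mathbb H)$, $B^*z\in L^2((0,T);\mathbb U)$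 is defined by density from the case where $z$ and $g$ are continuous with values in $\mathcal D(A^*)$, with respect to the norms of $z(T)$ in $\mathbb H$ and $g$ in $L^1((0,T);\mathbb H)$. Assume that the linear system $y'=Ay+Bu$ is exactly controllable in some time $T>0$: for all $y_0,y_T\in\mathbb H$ there is $u\in L^2((0,T);\mathbb U)$ such that the weak solution with $y(0)=y_0$ satisfies $y(T)=y_T$. Let $f:\mathbb H\to\mathbb H$ be continuous and such that (i) for every $\varepsilon>0$ there is $\delta>0$ with $\|f(x)\|\le\varepsilon\|x\|$ whenever $\|x\|<\delta$; (ii) there are $r,\Lambda>0$ with $\|f(x)-f(y)\|\le\Lambda\|x-y\|$ whenever $\|x\|,\|y\|<r$. Then the nonlinear system $y'=Ay+f(y)+Bu$ is locally rapidly (statically) stabilizable in the trajectory sense. That is, for every $\gamma>0$ there are $\lambda>0$, a symmetric, coercive, invertible $Q\in\mathcal L(\mathbb H)$, and symmetric non-negative $R\in\mathcal L(\mathbb H)$, $W\in\mathcal L(\mathbb U)$ with $$\langle Qx,A^*y\rangle+\langle A^*x,Qy\rangle-\langle WB^*x,B^*y\rangle+\langle RQx,Qy\rangle+2\lambda\langle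 Qx,y\rangle=0\qquad\text{for all }x,y\in\mathcal D(A^*),$$ such that the feedback "$u=-WB^*Q^{-1}y$" stabilizes the system locally with rate $\gamma$ in the following sense: there are $\varepsilon,C>0$ such that for every $y_0\in\mathbb H$ with $\|y_0\|\le\varepsilon$ there is a unique pair $(y,\widetilde y)\in C([0,\infty);\mathbb H)^2$ which is, on $(0,T)$ for every $T>0$, a weak solution of $$\begin{cases}y'=Ay+f(y)-BWB^*\widetilde y,\\ \widetilde y'=-A^*\widetilde y-2\lambda\widetilde y-RQ\widetilde y+Q^{-1}f(Q\widetilde y),\\ y(0)=y_0,\quad\widetilde y(0)=Q^{-1}y_0,\end{cases}$$ and this pair satisfies $\widetilde y(t)=Q^{-1}y(t)$ and $\|y(t)\|\le Ce^{-\gamma t}\|y_0\|$ for all $t\ge0$. -/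

import Mathlib

open MeasureTheory Filter Topology Set
open scoped ContDiff LinearPMap

/-- A strongly continuous group `(S(t))_{t ∈ ℝ}` of bounded linear operators on `H`. -/
structure C0Group (𝕜 H : Type*) [RCLike 𝕜] [NormedAddCommGroup H] [InnerProductSpace 𝕜 H] where
  /-- the operators `S(t)` -/
  op : ℝ → (H →L[𝕜] H)
  map_zero : op 0 = ContinuousLinearMap.id 𝕜 H
  map_add : ∀ s t : ℝ, op (s + t) = (op s).comp (op t)
  tendsto_zero : ∀ x : H, Tendsto (fun t : ℝ => op t x) (𝓝 0) (𝓝 x)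

namespace C0Group

section Generator

variable {𝕜 H : Type*} [RCLike 𝕜] [NormedAddCommGroup H] [InnerProductSpace 𝕜 H]

/-- `l` is the derivative at `t = 0` of the orbit `t ↦ S(t) x`. -/
def HasGen (S : C0Group 𝕜 H) (x l : H) : Prop :=
  Tendsto (fun t : ℝ => ((t : 𝕜)⁻¹) • (S.op t x - x)) (𝓝[≠] 0) (𝓝 l)

theorem HasGen.unique {S : C0Group 𝕜 H} {x l l' : H} (h : S.HasGen x l) (h' : S.HasGen x l') :
    l = l' :=
  tendsto_nhds_unique h h'

theorem HasGen.add {S : C0Group 𝕜 H} {x y l m : H} (h : S.HasGen x l) (h' : S.HasGen y m) :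
    S.HasGen (x + y) (l + m) := by
  unfold HasGen at *
  refine (Tendsto.add h h').congr fun t => ?_
  rw [← smul_add, (S.op t).map_add]
  congr 1
  abel

theorem HasGen.smul {S : C0Group 𝕜 H} {x l : H} (c : 𝕜) (h : S.HasGen x l) :
    S.HasGen (c • x) (c • l) := by
  unfold HasGen at *
  refine (Tendsto.const_smul h c).congr fun t => ?_
  rw [(S.op t).map_smul, ← smul_sub, smul_comm]

theorem HasGen.zero (S : C0Group 𝕜 H) : S.HasGen (0 : H) 0 := by
  unfold HasGen
  simp

/-- The infinitesimal generator `(A, D(A))` of the group: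
`D(A)` is the set of `x` for which `lim_{t → 0} (S(t) x - x) / t` exists, and `A x` is the limit. -/
noncomputable def generator (S : C0Group 𝕜 H) : H →ₗ.[𝕜] H where
  domain :=
    { carrier := {x | ∃ l, S.HasGen x l}
      zero_mem' := ⟨0, HasGen.zero S⟩
      add_mem' := fun ⟨l, hl⟩ ⟨m, hm⟩ => ⟨l + m, hl.add hm⟩
      smul_mem' := fun c _ ⟨l, hl⟩ => ⟨c • l, hl.smul c⟩ }
  toFun :=
    { toFun := fun x => Classical.choose x.2
      map_add' := fun x y => HasGen.unique (Classical.choose_spec (x + y).2)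
        ((Classical.choose_spec x.2).add (Classical.choose_spec y.2))
      map_smul' := fun c x => HasGen.unique (Classical.choose_spec (c • x).2)
        ((Classical.choose_spec x.2).smul c) }

theorem generator_spec (S : C0Group 𝕜 H) (x : S.generator.domain) :
    S.HasGen (x : H) (S.generator x) :=
  Classical.choose_spec x.2

theorem hasGen_op (S : C0Group 𝕜 H) (s : ℝ) {x l : H} (h : S.HasGen x l) :
    S.HasGen (S.op s x) (S.op s l) := by
  unfold HasGen at *
  refine (((S.op s).continuous.tendsto l).comp h).congr fun t => ?_
  have e : S.op t (S.op s x) = S.op s (S.op t x) := by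
    have h1 := congrArg (fun L : H →L[𝕜] H => L x) (S.map_add t s)
    have h2 := congrArg (fun L : H →L[𝕜] H => L x) (S.map_add s t)
    rw [add_comm t s] at h1
    exact h1.symm.trans h2
  simp only [Function.comp_apply, _root_.map_smul, map_sub, e]

theorem op_mem_domain (S : C0Group 𝕜 H) (s : ℝ) (x : S.generator.domain) :
    S.op s (x : H) ∈ S.generator.domain :=
  ⟨_, S.hasGen_op s (S.generator_spec x)⟩

theorem generator_op (S : C0Group 𝕜 H) (s : ℝ) (x : S.generator.domain) :
    S.generator ⟨S.op s (x : H), S.op_mem_domain s x⟩ = S.op s (S.generator x) :=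
  (S.generator_spec ⟨S.op s (x : H), S.op_mem_domain s x⟩).unique
    (S.hasGen_op s (S.generator_spec x))

end Generator

section Control

variable {𝕜 H U : Type*} [RCLike 𝕜]
  [NormedAddCommGroup H] [InnerProductSpace 𝕜 H] [CompleteSpace H]
  [NormedAddCommGroup U] [InnerProductSpace 𝕜 U] [CompleteSpace U]

/-- The Hilbert space `D(A*)` with scalar product `⟪φ₁, φ₂⟫ + ⟪A* φ₁, A* φ₂⟫`, realised as the
graph of `A*`, a subspace of the Hilbert sum `H ⊕ H`. -/
noncomputable abbrev DomAdj (S : C0Group 𝕜 H) : Submodule 𝕜 (WithLp 2 (H × H)) :=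
  S.generator†.graph.comap (WithLp.linearEquiv 2 𝕜 (H × H)).toLinearMap

/-- An element `φ` of `D(A*)`, as an element of `H`. -/
noncomputable def vec (S : C0Group 𝕜 H) (φ : S.DomAdj) : H := (φ : WithLp 2 (H × H)).fst

/-- `A* φ` for `φ ∈ D(A*)`. -/
noncomputable def adjGen (S : C0Group 𝕜 H) (φ : S.DomAdj) : H := (φ : WithLp 2 (H × H)).snd

/-- An element of `H` lying in the domain of `A*`, as an element of `D(A*)`. -/
noncomputable def toDomAdj (S : C0Group 𝕜 H) (x : H) (hx : x ∈ S.generator†.domain) : S.DomAdj :=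
  ⟨WithLp.toLp 2 (x, S.generator† ⟨x, hx⟩), S.generator†.mem_graph ⟨x, hx⟩⟩

theorem vec_mem (S : C0Group 𝕜 H) (φ : S.DomAdj) : S.vec φ ∈ S.generator†.domain :=
  LinearPMap.mem_domain_of_mem_graph φ.2

theorem adjGen_eq (S : C0Group 𝕜 H) (φ : S.DomAdj) :
    S.adjGen φ = S.generator† ⟨S.vec φ, S.vec_mem φ⟩ :=
  S.generator†.mem_graph_snd_inj' φ.2 (S.generator†.mem_graph ⟨S.vec φ, S.vec_mem φ⟩) rfl

/-- `S(t)*` maps `D(A*)` into itself. -/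
theorem adjoint_op_mem (S : C0Group 𝕜 H) (t : ℝ) {x : H} (hx : x ∈ S.generator†.domain) :
    ContinuousLinearMap.adjoint (S.op t) x ∈ S.generator†.domain := by
  rw [LinearPMap.mem_adjoint_domain_iff] at *
  have hc : Continuous fun y : S.generator.domain =>
      (⟨S.op t (y : H), S.op_mem_domain t y⟩ : S.generator.domain) :=
    ((S.op t).continuous.comp continuous_subtype_val).subtype_mk _
  refine (hx.comp hc).congr fun y => ?_
  change inner 𝕜 x (S.generator ⟨S.op t (y : H), S.op_mem_domain t y⟩)
    = inner 𝕜 (ContinuousLinearMap.adjoint (S.op t) x) (S.generator y)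
  rw [S.generator_op, ContinuousLinearMap.adjoint_inner_left]

/-- `S(t)*` as a map of `D(A*)` into itself. -/
noncomputable def adjOp (S : C0Group 𝕜 H) (t : ℝ) (φ : S.DomAdj) : S.DomAdj :=
  S.toDomAdj (ContinuousLinearMap.adjoint (S.op t) (S.vec φ)) (S.adjoint_op_mem t (S.vec_mem φ))

/-- `D(A*)'`, the dual of `D(A*)` with respect to the pivot space `H`: the continuous conjugate
linear functionals on `D(A*)` (the continuous linear ones when `𝕜 = ℝ`). An element `h` of `H` is
identified with `φ ↦ inner 𝕜 φ h`; the inner product of Mathlib is linear in its second slot. -/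
abbrev DomAdjDual (S : C0Group 𝕜 H) : Type _ := S.DomAdj →L⋆[𝕜] 𝕜

/-- The adjoint `B* : D(A*) → U` of `B : U → D(A*)'`. -/
noncomputable def obs (S : C0Group 𝕜 H) (B : U →L[𝕜] S.DomAdjDual) : S.DomAdj →L[𝕜] U :=
  ((InnerProductSpace.toDual 𝕜 U).symm.toContinuousLinearEquiv :
    StrongDual 𝕜 U →L⋆[𝕜] U).comp B.flip

theorem inner_obs (S : C0Group 𝕜 H) (B : U →L[𝕜] S.DomAdjDual) (φ : S.DomAdj) (u : U) :
    inner 𝕜 (S.obs B φ) u = B u φ :=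
  InnerProductSpace.toDual_symm_apply (𝕜 := 𝕜) (x := u) (y := B.flip φ)

/-- `B` is an admissible control operator: for all `T > 0` and `u ∈ L²((0,T);U)` the function
`t ↦ ∫₀ᵗ S(t-s) B u(s) ds`, whose values are a priori in `D(A*)'`, belongs to `C([0,T];H)`. -/
def Admissible (S : C0Group 𝕜 H) (B : U →L[𝕜] S.DomAdjDual) : Prop :=
  ∀ T : ℝ, 0 < T → ∀ u : ℝ → U, MemLp u 2 (volume.restrict (Ioo 0 T)) →
    ∃ Φ : ℝ → H, ContinuousOn Φ (Icc 0 T) ∧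
      ∀ t ∈ Icc 0 T, ∀ φ : S.DomAdj,
        inner 𝕜 (S.vec φ) (Φ t) = ∫ s in Ioo 0 t, B (u s) (S.adjOp (t - s) φ)

/-- Smooth real functions with compact support in `(0, T)`. -/
def IsTest (T : ℝ) (ψ : ℝ → ℝ) : Prop :=
  ContDiff ℝ ∞ ψ ∧ HasCompactSupport ψ ∧ tsupport ψ ⊆ Ioo 0 T

/-- `F' = h` in the sense of distributions on `(0, T)`. -/
def DistDeriv (T : ℝ) (F h : ℝ → 𝕜) : Prop :=
  ∀ ψ : ℝ → ℝ, IsTest T ψ →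
    -∫ t in Ioo 0 T, ((deriv ψ t : ℝ) : 𝕜) * F t = ∫ t in Ioo 0 T, ((ψ t : ℝ) : 𝕜) * h t

/-- `y ∈ C([0,T];H)` is a weak solution of `y' = A y + f + B u` in `(0,T)`, `y(0) = y₀`. -/
def IsWeakSol (S : C0Group 𝕜 H) (B : U →L[𝕜] S.DomAdjDual) (T : ℝ) (y₀ : H)
    (f : ℝ → H) (u : ℝ → U) (y : ℝ → H) : Prop :=
  ContinuousOn y (Icc 0 T) ∧ y 0 = y₀ ∧
    ∀ φ : S.DomAdj, DistDeriv T (fun t => inner 𝕜 (S.vec φ) (y t))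
      (fun t => inner 𝕜 (S.adjGen φ) (y t) + inner 𝕜 (S.vec φ) (f t) + B (u t) φ)

/-- `z ∈ C([0,T];H)` is a weak solution of `z' = -A* z - g` in `(0,T)`; the test vectors are taken
in `D(A)`, since `(-A*)* = -A`. No value of `z` is prescribed. -/
def IsAdjWeakSol (S : C0Group 𝕜 H) (T : ℝ) (g z : ℝ → H) : Prop :=
  ContinuousOn z (Icc 0 T) ∧
    ∀ x : S.generator.domain, DistDeriv T (fun t => inner 𝕜 (x : H) (z t))
      (fun t => -inner 𝕜 (S.generator x) (z t) - inner 𝕜 (x : H) (g t))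

/-- For a weak solution `z ∈ C([0,T];H)` of `z' = -A* z - g`, the function `v` is `B* z` as an
element of `L²((0,T);U)`. Here `B* z` is pointwise defined when `z` and `g` are continuous with
values in `D(A*)`, and in general it is defined by density with respect to the norm of `z(T)` in `H`
and of `g` in `L¹((0,T);H)`. -/
def IsObs (S : C0Group 𝕜 H) (B : U →L[𝕜] S.DomAdjDual) (T : ℝ) (g z : ℝ → H) (v : ℝ → U) : Prop :=
  MemLp v 2 (volume.restrict (Ioo 0 T)) ∧
    ∃ gn zn : ℕ → ℝ → S.DomAdj,
      (∀ n, ContinuousOn (gn n) (Icc 0 T)) ∧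
      (∀ n, ContinuousOn (zn n) (Icc 0 T)) ∧
      (∀ n, S.IsAdjWeakSol T (fun t => S.vec (gn n t)) (fun t => S.vec (zn n t))) ∧
      Tendsto (fun n => S.vec (zn n T)) atTop (𝓝 (z T)) ∧
      Tendsto (fun n => eLpNorm (fun t => S.vec (gn n t) - g t) 1 (volume.restrict (Ioo 0 T)))
        atTop (𝓝 0) ∧
      Tendsto (fun n => eLpNorm (fun t => S.obs B (zn n t) - v t) 2 (volume.restrict (Ioo 0 T)))
        atTop (𝓝 0)

/-- The system `y' = A y + B u`, `y(0) = y₀` is exactly controllable in some positive time. -/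
def ExactlyControllable (S : C0Group 𝕜 H) (B : U →L[𝕜] S.DomAdjDual) : Prop :=
  ∃ T : ℝ, 0 < T ∧ ∀ y₀ y₁ : H, ∃ u : ℝ → U, MemLp u 2 (volume.restrict (Ioo 0 T)) ∧
    ∃ y : ℝ → H, S.IsWeakSol B T y₀ (fun _ => 0) u y ∧ y T = y₁

/-- `Q` is symmetric and positive, that is coercive. -/
def IsCoercive (Q : H →L[𝕜] H) : Prop :=
  Q.IsSymmetric ∧ ∃ c : ℝ, 0 < c ∧ ∀ x : H, c * ‖x‖ ^ 2 ≤ RCLike.re (inner 𝕜 (Q x) x)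

/-- `A Q + Q A* - B W B* + Q R Q + 2 lam Q = 0`, tested against vectors of `D(A*)`. -/
def RiccatiIdentity (S : C0Group 𝕜 H) (B : U →L[𝕜] S.DomAdjDual) (lam : ℝ)
    (Q R : H →L[𝕜] H) (W : U →L[𝕜] U) : Prop :=
  ∀ φ χ : S.DomAdj,
    inner 𝕜 (Q (S.vec φ)) (S.adjGen χ) + inner 𝕜 (S.adjGen φ) (Q (S.vec χ)) - inner 𝕜 (W (S.obs B φ)) (S.obs B χ)
      + inner 𝕜 (R (Q (S.vec φ))) (Q (S.vec χ)) + 2 * (lam : 𝕜) * inner 𝕜 (Q (S.vec φ)) (S.vec χ) = 0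

/-- `(y, w)` is a weak solution on `(0, T)` for all `T > 0` of
`y' = A y + f(y) - B W B* w`, `w' = -A* w - 2 lam w - R Q w + Q⁻¹ f(Q w)`,
`y(0) = y₀`, `w(0) = Q⁻¹ y₀`: the control is `u = -W B* w`, where `B* w ∈ L²((0,T);U)`. -/
def IsClosedLoopSol (S : C0Group 𝕜 H) (B : U →L[𝕜] S.DomAdjDual) (f : H → H) (lam : ℝ)
    (Q : H ≃L[𝕜] H) (R : H →L[𝕜] H) (W : U →L[𝕜] U) (y₀ : H) (y w : ℝ → H) : Prop :=
  w 0 = Q.symm y₀ ∧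
  ∀ T : ℝ, 0 < T →
    S.IsAdjWeakSol T (fun t => (2 * (lam : 𝕜)) • w t + R (Q (w t)) - Q.symm (f (Q (w t)))) w ∧
    ∃ v : ℝ → U,
      S.IsObs B T (fun t => (2 * (lam : 𝕜)) • w t + R (Q (w t)) - Q.symm (f (Q (w t)))) w v ∧
      S.IsWeakSol B T y₀ (fun t => f (y t)) (fun t => -W (v t)) y

/-- The system `y' = A y + f(y) + B u` is locally rapidly (statically) stabilizable in the
trajectory sense: for every rate `γ > 0` there are `lam, Q, R, W` as in the operator identity such
that the static feedback `u = -W B* Q⁻¹ y` is, for all small initial data, well-posed in the sense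
of the trajectories of the above system, and its trajectories decay with the rate `γ`. -/
def LocallyRapidlyStabilizable (S : C0Group 𝕜 H) (B : U →L[𝕜] S.DomAdjDual) (f : H → H) : Prop :=
  ∀ γ : ℝ, 0 < γ →
    ∃ (lam : ℝ) (Q : H ≃L[𝕜] H) (R : H →L[𝕜] H) (W : U →L[𝕜] U),
      0 < lam ∧ IsCoercive (Q : H →L[𝕜] H) ∧ R.IsPositive ∧ W.IsPositive ∧
      S.RiccatiIdentity B lam (Q : H →L[𝕜] H) R W ∧
      ∃ ε C : ℝ, 0 < ε ∧ 0 < C ∧ ∀ y₀ : H, ‖y₀‖ ≤ ε →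
        ∃ y w : ℝ → H, S.IsClosedLoopSol B f lam Q R W y₀ y w ∧
          (∀ y₂ w₂ : ℝ → H, S.IsClosedLoopSol B f lam Q R W y₀ y₂ w₂ →
            EqOn y₂ y (Ici 0) ∧ EqOn w₂ w (Ici 0)) ∧
          (∀ t : ℝ, 0 ≤ t → w t = Q.symm (y t)) ∧
          ∀ t : ℝ, 0 ≤ t → ‖y t‖ ≤ C * Real.exp (-γ * t) * ‖y₀‖

end Control

end C0Group

/-! Idea of the proof. Take R = 0 and W = 1. Let κ be a growth exponent of the group and lam > κ.
The weighted Gramian Q = ∫₀^∞ e^{-2 lam s} S(-s) B B* S(-s)* ds, realised as G* G with (G φ)(s) =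
e^{-lam s} B* S(-s)* φ, is bounded because B is admissible (`exists_observation_map`) and coercive
because the system is exactly controllable (`ExactlyControllable.exists_le_norm`). Integrating the
derivative of its integrand over the half line gives A Q + Q A* - B B* + 2 lam Q = 0
(`gramian_identity`, `exists_riccati`).

Formally this identity says that Q intertwines -A* - 2 lam with A - B B* Q⁻¹. The unknown w = Q⁻¹ y
therefore satisfies w' = -A* w - 2 lam w + Q⁻¹ f(Q w), where the unbounded operator B has
disappeared. The linear part decays at rate 2 lam - κ, and the nonlinearity is small and Lipschitz
near 0. A truncation, Picard iteration and Grönwall's inequality produce a global small solution w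
with any prescribed decay rate (`exists_isAdjWeakSol_decay`), and y is defined as Q w.

It remains to give a meaning to B* w, as w only takes values in H. For solutions z of z' = -A* z - g
with values in D(A*), the Riccati identity gives d/dt ⟪Q z, z⟫ = 2 lam ⟪Q z, z⟫ - ‖B* z‖² - 2 Re ⟪Q
z, g⟫, so the L² norm of B* z is controlled by z(T) and the L¹ norm of g (`exists_integral_obs_le`).
Hence B* z exists and is unique as an L² limit (`exists_isObs`, `IsObs.ae_eq`). Passing to the limit
in the Riccati identity shows that Q w is a weak solution of the controlled equation with control
-B* w (`IsObs.isWeakSol`).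

Uniqueness is a cascade: the equation of w is autonomous and determines w (`IsAdjWeakSol.eqOn`), w
determines B* w almost everywhere, and the control then determines y (`IsWeakSol.eqOn`). -/

set_option linter.unusedSectionVars false

namespace C0Group

/-! ### Strongly continuous groups: growth bound and joint continuity. -/

section Basic

variable {𝕜 H : Type*} [RCLike 𝕜] [NormedAddCommGroup H] [InnerProductSpace 𝕜 H]

theorem op_zero_apply (S : C0Group 𝕜 H) (x : H) : S.op 0 x = x := by
  rw [S.map_zero]; rfl

theorem op_add_apply (S : C0Group 𝕜 H) (s t : ℝ) (x : H) :
    S.op (s + t) x = S.op s (S.op t x) := by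
  rw [S.map_add]; rfl

theorem op_comm (S : C0Group 𝕜 H) (s t : ℝ) (x : H) :
    S.op s (S.op t x) = S.op t (S.op s x) := by
  rw [← op_add_apply, ← op_add_apply, add_comm]

theorem op_neg_op (S : C0Group 𝕜 H) (t : ℝ) (x : H) : S.op (-t) (S.op t x) = x := by
  rw [← op_add_apply, neg_add_cancel, op_zero_apply]

theorem op_op_neg (S : C0Group 𝕜 H) (t : ℝ) (x : H) : S.op t (S.op (-t) x) = x := by
  rw [← op_add_apply, add_neg_cancel, op_zero_apply]

/-- The group `t ↦ S(-t)`. -/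
noncomputable def rev (S : C0Group 𝕜 H) : C0Group 𝕜 H where
  op t := S.op (-t)
  map_zero := by rw [neg_zero, S.map_zero]
  map_add s t := by rw [neg_add, S.map_add]
  tendsto_zero x := by
    have h : Tendsto (fun t : ℝ => -t) (𝓝 0) (𝓝 0) := by
      simpa using (continuous_neg (G := ℝ)).tendsto 0
    exact (S.tendsto_zero x).comp h

@[simp] theorem rev_op (S : C0Group 𝕜 H) (t : ℝ) : S.rev.op t = S.op (-t) := rfl

theorem norm_op_nsmul_le (S : C0Group 𝕜 H) {M : ℝ} (s : ℝ) (hs : ‖S.op s‖ ≤ M) (hM : 1 ≤ M)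
    (n : ℕ) : ‖S.op (n * s)‖ ≤ M ^ n := by
  induction n with
  | zero =>
    simp only [Nat.cast_zero, zero_mul, pow_zero, S.map_zero]
    exact ContinuousLinearMap.norm_id_le
  | succ k ih =>
    have e : ((k + 1 : ℕ) : ℝ) * s = k * s + s := by push_cast; ring
    rw [e, S.map_add, pow_succ]
    exact (ContinuousLinearMap.opNorm_comp_le _ _).trans
      (mul_le_mul ih hs (norm_nonneg _) (by positivity))

variable [CompleteSpace H]

/-- Otherwise there are times tending to 0 along which the norms are unbounded, although every orbit
converges along them; this contradicts the uniform boundedness principle. -/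
theorem exists_norm_op_le_near_zero (S : C0Group 𝕜 H) :
    ∃ δ M : ℝ, 0 < δ ∧ 1 ≤ M ∧ ∀ t : ℝ, |t| ≤ δ → ‖S.op t‖ ≤ M := by
  by_contra! hcon
  have h1 : ∀ n : ℕ, ∃ t : ℝ, |t| ≤ 1 / ((n : ℝ) + 1) ∧ (n : ℝ) + 1 < ‖S.op t‖ := fun n =>
    hcon (1 / ((n : ℝ) + 1)) ((n : ℝ) + 1) (by positivity) (by linarith [Nat.cast_nonneg (α := ℝ) n])
  choose t ht htn using h1
  have htend : Tendsto t atTop (𝓝 0) :=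
    squeeze_zero_norm (fun n => ht n) tendsto_one_div_add_atTop_nhds_zero_nat
  have hb : ∀ x : H, ∃ C, ∀ n, ‖S.op (t n) x‖ ≤ C := by
    intro x
    have := ((S.tendsto_zero x).comp htend).norm.bddAbove_range
    obtain ⟨C, hC⟩ := this
    exact ⟨C, fun n => hC ⟨n, rfl⟩⟩
  obtain ⟨C, hC⟩ := banach_steinhaus hb
  obtain ⟨n, hn⟩ := exists_nat_gt C
  linarith [hC n, htn n]

/-- The growth bound of a strongly continuous group. -/
theorem exists_growth (S : C0Group 𝕜 H) :
    ∃ M κ : ℝ, 1 ≤ M ∧ 0 ≤ κ ∧ ∀ t : ℝ, ‖S.op t‖ ≤ M * Real.exp (κ * |t|) := by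
  obtain ⟨δ, M, hδ, hM, h⟩ := S.exists_norm_op_le_near_zero
  have hM0 : 0 < M := by linarith
  -- Write S(t) = S(t/n)^n with n = ⌈|t|/δ⌉ ≤ |t|/δ + 1. Then M^n = exp(n log M) yields the exponent
  -- log M / δ, the extra 1 being paid by the prefactor M.
  refine ⟨M, Real.log M / δ, hM, div_nonneg (Real.log_nonneg hM) hδ.le, fun t => ?_⟩
  set n : ℕ := ⌈|t| / δ⌉₊ with hn
  rcases eq_or_ne n 0 with h0 | h0
  · have h2 : |t| / δ ≤ 0 := by
      have := Nat.le_ceil (|t| / δ); rw [← hn, h0] at this; exact_mod_cast this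
    have h3 : |t| ≤ 0 := by
      by_contra hc; exact absurd h2 (not_le.2 (div_pos (not_le.1 hc) hδ))
    have h4 := h t (h3.trans hδ.le)
    exact h4.trans (le_mul_of_one_le_right hM0.le (Real.one_le_exp (by
      have := Real.log_nonneg hM; positivity)))
  · have hn0 : (0 : ℝ) < n := by exact_mod_cast Nat.pos_of_ne_zero h0
    have h5 : |t / n| ≤ δ := by
      rw [abs_div, abs_of_pos hn0, div_le_iff₀ hn0]
      have := Nat.le_ceil (|t| / δ)
      rw [← hn, div_le_iff₀ hδ] at this
      linarith
    have h6 := S.norm_op_nsmul_le (t / n) (h _ h5) hM n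
    rw [mul_div_cancel₀ _ hn0.ne'] at h6
    refine h6.trans ?_
    have h7 : (n : ℝ) ≤ |t| / δ + 1 := (Nat.ceil_lt_add_one (by positivity)).le
    have e : M ^ n = Real.exp (Real.log M * n) := by
      rw [mul_comm, Real.exp_nat_mul, Real.exp_log hM0]
    have e2 : M * Real.exp (Real.log M / δ * |t|) = Real.exp (Real.log M * (|t| / δ + 1)) := by
      rw [mul_add, mul_one, Real.exp_add, Real.exp_log hM0, mul_comm M]
      congr 2; ring
    rw [e, e2]
    exact Real.exp_le_exp.2 (mul_le_mul_of_nonneg_left h7 (Real.log_nonneg hM))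

theorem exists_norm_op_le_of_abs_le (S : C0Group 𝕜 H) (T : ℝ) :
    ∃ M : ℝ, 1 ≤ M ∧ ∀ t : ℝ, |t| ≤ T → ‖S.op t‖ ≤ M := by
  obtain ⟨M, κ, hM, hκ, h⟩ := S.exists_growth
  refine ⟨M * Real.exp (κ * |T|), ?_, fun t ht => (h t).trans ?_⟩
  · exact one_le_mul_of_one_le_of_one_le hM (Real.one_le_exp (by positivity))
  · have : |t| ≤ |T| := ht.trans (le_abs_self T)
    gcongr

theorem continuous_op (S : C0Group 𝕜 H) (x : H) : Continuous fun t : ℝ => S.op t x := by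
  rw [continuous_iff_continuousAt]
  intro t
  have h : Tendsto (fun s : ℝ => s - t) (𝓝 t) (𝓝 0) := by
    have : Continuous fun s : ℝ => s - t := by fun_prop
    simpa using this.tendsto t
  have h2 := ((S.op t).continuous.tendsto x).comp ((S.tendsto_zero x).comp h)
  refine Tendsto.congr (fun s => ?_) h2
  simp only [Function.comp_apply]
  rw [← op_add_apply, add_sub_cancel]

/-- Strong continuity in time and a bound on the norms that is locally uniform in time together give
joint continuity. -/
theorem continuous_op_uncurry (S : C0Group 𝕜 H) :
    Continuous fun p : ℝ × H => S.op p.1 p.2 := by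
  rw [continuous_iff_continuousAt]
  rintro ⟨t, x⟩
  obtain ⟨M, hM, hb⟩ := S.exists_norm_op_le_of_abs_le (|t| + 1)
  rw [ContinuousAt, tendsto_iff_norm_sub_tendsto_zero]
  have h1 : Tendsto (fun p : ℝ × H => M * ‖p.2 - x‖ + ‖S.op p.1 x - S.op t x‖) (𝓝 (t, x)) (𝓝 0) := by
    have hc : Continuous fun p : ℝ × H => M * ‖p.2 - x‖ + ‖S.op p.1 x - S.op t x‖ := by
      have := (S.continuous_op x).comp (continuous_fst (X := ℝ) (Y := H))
      exact (continuous_const.mul (continuous_snd.sub continuous_const).norm).add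
        (this.sub continuous_const).norm
    simpa using hc.tendsto (t, x)
  refine squeeze_zero' (Eventually.of_forall fun _ => norm_nonneg _) ?_ h1
  have h2 : ∀ᶠ p : ℝ × H in 𝓝 (t, x), |p.1| < |t| + 1 :=
    (continuous_abs.comp continuous_fst).tendsto (t, x) |>.eventually_lt_const (by simp)
  filter_upwards [h2] with p hp
  have e : S.op p.1 p.2 - S.op t x = S.op p.1 (p.2 - x) + (S.op p.1 x - S.op t x) := by
    rw [map_sub]; abel
  rw [e]
  refine (norm_add_le _ _).trans (add_le_add_left ?_ _)
  exact (ContinuousLinearMap.le_opNorm _ _).trans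
    (mul_le_mul_of_nonneg_right (hb _ hp.le) (norm_nonneg _))

theorem continuousOn_op {X : Type*} [TopologicalSpace X] (S : C0Group 𝕜 H) {s : Set X}
    {a : X → ℝ} {b : X → H} (ha : ContinuousOn a s) (hb : ContinuousOn b s) :
    ContinuousOn (fun t => S.op (a t) (b t)) s :=
  S.continuous_op_uncurry.comp_continuousOn (ha.prodMk hb)

end Basic

/-! ### Orbits as differentiable curves, averages, and density of the domain. -/

section Real

variable {𝕜 H : Type*} [RCLike 𝕜] [NormedAddCommGroup H] [InnerProductSpace 𝕜 H]
  [NormedSpace ℝ H] [IsScalarTower ℝ 𝕜 H]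

theorem hasGen_iff_hasDerivAt (S : C0Group 𝕜 H) {x l : H} :
    S.HasGen x l ↔ HasDerivAt (fun t : ℝ => S.op t x) l 0 := by
  rw [hasDerivAt_iff_tendsto_slope_zero]
  unfold HasGen
  refine tendsto_congr fun t => ?_
  rw [zero_add, op_zero_apply, ← RCLike.ofReal_inv, ← RCLike.real_smul_eq_coe_smul]

theorem HasGen.hasDerivAt {S : C0Group 𝕜 H} {x l : H} (h : S.HasGen x l) (t : ℝ) :
    HasDerivAt (fun t : ℝ => S.op t x) (S.op t l) t := by
  have h1 := S.hasGen_iff_hasDerivAt.1 (S.hasGen_op t h)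
  have h2 : HasDerivAt (fun s : ℝ => s - t) 1 t := (hasDerivAt_id t).sub_const t
  have h3 : HasDerivAt (fun s : ℝ => S.op s (S.op t x)) (S.op t l) (t - t) := by rwa [sub_self]
  have h4 := HasDerivAt.scomp (h := fun s : ℝ => s - t) t h3 h2
  rw [one_smul] at h4
  refine h4.congr_of_eventuallyEq (Eventually.of_forall fun s => ?_)
  simp only [Function.comp_apply]
  rw [← op_add_apply, sub_add_cancel]

theorem HasGen.rev {S : C0Group 𝕜 H} {x l : H} (h : S.HasGen x l) : S.rev.HasGen x (-l) := by
  rw [hasGen_iff_hasDerivAt] at *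
  have h3 : HasDerivAt (fun s : ℝ => S.op s x) l (-0) := by rwa [neg_zero]
  have := h3.scomp (0 : ℝ) (hasDerivAt_neg 0)
  rwa [neg_one_smul] at this

variable [CompleteSpace H]

theorem intervalIntegrable_op (S : C0Group 𝕜 H) (x : H) (a b : ℝ) :
    IntervalIntegrable (fun t => S.op t x) volume a b :=
  (S.continuous_op x).intervalIntegrable a b

theorem HasGen.op_sub_eq_integral {S : C0Group 𝕜 H} {x l : H} (h : S.HasGen x l) (a b : ℝ) :
    S.op b x - S.op a x = ∫ t in a..b, S.op t l :=
  (intervalIntegral.integral_eq_sub_of_hasDerivAt (fun t _ => h.hasDerivAt t)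
    (S.intervalIntegrable_op l a b)).symm

theorem op_integral (S : C0Group 𝕜 H) (t : ℝ) (x : H) (a b : ℝ) :
    S.op t (∫ s in a..b, S.op s x) = ∫ s in (a + t)..(b + t), S.op s x := by
  rw [← intervalIntegral.integral_comp_add_right (fun s => S.op s x) t]
  rw [← (S.op t).intervalIntegral_comp_comm (S.intervalIntegrable_op x a b)]
  refine intervalIntegral.integral_congr fun s _ => ?_
  rw [add_comm, op_add_apply]

/-- Applying S(t) translates the interval of integration to (t, ε + t), so the derivative in t is
the difference of the integrand at the two endpoints. -/
theorem hasGen_integral (S : C0Group 𝕜 H) (x : H) (ε : ℝ) :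
    S.HasGen (∫ s in (0 : ℝ)..ε, S.op s x) (S.op ε x - x) := by
  rw [hasGen_iff_hasDerivAt]
  simp only [op_integral, zero_add]
  have key : ∀ t : ℝ, (∫ s in t..(ε + t), S.op s x)
      = (∫ s in (0 : ℝ)..(ε + t), S.op s x) - ∫ s in (0 : ℝ)..t, S.op s x := fun t =>
    (intervalIntegral.integral_interval_sub_left (S.intervalIntegrable_op x _ _)
      (S.intervalIntegrable_op x _ _)).symm
  simp only [key]
  have hd : ∀ b : ℝ, HasDerivAt (fun b => ∫ s in (0 : ℝ)..b, S.op s x) (S.op b x) b := fun b =>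
    intervalIntegral.integral_hasDerivAt_right (S.intervalIntegrable_op x _ _)
      (S.continuous_op x).stronglyMeasurable.stronglyMeasurableAtFilter
      (S.continuous_op x).continuousAt
  have h1 := (hd (ε + 0)).scomp (0 : ℝ) ((hasDerivAt_id (0 : ℝ)).const_add ε)
  have h2 := h1.sub (hd 0)
  rw [one_smul, add_zero, op_zero_apply] at h2
  exact h2

/-- The average `ε⁻¹ ∫₀^ε S(s) ds`. -/
noncomputable def avg (S : C0Group 𝕜 H) (ε : ℝ) : H →L[𝕜] H :=
  LinearMap.mkContinuousOfExistsBound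
    { toFun := fun x => ε⁻¹ • ∫ s in (0 : ℝ)..ε, S.op s x
      map_add' := fun x y => by
        simp only [_root_.map_add]
        rw [intervalIntegral.integral_add (S.intervalIntegrable_op x _ _)
          (S.intervalIntegrable_op y _ _), smul_add]
      map_smul' := fun c x => by
        simp only [_root_.map_smul, RingHom.id_apply]
        rw [intervalIntegral.integral_smul, smul_comm] }
    (by
      obtain ⟨M, hM, hb⟩ := S.exists_norm_op_le_of_abs_le |ε|
      refine ⟨‖ε⁻¹‖ * (M * |ε|), fun x => ?_⟩
      simp only [LinearMap.coe_mk, AddHom.coe_mk]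
      rw [norm_smul, mul_assoc]
      gcongr
      have := intervalIntegral.norm_integral_le_of_norm_le_const (a := 0) (b := ε) (C := M * ‖x‖)
        (f := fun s => S.op s x) (fun s hs => ?_)
      · rw [sub_zero] at this; linarith
      · refine (ContinuousLinearMap.le_opNorm _ _).trans
          (mul_le_mul_of_nonneg_right (hb _ ?_) (norm_nonneg _))
        have := Set.uIoc_subset_uIcc hs
        have := Set.abs_sub_left_of_mem_uIcc this
        simpa using this)

theorem avg_apply (S : C0Group 𝕜 H) (ε : ℝ) (x : H) :
    S.avg ε x = ε⁻¹ • ∫ s in (0 : ℝ)..ε, S.op s x := rfl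

theorem hasGen_avg (S : C0Group 𝕜 H) (ε : ℝ) (x : H) :
    S.HasGen (S.avg ε x) (ε⁻¹ • (S.op ε x - x)) := by
  have := (S.hasGen_integral x ε).smul (((ε⁻¹ : ℝ)) : 𝕜)
  rwa [← RCLike.real_smul_eq_coe_smul, ← RCLike.real_smul_eq_coe_smul] at this

theorem avg_mem_domain (S : C0Group 𝕜 H) (ε : ℝ) (x : H) : S.avg ε x ∈ S.generator.domain :=
  ⟨_, S.hasGen_avg ε x⟩

theorem tendsto_avg (S : C0Group 𝕜 H) (x : H) :
    Tendsto (fun ε : ℝ => S.avg ε x) (𝓝[≠] 0) (𝓝 x) := by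
  have hd : HasDerivAt (fun b => ∫ s in (0 : ℝ)..b, S.op s x) (S.op 0 x) 0 :=
    intervalIntegral.integral_hasDerivAt_right (S.intervalIntegrable_op x _ _)
      (S.continuous_op x).stronglyMeasurable.stronglyMeasurableAtFilter
      (S.continuous_op x).continuousAt
  rw [hasDerivAt_iff_tendsto_slope_zero, op_zero_apply] at hd
  refine hd.congr fun t => ?_
  rw [zero_add, intervalIntegral.integral_same, sub_zero, avg_apply]

/-- A sequence of parameters tending to `0`. -/
theorem tendsto_inv_succ_ne : Tendsto (fun n : ℕ => 1 / ((n : ℝ) + 1)) atTop (𝓝[≠] 0) :=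
  tendsto_nhdsWithin_iff.2 ⟨tendsto_one_div_add_atTop_nhds_zero_nat,
    Eventually.of_forall fun n => (by positivity : (0 : ℝ) < 1 / ((n : ℝ) + 1)).ne'⟩

theorem dense_domain (S : C0Group 𝕜 H) : Dense (S.generator.domain : Set H) := fun x =>
  mem_closure_of_tendsto (S.tendsto_avg x) (Eventually.of_forall fun ε => S.avg_mem_domain ε x)

/-- The average commutes with S(t) and lands in the domain, so its increment along the orbit is the
integral of a bounded function. The integral now runs over an interval of length |t|, whence an
O(|t|) bound in operator norm. -/
theorem op_avg_sub (S : C0Group 𝕜 H) (ε t : ℝ) (x : H) :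
    S.avg ε (S.op t x - x) = ε⁻¹ • ∫ s in (0 : ℝ)..t, S.op s (S.op ε x - x) := by
  have h := (S.hasGen_avg ε x).op_sub_eq_integral 0 t
  rw [op_zero_apply] at h
  have h2 : S.op t (S.avg ε x) = S.avg ε (S.op t x) := by
    rw [avg_apply, avg_apply, (S.op t).map_smul_of_tower,
      ← (S.op t).intervalIntegral_comp_comm (S.intervalIntegrable_op x _ _)]
    congr 1
    exact intervalIntegral.integral_congr fun s _ => S.op_comm t s x
  rw [map_sub, ← h2, h, ← intervalIntegral.integral_smul]
  exact intervalIntegral.integral_congr fun s _ =>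
    (S.op s).map_smul_of_tower _ _

end Real

/-! ### The adjoint group and its strong continuity. -/

section Dual

variable {𝕜 H : Type*} [RCLike 𝕜] [NormedAddCommGroup H] [InnerProductSpace 𝕜 H]
  [NormedSpace ℝ H] [IsScalarTower ℝ 𝕜 H] [CompleteSpace H]

open ContinuousLinearMap in
-- The adjoint family is a priori only weakly continuous. The subspace V of vectors where it is
-- strongly continuous contains the range of every adjoint average. A vector orthogonal to V is thus
-- annihilated by all averages, hence is 0 because the averages tend to the identity. So V is dense,
-- and the local norm bound extends the convergence from V to H.
theorem tendsto_adjoint_op (S : C0Group 𝕜 H) (x : H) :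
    Tendsto (fun t : ℝ => adjoint (S.op t) x) (𝓝 0) (𝓝 x) := by
  obtain ⟨M, hM, hb⟩ := S.exists_norm_op_le_of_abs_le 1
  have hM0 : 0 < M := by linarith
  let V : Submodule 𝕜 H :=
    { carrier := {v | Tendsto (fun t : ℝ => adjoint (S.op t) v) (𝓝 0) (𝓝 v)}
      zero_mem' := by simp
      add_mem' := fun {u v} hu hv => by
        simpa only [mem_ofPred_eq, _root_.map_add] using Tendsto.add hu hv
      smul_mem' := fun c v hv => by
        simpa only [mem_ofPred_eq, _root_.map_smul] using Tendsto.const_smul hv c }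
  have hVd : Dense (V : Set H) := by
    rw [Submodule.dense_iff_topologicalClosure_eq_top, Submodule.topologicalClosure_eq_top_iff,
      Submodule.eq_bot_iff]
    intro z hz
    have h0 : ∀ ε : ℝ, S.avg ε z = 0 := fun ε => by
      refine ext_inner_left 𝕜 fun y => ?_
      have hy : adjoint (S.avg ε) y ∈ V := by
        change Tendsto (fun t : ℝ => adjoint (S.op t) (adjoint (S.avg ε) y)) (𝓝 0)
          (𝓝 (adjoint (S.avg ε) y))
        rw [tendsto_iff_norm_sub_tendsto_zero]
        -- `op_avg_sub` bounds the average composed with S(t) - 1 by C |t| in operator norm; taking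
        -- adjoints preserves this norm.
        obtain ⟨C, hC0, hC⟩ : ∃ C : ℝ, 0 ≤ C ∧ ∀ t : ℝ, |t| ≤ 1 → ∀ x : H,
            ‖S.avg ε (S.op t x - x)‖ ≤ C * |t| * ‖x‖ := by
          refine ⟨|ε⁻¹| * (M * (‖S.op ε‖ + 1)), by positivity, fun t ht x => ?_⟩
          rw [op_avg_sub, norm_smul, Real.norm_eq_abs]
          have h1 := intervalIntegral.norm_integral_le_of_norm_le_const (a := 0) (b := t)
            (C := M * ((‖S.op ε‖ + 1) * ‖x‖)) (f := fun s => S.op s (S.op ε x - x)) (fun s hs => ?_)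
          · rw [sub_zero] at h1
            calc _ ≤ |ε⁻¹| * (M * ((‖S.op ε‖ + 1) * ‖x‖) * |t|) := by gcongr
              _ = _ := by ring
          · refine (ContinuousLinearMap.le_opNorm _ _).trans ?_
            have h2 : |s| ≤ 1 := by
              have := Set.abs_sub_left_of_mem_uIcc (Set.uIoc_subset_uIcc hs)
              simp only [sub_zero] at this
              exact this.trans ht
            have h3 : ‖S.op ε x - x‖ ≤ (‖S.op ε‖ + 1) * ‖x‖ := by
              refine (norm_sub_le _ _).trans ?_
              rw [add_mul, one_mul]
              gcongr
              exact ContinuousLinearMap.le_opNorm _ _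
            exact mul_le_mul (hb s h2) h3 (norm_nonneg _) hM0.le
        have hlim : Tendsto (fun t : ℝ => C * |t| * ‖y‖) (𝓝 0) (𝓝 0) := by
          have : Continuous fun t : ℝ => C * |t| * ‖y‖ := by fun_prop
          simpa using this.tendsto 0
        refine squeeze_zero' (Eventually.of_forall fun _ => norm_nonneg _) ?_ hlim
        have hev : ∀ᶠ t : ℝ in 𝓝 0, |t| < 1 :=
          continuous_abs.tendsto (0 : ℝ) |>.eventually_lt_const (by simp)
        filter_upwards [hev] with t ht
        have h1 : adjoint (S.op t) (adjoint (S.avg ε) y) - adjoint (S.avg ε) y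
            = adjoint ((S.avg ε).comp (S.op t - ContinuousLinearMap.id 𝕜 H)) y := by
          refine ext_inner_right 𝕜 fun x => ?_
          simp [inner_sub_left, adjoint_inner_left]
        rw [h1]
        refine (ContinuousLinearMap.le_opNorm _ _).trans
          (mul_le_mul_of_nonneg_right ?_ (norm_nonneg _))
        rw [LinearIsometryEquiv.norm_map]
        exact ContinuousLinearMap.opNorm_le_bound _ (by positivity) fun x => hC t ht.le x
      rw [inner_zero_right, ← adjoint_inner_left]
      exact hz _ hy
    refine tendsto_nhds_unique (S.tendsto_avg z) ?_
    simp only [h0]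
    exact tendsto_const_nhds
  rw [Metric.tendsto_nhds]
  intro e he
  obtain ⟨v, hxv, hv⟩ := Metric.dense_iff.1 hVd x (e / (2 * (M + 1))) (by positivity)
  have hv' : Tendsto (fun t : ℝ => adjoint (S.op t) v) (𝓝 0) (𝓝 v) := hv
  rw [Metric.mem_ball, lt_div_iff₀ (by positivity)] at hxv
  have hev : ∀ᶠ t : ℝ in 𝓝 0, |t| < 1 :=
    continuous_abs.tendsto (0 : ℝ) |>.eventually_lt_const (by simp)
  filter_upwards [hev, Metric.tendsto_nhds.1 hv' (e / 2) (by positivity)] with t ht htv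
  have h1 : dist (adjoint (S.op t) x) (adjoint (S.op t) v) ≤ M * dist v x := by
    rw [dist_eq_norm, ← map_sub, dist_comm v x, dist_eq_norm]
    refine (ContinuousLinearMap.le_opNorm _ _).trans
      (mul_le_mul_of_nonneg_right ?_ (norm_nonneg _))
    rw [LinearIsometryEquiv.norm_map]
    exact hb t ht.le
  have h2 := dist_triangle4 (adjoint (S.op t) x) (adjoint (S.op t) v) v x
  linarith

open ContinuousLinearMap in
/-- The dual group `t ↦ S(t)*`. -/
noncomputable def dual (S : C0Group 𝕜 H) : C0Group 𝕜 H where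
  op t := adjoint (S.op t)
  map_zero := by
    rw [S.map_zero]
    exact ContinuousLinearMap.ext fun x => ext_inner_right 𝕜 fun y => by
      simp [adjoint_inner_left]
  map_add s t := by rw [add_comm, S.map_add, adjoint_comp]
  tendsto_zero := S.tendsto_adjoint_op

open ContinuousLinearMap in
theorem dual_op (S : C0Group 𝕜 H) (t : ℝ) : S.dual.op t = adjoint (S.op t) := rfl

theorem inner_dual_op_left (S : C0Group 𝕜 H) (t : ℝ) (x y : H) :
    inner 𝕜 (S.dual.op t x) y = inner 𝕜 x (S.op t y) :=
  ContinuousLinearMap.adjoint_inner_left _ _ _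

theorem inner_dual_op_right (S : C0Group 𝕜 H) (t : ℝ) (x y : H) :
    inner 𝕜 x (S.dual.op t y) = inner 𝕜 (S.op t x) y :=
  ContinuousLinearMap.adjoint_inner_right _ _ _

theorem dual_dual_op (S : C0Group 𝕜 H) (t : ℝ) : S.dual.dual.op t = S.op t := by
  rw [dual_op, dual_op, ContinuousLinearMap.adjoint_adjoint]

theorem norm_dual_op (S : C0Group 𝕜 H) (t : ℝ) : ‖S.dual.op t‖ = ‖S.op t‖ :=
  LinearIsometryEquiv.norm_map _ _

/-- This duality moves a smoothing of a weak solution onto its test vectors. -/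
theorem inner_dual_avg (S : C0Group 𝕜 H) (ε : ℝ) (x y : H) :
    inner 𝕜 x (S.dual.avg ε y) = inner 𝕜 (S.avg ε x) y := by
  have h1 : inner 𝕜 x (∫ s in (0 : ℝ)..ε, S.dual.op s y) = ∫ s in (0 : ℝ)..ε, inner 𝕜 x (S.dual.op s y) :=
    ((innerSL 𝕜 x).intervalIntegral_comp_comm (S.dual.intervalIntegrable_op y _ _)).symm
  have h2 : inner 𝕜 y (∫ s in (0 : ℝ)..ε, S.op s x) = ∫ s in (0 : ℝ)..ε, inner 𝕜 y (S.op s x) :=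
    ((innerSL 𝕜 y).intervalIntegral_comp_comm (S.intervalIntegrable_op x _ _)).symm
  have h3 : inner 𝕜 x (∫ s in (0 : ℝ)..ε, S.dual.op s y) = inner 𝕜 (∫ s in (0 : ℝ)..ε, S.op s x) y := by
    rw [← inner_conj_symm (∫ s in (0 : ℝ)..ε, S.op s x) y, h1, h2]
    simp only [intervalIntegral, map_sub, ← integral_conj, inner_conj_symm, inner_dual_op_right]
  rw [avg_apply, avg_apply, RCLike.real_smul_eq_coe_smul (K := 𝕜),
    RCLike.real_smul_eq_coe_smul (K := 𝕜) ε⁻¹ (∫ s in (0 : ℝ)..ε, S.op s x), inner_smul_right,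
    inner_smul_left, RCLike.conj_ofReal, h3]

end Dual

/-! ### The Hilbert space D(A*) and the group restricted to it. -/

section DomAdj

variable {𝕜 H : Type*} [RCLike 𝕜] [NormedAddCommGroup H] [InnerProductSpace 𝕜 H]
  [NormedSpace ℝ H] [IsScalarTower ℝ 𝕜 H] [CompleteSpace H]

theorem vec_add (S : C0Group 𝕜 H) (φ χ : S.DomAdj) : S.vec (φ + χ) = S.vec φ + S.vec χ := rfl
theorem vec_sub (S : C0Group 𝕜 H) (φ χ : S.DomAdj) : S.vec (φ - χ) = S.vec φ - S.vec χ := rfl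
theorem vec_smul (S : C0Group 𝕜 H) (c : 𝕜) (φ : S.DomAdj) : S.vec (c • φ) = c • S.vec φ := rfl
theorem adjGen_add (S : C0Group 𝕜 H) (φ χ : S.DomAdj) :
    S.adjGen (φ + χ) = S.adjGen φ + S.adjGen χ := rfl
theorem adjGen_sub (S : C0Group 𝕜 H) (φ χ : S.DomAdj) :
    S.adjGen (φ - χ) = S.adjGen φ - S.adjGen χ := rfl
theorem adjGen_smul (S : C0Group 𝕜 H) (c : 𝕜) (φ : S.DomAdj) :
    S.adjGen (c • φ) = c • S.adjGen φ := rfl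

theorem norm_sq_domAdj (S : C0Group 𝕜 H) (φ : S.DomAdj) :
    ‖φ‖ ^ 2 = ‖S.vec φ‖ ^ 2 + ‖S.adjGen φ‖ ^ 2 :=
  WithLp.prod_norm_sq_eq_of_L2 (φ : WithLp 2 (H × H))

theorem norm_vec_le (S : C0Group 𝕜 H) (φ : S.DomAdj) : ‖S.vec φ‖ ≤ ‖φ‖ := by
  refine le_of_sq_le_sq ?_ (norm_nonneg _)
  rw [norm_sq_domAdj]
  exact le_add_of_nonneg_right (by positivity)

theorem norm_adjGen_le (S : C0Group 𝕜 H) (φ : S.DomAdj) : ‖S.adjGen φ‖ ≤ ‖φ‖ := by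
  refine le_of_sq_le_sq ?_ (norm_nonneg _)
  rw [norm_sq_domAdj]
  exact le_add_of_nonneg_left (by positivity)

theorem norm_domAdj_le (S : C0Group 𝕜 H) (φ : S.DomAdj) : ‖φ‖ ≤ ‖S.vec φ‖ + ‖S.adjGen φ‖ := by
  refine le_of_sq_le_sq ?_ (by positivity)
  rw [norm_sq_domAdj]
  nlinarith [norm_nonneg (S.vec φ), norm_nonneg (S.adjGen φ)]

/-- `φ ↦ φ` as a bounded operator from `D(A*)` to `H`. -/
noncomputable def vecL (S : C0Group 𝕜 H) : S.DomAdj →L[𝕜] H :=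
  LinearMap.mkContinuous ⟨⟨S.vec, S.vec_add⟩, S.vec_smul⟩ 1 fun φ => by
    rw [one_mul]; exact S.norm_vec_le φ

/-- `φ ↦ A* φ` as a bounded operator from `D(A*)` to `H`. -/
noncomputable def adjGenL (S : C0Group 𝕜 H) : S.DomAdj →L[𝕜] H :=
  LinearMap.mkContinuous ⟨⟨S.adjGen, S.adjGen_add⟩, S.adjGen_smul⟩ 1 fun φ => by
    rw [one_mul]; exact S.norm_adjGen_le φ

@[simp] theorem vecL_apply (S : C0Group 𝕜 H) (φ : S.DomAdj) : S.vecL φ = S.vec φ := rfl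

theorem continuous_vec (S : C0Group 𝕜 H) : Continuous S.vec := S.vecL.continuous
theorem continuous_adjGen (S : C0Group 𝕜 H) : Continuous S.adjGen := S.adjGenL.continuous

theorem inner_adjGen (S : C0Group 𝕜 H) (φ : S.DomAdj) (x : S.generator.domain) :
    inner 𝕜 (S.adjGen φ) (x : H) = inner 𝕜 (S.vec φ) (S.generator x) := by
  rw [adjGen_eq]
  exact LinearPMap.adjoint_isFormalAdjoint S.dense_domain ⟨S.vec φ, S.vec_mem φ⟩ x

theorem generator_eq (S : C0Group 𝕜 H) {x l : H} (h : S.HasGen x l) :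
    S.generator ⟨x, l, h⟩ = l :=
  (S.generator_spec ⟨x, l, h⟩).unique h

theorem HasGen.inner_adjGen {S : C0Group 𝕜 H} {x l : H} (h : S.HasGen x l) (φ : S.DomAdj) :
    inner 𝕜 (S.adjGen φ) x = inner 𝕜 (S.vec φ) l := by
  have := S.inner_adjGen φ ⟨x, l, h⟩
  rwa [generator_eq S h] at this

theorem vec_injective (S : C0Group 𝕜 H) : Function.Injective S.vec := by
  intro φ χ h
  have h2 : S.adjGen φ = S.adjGen χ := by
    rw [adjGen_eq, adjGen_eq]; congr 1; exact Subtype.ext h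
  have h3 : ‖φ - χ‖ ≤ 0 := by
    refine (S.norm_domAdj_le _).trans ?_
    rw [vec_sub, adjGen_sub, h, h2, sub_self, sub_self, norm_zero, add_zero]
  exact sub_eq_zero.1 (norm_le_zero_iff.1 h3)

/-- An element of the domain of the generator of the dual group, as an element of `D(A*)`. -/
noncomputable def ofHasGen (S : C0Group 𝕜 H) {v l : H} (h : S.dual.HasGen v l) : S.DomAdj :=
  ⟨WithLp.toLp 2 (v, l), by
    have key : ∀ x : S.generator.domain, inner 𝕜 l (x : H) = inner 𝕜 v (S.generator x) := by
      intro x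
      have h1 := Tendsto.inner (𝕜 := 𝕜) h (tendsto_const_nhds (x := (x : H)))
      have h2 := Tendsto.inner (𝕜 := 𝕜) (tendsto_const_nhds (x := v)) (S.generator_spec x)
      refine tendsto_nhds_unique h1 (h2.congr fun t => ?_)
      rw [inner_smul_left, inner_smul_right, inner_sub_left, inner_sub_right, inner_dual_op_left,
        map_inv₀, RCLike.conj_ofReal]
    have hv : v ∈ S.generator†.domain := LinearPMap.mem_adjoint_domain_of_exists v ⟨l, key⟩
    have e : S.generator† ⟨v, hv⟩ = l := LinearPMap.adjoint_apply_eq S.dense_domain ⟨v, hv⟩ key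
    have := S.generator†.mem_graph ⟨v, hv⟩
    rw [e] at this
    exact this⟩

@[simp] theorem vec_ofHasGen (S : C0Group 𝕜 H) {v l : H} (h : S.dual.HasGen v l) :
    S.vec (S.ofHasGen h) = v := rfl
@[simp] theorem adjGen_ofHasGen (S : C0Group 𝕜 H) {v l : H} (h : S.dual.HasGen v l) :
    S.adjGen (S.ofHasGen h) = l := rfl

theorem adjGen_eq_of_hasGen (S : C0Group 𝕜 H) (φ : S.DomAdj) {l : H}
    (h : S.dual.HasGen (S.vec φ) l) : S.adjGen φ = l := by
  have e : φ = S.ofHasGen h := S.vec_injective rfl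
  rw [e, adjGen_ofHasGen]

/-- The averages of the dual group as bounded operators from `H` to `D(A*)`. -/
noncomputable def smooth (S : C0Group 𝕜 H) (ε : ℝ) : H →L[𝕜] S.DomAdj :=
  LinearMap.mkContinuousOfExistsBound
    { toFun := fun x => S.ofHasGen (S.dual.hasGen_avg ε x)
      map_add' := fun x y => S.vec_injective (by
        rw [vec_add]; simp only [vec_ofHasGen, _root_.map_add])
      map_smul' := fun c x => S.vec_injective (by
        simp only [RingHom.id_apply, vec_smul, vec_ofHasGen, _root_.map_smul]) }
    (by
      refine ⟨‖S.dual.avg ε‖ + ‖ε⁻¹‖ * (‖S.dual.op ε‖ + 1), fun x => ?_⟩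
      refine (S.norm_domAdj_le _).trans ?_
      simp only [LinearMap.coe_mk, AddHom.coe_mk, vec_ofHasGen, adjGen_ofHasGen]
      rw [add_mul]
      refine add_le_add (ContinuousLinearMap.le_opNorm _ _) ?_
      rw [norm_smul, mul_assoc]
      gcongr
      refine (norm_sub_le _ _).trans ?_
      rw [add_mul, one_mul]
      gcongr
      exact ContinuousLinearMap.le_opNorm _ _)

@[simp] theorem vec_smooth (S : C0Group 𝕜 H) (ε : ℝ) (x : H) :
    S.vec (S.smooth ε x) = S.dual.avg ε x := rfl

theorem denseRange_vec (S : C0Group 𝕜 H) : DenseRange S.vec := fun x =>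
  mem_closure_of_tendsto (S.dual.tendsto_avg x)
    (Eventually.of_forall fun ε => ⟨S.smooth ε x, rfl⟩)

/-- The graph of an adjoint is closed. Completeness makes the preceding theory of averages and
generators applicable to the restricted group. -/
instance (S : C0Group 𝕜 H) : CompleteSpace S.DomAdj := by
  have hc : IsClosed (S.generator†.graph : Set (H × H)) :=
    LinearPMap.adjoint_isClosed S.dense_domain
  have hc2 : IsClosed (S.DomAdj : Set (WithLp 2 (H × H))) :=
    hc.preimage (WithLp.prod_continuous_ofLp 2 H H)
  exact hc2.isComplete.completeSpace_coe

theorem vec_adjOp (S : C0Group 𝕜 H) (t : ℝ) (φ : S.DomAdj) :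
    S.vec (S.adjOp t φ) = S.dual.op t (S.vec φ) := rfl

/-- Testing against the dense domain of A reduces the claim to the fact that A commutes with S(t).
-/
theorem adjGen_adjOp (S : C0Group 𝕜 H) (t : ℝ) (φ : S.DomAdj) :
    S.adjGen (S.adjOp t φ) = S.dual.op t (S.adjGen φ) := by
  refine S.dense_domain.eq_of_inner_left (𝕜 := 𝕜) fun x hx => ?_
  rw [S.inner_adjGen _ ⟨x, hx⟩, vec_adjOp, inner_dual_op_left, inner_dual_op_left]
  exact ((S.inner_adjGen φ ⟨_, S.op_mem_domain t ⟨x, hx⟩⟩).trans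
    (by rw [S.generator_op t ⟨x, hx⟩])).symm

theorem tendsto_domAdj_iff (S : C0Group 𝕜 H) {α : Type*} {F : Filter α} {a : α → S.DomAdj}
    {φ : S.DomAdj} : Tendsto a F (𝓝 φ) ↔
      Tendsto (fun t => S.vec (a t)) F (𝓝 (S.vec φ)) ∧
      Tendsto (fun t => S.adjGen (a t)) F (𝓝 (S.adjGen φ)) := by
  refine ⟨fun h => ⟨(S.continuous_vec.tendsto φ).comp h, (S.continuous_adjGen.tendsto φ).comp h⟩,
    fun ⟨h1, h2⟩ => ?_⟩
  rw [tendsto_iff_norm_sub_tendsto_zero] at *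
  have h3 := h1.add h2
  rw [add_zero] at h3
  exact squeeze_zero (fun _ => norm_nonneg _) (fun t => S.norm_domAdj_le _) h3

theorem norm_adjOp_le (S : C0Group 𝕜 H) (t : ℝ) (φ : S.DomAdj) :
    ‖S.adjOp t φ‖ ≤ ‖S.op t‖ * ‖φ‖ := by
  refine le_of_sq_le_sq ?_ (by positivity)
  rw [mul_pow, norm_sq_domAdj, norm_sq_domAdj, vec_adjOp, adjGen_adjOp, mul_add, ← mul_pow,
    ← mul_pow, ← norm_dual_op]
  gcongr <;> exact ContinuousLinearMap.le_opNorm _ _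

/-- The restriction of the dual group to `D(A*)`. -/
noncomputable def domGroup (S : C0Group 𝕜 H) : C0Group 𝕜 S.DomAdj where
  op t := LinearMap.mkContinuous
    ⟨⟨S.adjOp t, fun φ χ => S.vec_injective (by
        simp only [vec_adjOp, vec_add, _root_.map_add])⟩,
      fun c φ => S.vec_injective (by
        simp only [vec_adjOp, vec_smul, _root_.map_smul, RingHom.id_apply])⟩
    ‖S.op t‖ fun φ => S.norm_adjOp_le t φ
  map_zero := ContinuousLinearMap.ext fun φ => S.vec_injective (S.dual.op_zero_apply _)
  map_add s t := ContinuousLinearMap.ext fun φ => S.vec_injective (S.dual.op_add_apply s t _)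
  tendsto_zero φ := by
    refine S.tendsto_domAdj_iff.2 ⟨S.dual.tendsto_zero (S.vec φ), ?_⟩
    refine (S.dual.tendsto_zero (S.adjGen φ)).congr fun t => ?_
    exact (S.adjGen_adjOp t φ).symm

@[simp] theorem vec_domGroup (S : C0Group 𝕜 H) (t : ℝ) (φ : S.DomAdj) :
    S.vec (S.domGroup.op t φ) = S.dual.op t (S.vec φ) := rfl

theorem norm_domGroup_le (S : C0Group 𝕜 H) (t : ℝ) : ‖S.domGroup.op t‖ ≤ ‖S.op t‖ :=
  ContinuousLinearMap.opNorm_le_bound _ (norm_nonneg _) fun φ => S.norm_adjOp_le t φ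

/-- Graph-norm convergence of the difference quotients implies convergence in H. The vectors φ in
question are the smooth test vectors used later: their orbits are differentiable in D(A*), where B*
is bounded. -/
theorem HasGen.adjGen_eq_vec {S : C0Group 𝕜 H} {φ l : S.DomAdj} (h : S.domGroup.HasGen φ l) :
    S.adjGen φ = S.vec l := by
  refine S.adjGen_eq_of_hasGen φ ?_
  exact ((S.continuous_vec.tendsto l).comp h)

end DomAdj

/-! ### Distributional derivatives of scalar functions. -/

section Distribution

variable {𝕜 : Type*} [RCLike 𝕜]

/-- Smooth approximations of the indicator function of `(a, b)`. -/
theorem exists_isTest_seq {T a b : ℝ} (ha : 0 < a) (hab : a < b) (hb : b < T) :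
    ∃ (ρ : ℕ → ContDiffBump (0 : ℝ)) (ψ : ℕ → ℝ → ℝ), Tendsto (fun n => (ρ n).rOut) atTop (𝓝 0) ∧
      (∀ n, IsTest T (ψ n)) ∧
      (∀ n t, deriv (ψ n) t = (ρ n).normed volume (a - t) - (ρ n).normed volume (b - t)) ∧
      (∀ n t, |ψ n t| ≤ 1) ∧
      ∀ t, t ≠ a → t ≠ b → Tendsto (fun n => ψ n t) atTop (𝓝 ((Ioc a b).indicator 1 t)) := by
  -- Half the distance from {a, b} to the complement of (0, T): mollifying the indicator at scales
  -- at most r keeps the support inside (0, T).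
  set r : ℝ := min a (T - b) / 2 with hr
  have hr0 : 0 < r := by rw [hr]; have : 0 < min a (T - b) := lt_min ha (by linarith); positivity
  have hra : r < a := by
    have := min_le_left a (T - b); rw [hr]; linarith
  have hrb : r < T - b := by
    have := min_le_right a (T - b); rw [hr]; linarith
  let ρ : ℕ → ContDiffBump (0 : ℝ) := fun n =>
    ⟨r / (2 * ((n : ℝ) + 1)), r / ((n : ℝ) + 1), by positivity, by
      apply div_lt_div_of_pos_left hr0 (by positivity); linarith [Nat.cast_nonneg (α := ℝ) n]⟩
  have hrout : ∀ n, (ρ n).rOut ≤ r := fun n => by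
    change r / ((n : ℝ) + 1) ≤ r
    exact div_le_self hr0.le (by linarith [Nat.cast_nonneg (α := ℝ) n])
  have htend : Tendsto (fun n => (ρ n).rOut) atTop (𝓝 0) := by
    have := (tendsto_one_div_add_atTop_nhds_zero_nat (𝕜 := ℝ)).const_mul r
    simpa [ρ, div_eq_mul_inv] using this
  let g : ℕ → ℝ → ℝ := fun n => (ρ n).normed volume
  have hgc : ∀ n, Continuous (g n) := fun n => (ρ n).continuous_normed
  have hg0 : ∀ n t, 0 ≤ g n t := fun n t => (ρ n).nonneg_normed t
  have hgi : ∀ n, Integrable (g n) := fun n => (ρ n).integrable_normed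
  have hgs : ∀ n t, (ρ n).rOut ≤ |t| → g n t = 0 := fun n t ht => by
    by_contra hc
    have : t ∈ Function.support (g n) := hc
    rw [(ρ n).support_normed_eq, mem_ball_zero_iff, Real.norm_eq_abs] at this
    linarith
  let P : ℕ → ℝ → ℝ := fun n t => ∫ s in (0 : ℝ)..t, g n s
  have hP : ∀ n t, HasDerivAt (P n) (g n t) t := fun n t =>
    intervalIntegral.integral_hasDerivAt_right ((hgc n).intervalIntegrable _ _)
      (hgc n).stronglyMeasurable.stronglyMeasurableAtFilter (hgc n).continuousAt
  have hPs : ∀ n, ContDiff ℝ ∞ (P n) := fun n => by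
    rw [contDiff_infty_iff_deriv]
    refine ⟨fun t => (hP n t).differentiableAt, ?_⟩
    rw [show deriv (P n) = g n from funext fun t => (hP n t).deriv]
    exact (ρ n).contDiff_normed
  let ψ : ℕ → ℝ → ℝ := fun n t => P n (t - a) - P n (t - b)
  have hψ : ∀ n t, ψ n t = ∫ s in (t - b)..(t - a), g n s := fun n t =>
    intervalIntegral.integral_interval_sub_left ((hgc n).intervalIntegrable _ _)
      ((hgc n).intervalIntegrable _ _)
  have hle : ∀ t, t - b ≤ t - a := fun t => by linarith
  have hψl : ∀ n t, t ≤ a - (ρ n).rOut → ψ n t = 0 := fun n t ht => by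
    rw [hψ, intervalIntegral.integral_of_le (hle t)]
    refine setIntegral_eq_zero_of_forall_eq_zero fun s hs => hgs n s ?_
    rw [abs_of_nonpos (by linarith [hs.2, (ρ n).rOut_pos])]; linarith [hs.2]
  have hψr : ∀ n t, b + (ρ n).rOut ≤ t → ψ n t = 0 := fun n t ht => by
    rw [hψ, intervalIntegral.integral_of_le (hle t)]
    refine setIntegral_eq_zero_of_forall_eq_zero fun s hs => hgs n s ?_
    rw [abs_of_nonneg (by linarith [hs.1, (ρ n).rOut_pos])]; linarith [hs.1]
  have hsupp : ∀ n, tsupport (ψ n) ⊆ Icc (a - r) (b + r) := fun n => by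
    refine closure_minimal (fun t ht => ?_) isClosed_Icc
    by_contra hc
    rw [mem_Icc, not_and_or, not_le, not_le] at hc
    refine ht ?_
    rcases hc with hc | hc
    · exact hψl n t (by linarith [hrout n])
    · exact hψr n t (by linarith [hrout n])
  refine ⟨ρ, ψ, htend, fun n => ⟨?_, ?_, ?_⟩, fun n t => ?_, fun n t => ?_, fun t hta htb => ?_⟩
  · exact ((hPs n).comp (contDiff_id.sub contDiff_const)).sub
      ((hPs n).comp (contDiff_id.sub contDiff_const))
  · exact IsCompact.of_isClosed_subset isCompact_Icc (isClosed_tsupport _) (hsupp n)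
  · exact (hsupp n).trans (Icc_subset_Ioo (by linarith) (by linarith))
  · have h1 : HasDerivAt (ψ n) (g n (t - a) - g n (t - b)) t :=
      ((hP n (t - a)).comp_sub_const t a).sub ((hP n (t - b)).comp_sub_const t b)
    rw [h1.deriv, ← neg_sub a t, ← neg_sub b t]
    simp only [g, ContDiffBump.normed_neg]
  · rw [hψ, intervalIntegral.integral_of_le (hle t), abs_of_nonneg
      (setIntegral_nonneg measurableSet_Ioc fun s _ => hg0 n s)]
    exact (setIntegral_le_integral (hgi n) (Eventually.of_forall (hg0 n))).trans_eq
      (ρ n).integral_normed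
  · by_cases hmem : t ∈ Ioc a b
    · rw [indicator_of_mem hmem, Pi.one_apply]
      have htb' : t < b := lt_of_le_of_ne hmem.2 htb
      have hev : ∀ᶠ n in atTop, (ρ n).rOut < min (t - a) (b - t) :=
        htend.eventually_lt_const (lt_min (by linarith [hmem.1]) (by linarith))
      refine tendsto_const_nhds.congr' ?_
      filter_upwards [hev] with n hn
      rw [hψ, intervalIntegral.integral_of_le (hle t), setIntegral_eq_integral_of_forall_compl_eq_zero,
        (ρ n).integral_normed]
      intro s hs
      refine hgs n s ?_
      rw [mem_Ioc, not_and_or, not_lt, not_le] at hs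
      rw [lt_min_iff] at hn
      rcases hs with hs | hs
      · exact le_abs.2 (Or.inr (by linarith [hn.2]))
      · exact le_abs.2 (Or.inl (by linarith [hn.1]))
    · rw [indicator_of_notMem hmem]
      refine tendsto_const_nhds.congr' ?_
      rw [mem_Ioc, not_and_or, not_lt, not_le] at hmem
      rcases hmem with hm | hm
      · have hm' : t < a := lt_of_le_of_ne hm hta
        filter_upwards [htend.eventually_lt_const (show 0 < a - t by linarith)] with n hn
        exact (hψl n t (by linarith)).symm
      · filter_upwards [htend.eventually_lt_const (show 0 < t - b by linarith)] with n hn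
        exact (hψr n t (by linarith)).symm

open ContinuousLinearMap in
-- Convolution with an approximate identity, evaluated at a; F is extended by zero outside (0, T),
-- which does not affect its continuity at the interior point a.
theorem tendsto_integral_normed_mul {T a : ℝ} {F : ℝ → 𝕜} (hF : ContinuousOn F (Icc 0 T))
    (ha : a ∈ Ioo 0 T) {ρ : ℕ → ContDiffBump (0 : ℝ)}
    (hρ : Tendsto (fun n => (ρ n).rOut) atTop (𝓝 0)) :
    Tendsto (fun n => ∫ t in Ioo 0 T, (((ρ n).normed volume (a - t) : ℝ) : 𝕜) * F t) atTop
      (𝓝 (F a)) := by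
  have hFo : ContinuousOn F (Ioo 0 T) := hF.mono Ioo_subset_Icc_self
  have hm : AEStronglyMeasurable ((Ioo 0 T).indicator F) volume :=
    (aestronglyMeasurable_indicator_iff measurableSet_Ioo).2
      (hFo.aestronglyMeasurable measurableSet_Ioo)
  have hc : Tendsto ((Ioo 0 T).indicator F) (𝓝 a) (𝓝 (F a)) := by
    have h1 : Tendsto F (𝓝 a) (𝓝 (F a)) := hFo.continuousAt (isOpen_Ioo.mem_nhds ha)
    refine h1.congr' ?_
    filter_upwards [isOpen_Ioo.mem_nhds ha] with t ht
    rw [indicator_of_mem ht]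
  have := ContDiffBump.convolution_tendsto_right (μ := volume) (φ := ρ) (l := atTop)
    (g := fun _ => (Ioo 0 T).indicator F) (k := fun _ => a) (x₀ := a) (z₀ := F a) hρ
    (Eventually.of_forall fun _ => hm) (hc.comp tendsto_snd) tendsto_const_nhds
  refine this.congr fun n => ?_
  rw [convolution_eq_swap, ← integral_indicator measurableSet_Ioo]
  refine integral_congr_ae (Eventually.of_forall fun t => ?_)
  by_cases ht : t ∈ Ioo 0 T
  · simp only [indicator_of_mem ht, lsmul_apply, RCLike.real_smul_eq_coe_mul]
  · simp only [indicator_of_notMem ht, lsmul_apply, smul_zero]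

/-- Test with mollified indicators of (a, b]: their derivatives concentrate at a and b and recover
the values of F, while dominated convergence treats the side of h. -/
theorem DistDeriv.sub_eq_integral_of_lt {T : ℝ} {F h : ℝ → 𝕜} (hd : DistDeriv T F h)
    (hF : ContinuousOn F (Icc 0 T)) (hh : IntegrableOn h (Ioo 0 T)) {a b : ℝ}
    (ha : 0 < a) (hab : a < b) (hb : b < T) : F b - F a = ∫ t in a..b, h t := by
  obtain ⟨ρ, ψ, hρ, htest, hder, hbd, hlim⟩ := exists_isTest_seq ha hab hb
  have hFi : IntegrableOn F (Ioo 0 T) :=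
    (hF.integrableOn_compact (μ := volume) isCompact_Icc).mono_set Ioo_subset_Icc_self
  have hint : ∀ (n : ℕ) (c : ℝ), IntegrableOn
      (fun t => (((ρ n).normed volume (c - t) : ℝ) : 𝕜) * F t) (Ioo 0 T) := fun n c => by
    refine IntegrableOn.mono_set ?_ Ioo_subset_Icc_self
    refine ContinuousOn.integrableOn_compact isCompact_Icc ?_
    refine ContinuousOn.mul (Continuous.continuousOn ?_) hF
    exact RCLike.continuous_ofReal.comp ((ρ n).continuous_normed.comp (by fun_prop))
  have h1 : Tendsto (fun n => -∫ t in Ioo 0 T, ((deriv (ψ n) t : ℝ) : 𝕜) * F t) atTop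
      (𝓝 (-(F a - F b))) := by
    refine (((tendsto_integral_normed_mul hF ⟨ha, hab.trans hb⟩ hρ).sub
      (tendsto_integral_normed_mul hF ⟨ha.trans hab, hb⟩ hρ)).neg).congr fun n => ?_
    rw [← integral_sub (hint n a) (hint n b)]
    congr 1
    refine integral_congr_ae (Eventually.of_forall fun t => ?_)
    simp only [hder]
    push_cast
    ring
  have h2 : Tendsto (fun n => ∫ t in Ioo 0 T, ((ψ n t : ℝ) : 𝕜) * h t) atTop
      (𝓝 (∫ t in Ioo 0 T, (Ioc a b).indicator h t)) := by
    refine tendsto_integral_of_dominated_convergence (fun t => ‖h t‖) (fun n => ?_) hh.norm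
      (fun n => Eventually.of_forall fun t => ?_) ?_
    · exact (RCLike.continuous_ofReal.comp (htest n).1.continuous).aestronglyMeasurable.mul
        hh.aestronglyMeasurable
    · rw [norm_mul, RCLike.norm_ofReal]
      exact mul_le_of_le_one_left (norm_nonneg _) (hbd n t)
    · have hne : ∀ᵐ t ∂(volume.restrict (Ioo 0 T)), t ∉ ({a, b} : Set ℝ) :=
        ae_restrict_of_ae (measure_eq_zero_iff_ae_notMem.1 ((Set.toFinite {a, b}).measure_zero _))
      filter_upwards [hne] with t ht
      simp only [mem_insert_iff, mem_singleton_iff, not_or] at ht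
      have h3 := ((RCLike.continuous_ofReal (K := 𝕜)).tendsto _).comp (hlim t ht.1 ht.2)
      have h4 := h3.mul_const (h t)
      by_cases hm : t ∈ Ioc a b
      · simpa [indicator_of_mem hm] using h4
      · simpa [indicator_of_notMem hm] using h4
  have h3 := tendsto_nhds_unique h1 (h2.congr fun n => (hd (ψ n) (htest n)).symm)
  rw [neg_sub] at h3
  rw [h3, setIntegral_indicator measurableSet_Ioc, intervalIntegral.integral_of_le hab.le]
  congr 2
  exact inter_eq_right.2 fun t ht => ⟨ha.trans ht.1, ht.2.trans_lt hb⟩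

/-- A continuous function whose distributional derivative is integrable is a primitive of it. -/
theorem DistDeriv.sub_eq_integral {T : ℝ} {F h : ℝ → 𝕜} (hd : DistDeriv T F h)
    (hF : ContinuousOn F (Icc 0 T)) (hh : IntegrableOn h (Ioo 0 T)) {a b : ℝ}
    (ha : 0 ≤ a) (hab : a ≤ b) (hb : b ≤ T) : F b - F a = ∫ t in a..b, h t := by
  rcases hab.eq_or_lt with rfl | hab
  · simp
  have hT : 0 < T := by linarith
  have hhi : IntegrableOn h (Icc 0 T) := (integrableOn_Icc_iff_integrableOn_Ioo).2 hh
  have hhI : IntervalIntegrable h volume 0 T :=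
    (intervalIntegrable_iff_integrableOn_Icc_of_le hT.le).2 hhi
  have hprim : ContinuousOn (fun t => ∫ s in (0 : ℝ)..t, h s) (Icc 0 T) := by
    have := intervalIntegral.continuousOn_primitive_interval (μ := volume) (f := h) (a := 0) (b := T)
      (by rwa [uIcc_of_le hT.le])
    rwa [uIcc_of_le hT.le] at this
  -- G is constant on the open interval by the interior case, hence on the closed one by continuity;
  -- this brings in the endpoints 0 and T.
  set G : ℝ → 𝕜 := fun t => F t - ∫ s in (0 : ℝ)..t, h s with hG
  have hGc : ContinuousOn G (Icc 0 T) := hF.sub hprim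
  have hsub : ∀ {c d : ℝ}, c ∈ Icc 0 T → d ∈ Icc 0 T →
      (∫ s in (0 : ℝ)..d, h s) - ∫ s in (0 : ℝ)..c, h s = ∫ s in c..d, h s := fun {c d} hc hd =>
    intervalIntegral.integral_interval_sub_left
      (hhI.mono_set (by rw [uIcc_of_le hd.1, uIcc_of_le hT.le]; exact Icc_subset_Icc_right hd.2))
      (hhI.mono_set (by rw [uIcc_of_le hc.1, uIcc_of_le hT.le]; exact Icc_subset_Icc_right hc.2))
  have hconst : ∀ t ∈ Ioo 0 T, G t = G (T / 2) := by
    have key : ∀ {c d : ℝ}, 0 < c → c < d → d < T → G d = G c := fun {c d} hc hcd hd' => by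
      have h1 := hd.sub_eq_integral_of_lt hF hh hc hcd hd'
      rw [← hsub ⟨hc.le, (hcd.trans hd').le⟩ ⟨(hc.trans hcd).le, hd'.le⟩] at h1
      simp only [hG]
      linear_combination h1
    intro t ht
    rcases lt_trichotomy t (T / 2) with h | h | h
    · exact (key ht.1 h (by linarith)).symm
    · rw [h]
    · exact key (by linarith) h ht.2
  have hEq : EqOn G (fun _ => G (T / 2)) (Icc 0 T) := by
    refine Set.EqOn.of_subset_closure hconst hGc continuousOn_const Ioo_subset_Icc_self ?_
    rw [closure_Ioo hT.ne]
  have e1 := hEq ⟨ha, hab.le.trans hb⟩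
  have e2 := hEq ⟨ha.trans hab.le, hb⟩
  rw [← hsub ⟨ha, hab.le.trans hb⟩ ⟨ha.trans hab.le, hb⟩]
  simp only [hG] at e1 e2
  linear_combination e2 - e1

end Distribution

/-! ### From weak solutions to the variation of constants formula. -/

section Mild

variable {𝕜 H : Type*} [RCLike 𝕜] [NormedAddCommGroup H] [InnerProductSpace 𝕜 H]
  [NormedSpace ℝ H] [IsScalarTower ℝ 𝕜 H] [CompleteSpace H]

theorem ContinuousOn.integrableOn_Ioo {E : Type*} [NormedAddCommGroup E] {h : ℝ → E} {T : ℝ}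
    (hc : ContinuousOn h (Icc 0 T)) : IntegrableOn h (Ioo 0 T) :=
  (hc.integrableOn_compact isCompact_Icc).mono_set Ioo_subset_Icc_self

theorem DistDeriv.hasDerivAt {T : ℝ} {F h : ℝ → 𝕜} (hd : DistDeriv T F h)
    (hF : ContinuousOn F (Icc 0 T)) (hh : ContinuousOn h (Icc 0 T)) {s : ℝ} (hs : s ∈ Ioo 0 T) :
    HasDerivAt F (h s) s := by
  have hT : 0 ≤ T := (hs.1.trans hs.2).le
  have h1 : HasDerivAt (fun t => F 0 + ∫ τ in (0 : ℝ)..t, h τ) (h s) s := by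
    refine HasDerivAt.const_add _ (intervalIntegral.integral_hasDerivAt_right ?_ ?_ ?_)
    · refine (hh.mono ?_).intervalIntegrable
      rw [uIcc_of_le hs.1.le]
      exact Icc_subset_Icc_right hs.2.le
    · exact ContinuousOn.stronglyMeasurableAtFilter isOpen_Ioo (hh.mono Ioo_subset_Icc_self) s hs
    · exact hh.continuousAt (Icc_mem_nhds hs.1 hs.2)
  refine h1.congr_of_eventuallyEq ?_
  filter_upwards [Icc_mem_nhds hs.1 hs.2] with t ht
  rw [← hd.sub_eq_integral hF (ContinuousOn.integrableOn_Ioo hh) le_rfl ht.1 ht.2, add_sub_cancel]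

/-- Product rule for `⟪a(t), z(t)⟫` when `a` is differentiable at `s`, and `z` is continuous there
and differentiable when tested against the fixed vector `a(s)`. -/
theorem hasDerivAt_inner_of_weak {a z : ℝ → H} {a' : H} {s : ℝ} {m : 𝕜} (ha : HasDerivAt a a' s)
    (hz : ContinuousAt z s) (hw : HasDerivAt (fun t => inner 𝕜 (a s) (z t)) m s) :
    HasDerivAt (fun t => inner 𝕜 (a t) (z t)) (inner 𝕜 a' (z s) + m) s := by
  rw [hasDerivAt_iff_tendsto_slope] at *
  refine ((ha.inner (𝕜 := 𝕜) (hz.tendsto.mono_left nhdsWithin_le_nhds)).add hw).congr fun t => ?_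
  simp only [slope, vsub_eq_sub]
  rw [RCLike.real_smul_eq_coe_smul (K := 𝕜) _ (a t - a s), inner_smul_left, RCLike.conj_ofReal,
    RCLike.real_smul_eq_coe_mul, RCLike.real_smul_eq_coe_mul, ← mul_add, inner_sub_left]
  congr 1
  ring

/-- Weak solutions of `z' = -K* z + k`, where `K` generates a strongly continuous group, satisfy
the variation of constants formula. -/
theorem mild_of_weak (K : C0Group 𝕜 H) {T : ℝ} {z k : ℝ → H} (hz : ContinuousOn z (Icc 0 T))
    (hk : ContinuousOn k (Icc 0 T))
    (hw : ∀ x l, K.HasGen x l →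
      DistDeriv T (fun t => inner 𝕜 x (z t)) (fun t => -inner 𝕜 l (z t) + inner 𝕜 x (k t)))
    {s t : ℝ} (hs : 0 ≤ s) (hst : s ≤ t) (ht : t ≤ T) :
    K.dual.op t (z t) - K.dual.op s (z s) = ∫ τ in s..t, K.dual.op τ (k τ) := by
  have hsub : Icc s t ⊆ Icc 0 T := Icc_subset_Icc hs ht
  have hint : IntervalIntegrable (fun τ => K.dual.op τ (k τ)) volume s t := by
    refine ContinuousOn.intervalIntegrable ?_
    rw [uIcc_of_le hst]
    exact K.dual.continuousOn_op continuousOn_id (hk.mono hsub)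
  refine K.dense_domain.eq_of_inner_right (𝕜 := 𝕜) fun x hx => ?_
  obtain ⟨l, hl⟩ := hx
  have h1 : inner 𝕜 x (∫ τ in s..t, K.dual.op τ (k τ)) = ∫ τ in s..t, inner 𝕜 (K.op τ x) (k τ) := by
    rw [← innerSL_apply_apply 𝕜, ← (innerSL 𝕜 x).intervalIntegral_comp_comm hint]
    exact intervalIntegral.integral_congr fun τ _ => K.inner_dual_op_right τ x (k τ)
  rw [h1, inner_sub_right, inner_dual_op_right, inner_dual_op_right]
  have hcx : ContinuousOn (fun τ => K.op τ x) (Icc 0 T) := (K.continuous_op x).continuousOn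
  refine (intervalIntegral.integral_eq_sub_of_hasDerivAt_of_le hst
    (f := fun τ => inner 𝕜 (K.op τ x) (z τ)) ((hcx.inner hz).mono hsub) (fun τ hτ => ?_) ?_).symm
  · have hτ' : τ ∈ Ioo 0 T := ⟨hs.trans_lt hτ.1, hτ.2.trans_le ht⟩
    -- The test vector K(τ)x moves with time and stays in the domain. In the product rule its own
    -- derivative cancels the generator term of the weak equation, and only the pairing with k
    -- survives.
    have hg := K.hasGen_op τ hl
    have h2 := (hw _ _ hg).hasDerivAt (continuousOn_const.inner hz)
      ((continuousOn_const.inner hz).neg.add (continuousOn_const.inner hk)) hτ'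
    have h3 := hasDerivAt_inner_of_weak (𝕜 := 𝕜) (a := fun τ => K.op τ x) (hl.hasDerivAt τ)
      (hz.continuousAt (Icc_mem_nhds hτ'.1 hτ'.2)) h2
    rwa [add_neg_cancel_left] at h3
  · refine ContinuousOn.intervalIntegrable ?_
    rw [uIcc_of_le hst]
    exact (hcx.inner hk).mono hsub

end Mild

/-! ### Pairings in L². -/

section L2

variable {𝕜 U X : Type*} [RCLike 𝕜] [NormedAddCommGroup U] [InnerProductSpace 𝕜 U]
  [MeasurableSpace X] {μ : Measure X}

theorem inner_toLp {a b : X → U} (ha : MemLp a 2 μ) (hb : MemLp b 2 μ) :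
    inner 𝕜 (ha.toLp a) (hb.toLp b) = ∫ x, inner 𝕜 (a x) (b x) ∂μ := by
  rw [L2.inner_def]
  refine integral_congr_ae ?_
  filter_upwards [ha.coeFn_toLp, hb.coeFn_toLp] with x h1 h2
  rw [h1, h2]

theorem norm_sq_toLp (𝕜 : Type*) [RCLike 𝕜] [InnerProductSpace 𝕜 U] {a : X → U}
    (ha : MemLp a 2 μ) : ‖ha.toLp a‖ ^ 2 = ∫ x, ‖a x‖ ^ 2 ∂μ := by
  have h : ((‖ha.toLp a‖ ^ 2 : ℝ) : 𝕜) = ((∫ x, ‖a x‖ ^ 2 ∂μ : ℝ) : 𝕜) := by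
    rw [← integral_ofReal]
    push_cast
    rw [← inner_self_eq_norm_sq_to_K, inner_toLp]
    simp only [inner_self_eq_norm_sq_to_K]
  exact_mod_cast h

end L2

/-! ### Admissibility as an observation inequality; the infinite horizon observation map. -/

section Admissible

variable {𝕜 H U : Type*} [RCLike 𝕜]
  [NormedAddCommGroup H] [InnerProductSpace 𝕜 H] [NormedSpace ℝ H] [IsScalarTower ℝ 𝕜 H]
  [CompleteSpace H]
  [NormedAddCommGroup U] [InnerProductSpace 𝕜 U] [CompleteSpace U]

theorem continuous_obs_domGroup (S : C0Group 𝕜 H) (B : U →L[𝕜] S.DomAdjDual) (φ : S.DomAdj) :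
    Continuous fun s : ℝ => S.obs B (S.domGroup.op s φ) :=
  (S.obs B).continuous.comp (S.domGroup.continuous_op φ)

theorem memLp_of_continuousOn_Icc {E : Type*} [NormedAddCommGroup E] {g : ℝ → E} {T : ℝ}
    (hg : ContinuousOn g (Icc 0 T)) : MemLp g 2 (volume.restrict (Ioo 0 T)) :=
  (memLp_two_iff_integrable_sq_norm
    ((hg.mono Ioo_subset_Icc_self).aestronglyMeasurable measurableSet_Ioo)).2
    (ContinuousOn.integrableOn_Ioo (hg.norm.pow 2))

/-- The observation inequality dual to admissibility. -/
theorem Admissible.exists_integral_le {S : C0Group 𝕜 H} {B : U →L[𝕜] S.DomAdjDual}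
    (hB : S.Admissible B) {T : ℝ} (hT : 0 < T) :
    ∃ K : ℝ, 0 ≤ K ∧ ∀ φ : S.DomAdj,
      ∫ s in (0 : ℝ)..T, ‖S.obs B (S.domGroup.op s φ)‖ ^ 2 ≤ K * ‖S.vec φ‖ ^ 2 := by
  have hmem : ∀ φ : S.DomAdj, MemLp (fun s => S.obs B (S.domGroup.op (T - s) φ)) 2
      (volume.restrict (Ioo 0 T)) := fun φ => memLp_of_continuousOn_Icc
    ((S.continuous_obs_domGroup B φ).comp (by fun_prop : Continuous fun s : ℝ => T - s)).continuousOn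
  have hnorm : ∀ φ : S.DomAdj, ‖(hmem φ).toLp _‖ ^ 2
      = ∫ s in (0 : ℝ)..T, ‖S.obs B (S.domGroup.op s φ)‖ ^ 2 := fun φ => by
    rw [norm_sq_toLp 𝕜, ← integral_Ioc_eq_integral_Ioo, ← intervalIntegral.integral_of_le hT.le]
    have := intervalIntegral.integral_comp_sub_left (a := 0) (b := T)
      (fun s => ‖S.obs B (S.domGroup.op s φ)‖ ^ 2) T
    rw [this, sub_self, sub_zero]
  -- Pairing the observation of φ with a control u gives ⟪φ, Φ(T)⟫, bounded by ‖Φ(T)‖ when ‖φ‖ ≤ 1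
  -- in H. Uniform boundedness turns this into a bound on the L² norms of the observations, and
  -- scaling into the inequality.
  have hbdd : ∀ u : Lp U 2 (volume.restrict (Ioo 0 T)), ∃ C,
      ∀ φ : {φ : S.DomAdj // ‖S.vec φ‖ ≤ 1}, ‖innerSL 𝕜 ((hmem φ.1).toLp _) u‖ ≤ C := by
    intro u
    obtain ⟨Φ, -, hΦ⟩ := hB T hT u (Lp.memLp u)
    refine ⟨‖Φ T‖, fun φ => ?_⟩
    have h1 := hΦ T ⟨hT.le, le_rfl⟩ φ.1
    have h2 : inner 𝕜 ((hmem φ.1).toLp _) u = inner 𝕜 (S.vec φ.1) (Φ T) := by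
      rw [h1, L2.inner_def]
      refine integral_congr_ae ?_
      filter_upwards [(hmem φ.1).coeFn_toLp] with s hs
      rw [hs, inner_obs]
      rfl
    rw [innerSL_apply_apply, h2]
    refine (norm_inner_le_norm _ _).trans ?_
    exact mul_le_of_le_one_left (norm_nonneg _) φ.2
  obtain ⟨C, hC⟩ := banach_steinhaus hbdd
  refine ⟨C ^ 2, sq_nonneg _, fun φ => ?_⟩
  have hscale : ∀ c : 𝕜, ∫ s in (0 : ℝ)..T, ‖S.obs B (S.domGroup.op s (c • φ))‖ ^ 2
      = ‖c‖ ^ 2 * ∫ s in (0 : ℝ)..T, ‖S.obs B (S.domGroup.op s φ)‖ ^ 2 := fun c => by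
    rw [← intervalIntegral.integral_const_mul]
    refine intervalIntegral.integral_congr fun s _ => ?_
    simp only [_root_.map_smul, norm_smul, mul_pow]
  rcases eq_or_ne (S.vec φ) 0 with h0 | h0
  · have : φ = 0 := S.vec_injective (by rw [h0]; rfl)
    subst this
    have := hscale 0
    rw [smul_zero, norm_zero, zero_pow two_ne_zero, zero_mul] at this
    rw [this]; positivity
  · have hn : 0 < ‖S.vec φ‖ := norm_pos_iff.2 h0
    have h1 : ‖S.vec ((((‖S.vec φ‖⁻¹ : ℝ)) : 𝕜) • φ)‖ ≤ 1 := by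
      rw [vec_smul, norm_smul, RCLike.norm_ofReal, abs_of_pos (inv_pos.2 hn), inv_mul_cancel₀ hn.ne']
    have h2 := hC ⟨_, h1⟩
    rw [innerSL_apply_norm] at h2
    have h3 := pow_le_pow_left₀ (norm_nonneg _) h2 2
    rw [hnorm, hscale, RCLike.norm_ofReal, abs_of_pos (inv_pos.2 hn), inv_pow, inv_mul_le_iff₀
      (by positivity)] at h3
    linarith

/-- The weighted observation `s ↦ e^{-lam s} B* S(-s)* φ`. -/
noncomputable def wobs (S : C0Group 𝕜 H) (B : U →L[𝕜] S.DomAdjDual) (lam : ℝ) (φ : S.DomAdj)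
    (s : ℝ) : U :=
  ((Real.exp (-lam * s) : ℝ) : 𝕜) • S.obs B (S.domGroup.op (-s) φ)

theorem continuous_wobs (S : C0Group 𝕜 H) (B : U →L[𝕜] S.DomAdjDual) (lam : ℝ) (φ : S.DomAdj) :
    Continuous (S.wobs B lam φ) := by
  refine Continuous.smul (RCLike.continuous_ofReal.comp (by fun_prop)) ?_
  exact (S.continuous_obs_domGroup B φ).comp continuous_neg

theorem wobs_add (S : C0Group 𝕜 H) (B : U →L[𝕜] S.DomAdjDual) (lam : ℝ) (φ χ : S.DomAdj) :
    S.wobs B lam (φ + χ) = S.wobs B lam φ + S.wobs B lam χ := by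
  funext s
  simp only [wobs, _root_.map_add, smul_add, Pi.add_apply]

theorem wobs_smul (S : C0Group 𝕜 H) (B : U →L[𝕜] S.DomAdjDual) (lam : ℝ) (c : 𝕜) (φ : S.DomAdj) :
    S.wobs B lam (c • φ) = c • S.wobs B lam φ := by
  funext s
  simp only [wobs, _root_.map_smul, Pi.smul_apply, smul_comm c]

theorem norm_wobs (S : C0Group 𝕜 H) (B : U →L[𝕜] S.DomAdjDual) (lam : ℝ) (φ : S.DomAdj) (s : ℝ) :
    ‖S.wobs B lam φ s‖ = Real.exp (-lam * s) * ‖S.obs B (S.domGroup.op (-s) φ)‖ := by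
  rw [wobs, norm_smul, RCLike.norm_ofReal, abs_of_pos (Real.exp_pos _)]

variable {S : C0Group 𝕜 H} {M κ lam : ℝ}

theorem norm_wobs_le (B : U →L[𝕜] S.DomAdjDual) (hS : ∀ t, ‖S.op t‖ ≤ M * Real.exp (κ * |t|))
    (φ : S.DomAdj) {s : ℝ} (hs : 0 ≤ s) :
    ‖S.wobs B lam φ s‖ ≤ ‖S.obs B‖ * M * ‖φ‖ * Real.exp (-(lam - κ) * s) := by
  rw [norm_wobs]
  have h1 : ‖S.obs B (S.domGroup.op (-s) φ)‖ ≤ ‖S.obs B‖ * (M * Real.exp (κ * s) * ‖φ‖) := by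
    refine (ContinuousLinearMap.le_opNorm _ _).trans ?_
    gcongr
    refine (ContinuousLinearMap.le_opNorm _ _).trans ?_
    gcongr
    have := hS (-s)
    rw [abs_neg, abs_of_nonneg hs] at this
    exact (S.norm_domGroup_le _).trans this
  calc _ ≤ Real.exp (-lam * s) * (‖S.obs B‖ * (M * Real.exp (κ * s) * ‖φ‖)) := by gcongr
    _ = ‖S.obs B‖ * M * ‖φ‖ * (Real.exp (-lam * s) * Real.exp (κ * s)) := by ring
    _ = _ := by rw [← Real.exp_add]; congr 2; ring

theorem memLp_wobs (B : U →L[𝕜] S.DomAdjDual) (hS : ∀ t, ‖S.op t‖ ≤ M * Real.exp (κ * |t|))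
    (hlam : κ < lam) (φ : S.DomAdj) :
    MemLp (S.wobs B lam φ) 2 (volume.restrict (Ioi 0)) := by
  rw [memLp_two_iff_integrable_sq_norm (S.continuous_wobs B lam φ).aestronglyMeasurable]
  have h1 : IntegrableOn (fun s => (‖S.obs B‖ * M * ‖φ‖) ^ 2 * Real.exp (-(2 * (lam - κ)) * s))
      (Ioi 0) := (exp_neg_integrableOn_Ioi 0 (by linarith)).const_mul _
  refine Integrable.mono' h1 ((S.continuous_wobs B lam φ).norm.pow 2).aestronglyMeasurable ?_
  refine (ae_restrict_iff' measurableSet_Ioi).2 (Eventually.of_forall fun s hs => ?_)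
  rw [Real.norm_of_nonneg (by positivity)]
  refine (pow_le_pow_left₀ (norm_nonneg _) (norm_wobs_le B hS φ (le_of_lt hs)) 2).trans_eq ?_
  rw [mul_pow, ← Real.exp_nat_mul]
  congr 2
  push_cast
  ring

/-- Cut the half line into unit intervals. On the n-th one the observation inequality in time 1
applies, and the weight e^{-2 lam n} beats the growth e^{2 κ (n+1)}, so the pieces are dominated by
a geometric series of ratio q = e^{-2(lam - κ)} < 1. -/
theorem exists_integral_wobs_le {B : U →L[𝕜] S.DomAdjDual} (hB : S.Admissible B) (hM : 1 ≤ M)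
    (hS : ∀ t, ‖S.op t‖ ≤ M * Real.exp (κ * |t|)) (hlam : κ < lam) (hlam0 : 0 ≤ lam) :
    ∃ K : ℝ, 0 ≤ K ∧ ∀ φ : S.DomAdj,
      ∫ s in Ioi (0 : ℝ), ‖S.wobs B lam φ s‖ ^ 2 ≤ K * ‖S.vec φ‖ ^ 2 := by
  obtain ⟨K, hK, hKb⟩ := hB.exists_integral_le one_pos
  set q : ℝ := Real.exp (-(2 * (lam - κ))) with hq
  have hq0 : 0 < q := Real.exp_pos _
  have hq1 : q < 1 := by rw [hq, Real.exp_lt_one_iff]; linarith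
  refine ⟨K * (M * Real.exp κ) ^ 2 * (1 - q)⁻¹, mul_nonneg (by positivity)
    (inv_nonneg.2 (by linarith)), fun φ => ?_⟩
  have hc : Continuous fun s => ‖S.wobs B lam φ s‖ ^ 2 := (S.continuous_wobs B lam φ).norm.pow 2
  have hint : IntegrableOn (fun s => ‖S.wobs B lam φ s‖ ^ 2) (Ioi 0) :=
    (memLp_two_iff_integrable_sq_norm (S.continuous_wobs B lam φ).aestronglyMeasurable).1
      (memLp_wobs B hS hlam φ)
  have hlim := (intervalIntegral_tendsto_integral_Ioi (0 : ℝ) hint tendsto_id).comp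
    (tendsto_natCast_atTop_atTop (R := ℝ))
  have hpiece : ∀ n : ℕ, ∫ s in (n : ℝ)..((n + 1 : ℕ) : ℝ), ‖S.wobs B lam φ s‖ ^ 2
      ≤ K * (M * Real.exp κ) ^ 2 * ‖S.vec φ‖ ^ 2 * q ^ n := by
    intro n
    -- Going back by n + 1 rather than n writes -s as (n + 1 - s) - (n + 1) with n + 1 - s in [0,
    -- 1], the forward times covered by the observation inequality.
    set χ := S.domGroup.op (-((n + 1 : ℕ) : ℝ)) φ with hχ
    have h1 : ∫ s in (n : ℝ)..((n + 1 : ℕ) : ℝ), ‖S.wobs B lam φ s‖ ^ 2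
        ≤ ∫ s in (n : ℝ)..((n + 1 : ℕ) : ℝ), Real.exp (-(2 * lam) * n) *
          ‖S.obs B (S.domGroup.op (((n + 1 : ℕ) : ℝ) - s) χ)‖ ^ 2 := by
      refine intervalIntegral.integral_mono_on (by push_cast; linarith) (hc.intervalIntegrable _ _)
        (Continuous.intervalIntegrable ?_ _ _) fun s hs => ?_
      · exact continuous_const.mul (((S.continuous_obs_domGroup B χ).comp (by fun_prop)).norm.pow 2)
      · rw [norm_wobs, mul_pow, hχ, ← op_add_apply, ← Real.exp_nat_mul]
        rw [show ((n + 1 : ℕ) : ℝ) - s + -((n + 1 : ℕ) : ℝ) = -s by ring]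
        refine mul_le_mul_of_nonneg_right (Real.exp_le_exp.2 ?_) (by positivity)
        push_cast
        nlinarith [hs.1]
    have h2 : ∫ s in (n : ℝ)..((n + 1 : ℕ) : ℝ),
        ‖S.obs B (S.domGroup.op (((n + 1 : ℕ) : ℝ) - s) χ)‖ ^ 2 ≤ K * ‖S.vec χ‖ ^ 2 := by
      have := intervalIntegral.integral_comp_sub_left (a := (n : ℝ)) (b := ((n + 1 : ℕ) : ℝ))
        (fun s => ‖S.obs B (S.domGroup.op s χ)‖ ^ 2) ((n + 1 : ℕ) : ℝ)
      rw [this, sub_self, show ((n + 1 : ℕ) : ℝ) - n = 1 by push_cast; ring]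
      exact hKb χ
    have h3 : ‖S.vec χ‖ ≤ M * Real.exp (κ * ((n : ℝ) + 1)) * ‖S.vec φ‖ := by
      rw [hχ, vec_domGroup]
      refine (ContinuousLinearMap.le_opNorm _ _).trans ?_
      gcongr
      have := hS (-((n + 1 : ℕ) : ℝ))
      rw [abs_neg, Nat.abs_cast, ← norm_dual_op] at this
      push_cast at this ⊢
      exact this
    rw [intervalIntegral.integral_const_mul] at h1
    refine h1.trans ((mul_le_mul_of_nonneg_left (h2.trans (mul_le_mul_of_nonneg_left
      (pow_le_pow_left₀ (norm_nonneg _) h3 2) hK)) (Real.exp_pos _).le).trans_eq ?_)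
    have e : Real.exp (-(2 * lam) * n) * Real.exp (κ * ((n : ℝ) + 1)) ^ 2
        = Real.exp κ ^ 2 * q ^ n := by
      rw [hq, ← Real.exp_nat_mul, ← Real.exp_nat_mul, ← Real.exp_nat_mul, ← Real.exp_add,
        ← Real.exp_add]
      congr 1
      push_cast
      ring
    calc _ = K * M ^ 2 * ‖S.vec φ‖ ^ 2 *
          (Real.exp (-(2 * lam) * n) * Real.exp (κ * ((n : ℝ) + 1)) ^ 2) := by ring
      _ = _ := by rw [e]; ring
  refine le_of_tendsto hlim (Eventually.of_forall fun N => ?_)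
  simp only [Function.comp_apply, id]
  have hsum := intervalIntegral.sum_integral_adjacent_intervals (μ := volume)
    (f := fun s => ‖S.wobs B lam φ s‖ ^ 2) (a := fun n : ℕ => (n : ℝ)) (n := N)
    (fun k _ => hc.intervalIntegrable _ _)
  rw [Nat.cast_zero] at hsum
  rw [← hsum]
  refine (Finset.sum_le_sum fun n _ => hpiece n).trans ?_
  rw [← Finset.mul_sum]
  have hg : ∑ i ∈ Finset.range N, q ^ i ≤ (1 - q)⁻¹ := by
    rw [← tsum_geometric_of_lt_one hq0.le hq1]
    exact (summable_geometric_of_lt_one hq0.le hq1).sum_le_tsum _ fun _ _ => by positivity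
  calc _ ≤ K * (M * Real.exp κ) ^ 2 * ‖S.vec φ‖ ^ 2 * (1 - q)⁻¹ := by gcongr
    _ = _ := by ring

/-- The infinite horizon observation map, extended to the whole space. -/
theorem exists_observation_map {B : U →L[𝕜] S.DomAdjDual} (hB : S.Admissible B) (hM : 1 ≤ M)
    (hS : ∀ t, ‖S.op t‖ ≤ M * Real.exp (κ * |t|)) (hlam : κ < lam) (hlam0 : 0 ≤ lam) :
    ∃ G : H →L[𝕜] Lp U 2 (volume.restrict (Ioi (0 : ℝ))), ∀ φ : S.DomAdj,
      G (S.vec φ) = (memLp_wobs B hS hlam φ).toLp _ := by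
  obtain ⟨K, hK, hKb⟩ := exists_integral_wobs_le hB hM hS hlam hlam0
  let g : S.DomAdj →ₗ[𝕜] Lp U 2 (volume.restrict (Ioi (0 : ℝ))) :=
    { toFun := fun φ => (memLp_wobs B hS hlam φ).toLp _
      map_add' := fun φ χ => by
        rw [← MemLp.toLp_add]
        exact MemLp.toLp_congr _ _ (by rw [wobs_add])
      map_smul' := fun c φ => by
        rw [RingHom.id_apply, ← MemLp.toLp_const_smul]
        exact MemLp.toLp_congr _ _ (by rw [wobs_smul]) }
  -- The bound involves only the norm of φ in H, so the map extends from the dense subspace D(A*).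
  refine ⟨g.extendOfNorm S.vecL.toLinearMap, fun φ => ?_⟩
  refine LinearMap.extendOfNorm_eq (f := g) (e := S.vecL.toLinearMap) S.denseRange_vec
    ⟨Real.sqrt K, fun χ => ?_⟩ φ
  refine le_of_sq_le_sq ?_ (by positivity)
  rw [mul_pow, Real.sq_sqrt hK]
  exact (norm_sq_toLp 𝕜 (memLp_wobs B hS hlam χ)).trans_le (hKb χ)

end Admissible

theorem integrable_inner_of_memLp {𝕜 U X : Type*} [RCLike 𝕜] [NormedAddCommGroup U]
    [InnerProductSpace 𝕜 U] [MeasurableSpace X] {μ : Measure X} {a b : X → U}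
    (ha : MemLp a 2 μ) (hb : MemLp b 2 μ) : Integrable (fun x => inner 𝕜 (a x) (b x)) μ := by
  refine (L2.integrable_inner (𝕜 := 𝕜) (ha.toLp a) (hb.toLp b)).congr ?_
  filter_upwards [ha.coeFn_toLp, hb.coeFn_toLp] with x h1 h2
  rw [h1, h2]

theorem uIcc_subset_Icc_of_mem {T c d : ℝ} (hc : c ∈ Icc 0 T) (hd : d ∈ Icc 0 T) :
    uIcc c d ⊆ Icc 0 T := ordConnected_Icc.uIcc_subset hc hd

theorem intervalIntegrable_of_integrableOn_Ioo {E : Type*} [NormedAddCommGroup E] {g : ℝ → E}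
    {T : ℝ} (hg : IntegrableOn g (Ioo 0 T)) {c d : ℝ} (hc : c ∈ Icc 0 T) (hd : d ∈ Icc 0 T) :
    IntervalIntegrable g volume c d := by
  rw [intervalIntegrable_iff']
  exact ((integrableOn_Icc_iff_integrableOn_Ioo).2 hg).mono_set (uIcc_subset_Icc_of_mem hc hd)

/-! ### The Lyapunov identity for the Gramian. -/

section Gramian

variable {𝕜 H U : Type*} [RCLike 𝕜]
  [NormedAddCommGroup H] [InnerProductSpace 𝕜 H] [NormedSpace ℝ H] [IsScalarTower ℝ 𝕜 H]
  [CompleteSpace H]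
  [NormedAddCommGroup U] [InnerProductSpace 𝕜 U] [NormedSpace ℝ U] [IsScalarTower ℝ 𝕜 U]
  [CompleteSpace U]
variable {S : C0Group 𝕜 H} {M κ lam : ℝ} {B : U →L[𝕜] S.DomAdjDual}

/-- The orbit of φ is differentiable in the graph norm, so the bounded operator B* may be applied to
its derivative. -/
theorem hasDerivAt_wobs {φ φ' : S.DomAdj} (h : S.domGroup.HasGen φ φ') (s : ℝ) :
    HasDerivAt (S.wobs B lam φ) (-((lam : 𝕜) • S.wobs B lam φ s) - S.wobs B lam φ' s) s := by
  have h1 : HasDerivAt (fun s : ℝ => S.obs B (S.domGroup.op (-s) φ))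
      (S.obs B (S.domGroup.op (-s) (-φ'))) s :=
    ((S.obs B).restrictScalars ℝ).hasFDerivAt.comp_hasDerivAt s (h.rev.hasDerivAt s)
  have h2 : HasDerivAt (fun s : ℝ => Real.exp (-lam * s)) (Real.exp (-lam * s) * (-lam * 1)) s :=
    ((hasDerivAt_id s).const_mul (-lam)).exp
  have h3 := h2.smul h1
  have e : S.wobs B lam φ = fun s => Real.exp (-lam * s) • S.obs B (S.domGroup.op (-s) φ) :=
    funext fun s => (RCLike.real_smul_eq_coe_smul (K := 𝕜) _ _).symm
  rw [e]
  refine h3.congr_deriv ?_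
  simp only [wobs]
  rw [← RCLike.real_smul_eq_coe_smul (K := 𝕜) lam, ← RCLike.real_smul_eq_coe_smul (K := 𝕜),
    map_neg, map_neg, smul_neg, mul_one, mul_neg, neg_smul, smul_smul, mul_comm lam]
  abel

theorem tendsto_inner_wobs (hS : ∀ t, ‖S.op t‖ ≤ M * Real.exp (κ * |t|)) (hlam : κ < lam)
    (φ χ : S.DomAdj) :
    Tendsto (fun s => inner 𝕜 (S.wobs B lam φ s) (S.wobs B lam χ s)) atTop (𝓝 0) := by
  have h0 : Tendsto (fun s : ℝ => Real.exp (-(lam - κ) * s)) atTop (𝓝 0) := by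
    refine Real.tendsto_exp_atBot.comp ?_
    exact tendsto_id.const_mul_atTop_of_neg (by linarith)
  have h1 := (h0.const_mul (‖S.obs B‖ * M * ‖φ‖)).mul (h0.const_mul (‖S.obs B‖ * M * ‖χ‖))
  simp only [mul_zero] at h1
  refine squeeze_zero_norm' ?_ h1
  filter_upwards [eventually_ge_atTop 0] with s hs
  refine (norm_inner_le_norm _ _).trans ?_
  have h2 := norm_wobs_le (lam := lam) B hS φ hs
  exact mul_le_mul h2 (norm_wobs_le B hS χ hs) (norm_nonneg _) ((norm_nonneg _).trans h2)

/-- Integrate the derivative of the pairing of the two observations over the half line: the boundary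
value at 0 is ⟪B* φ, B* χ⟫, and the one at infinity vanishes because lam > κ. -/
theorem integral_inner_wobs_of_hasGen (hS : ∀ t, ‖S.op t‖ ≤ M * Real.exp (κ * |t|))
    (hlam : κ < lam) {φ φ' χ χ' : S.DomAdj} (h : S.domGroup.HasGen φ φ')
    (h' : S.domGroup.HasGen χ χ') :
    (∫ s in Ioi (0 : ℝ), inner 𝕜 (S.wobs B lam φ s) (S.wobs B lam χ' s))
      + (∫ s in Ioi (0 : ℝ), inner 𝕜 (S.wobs B lam φ' s) (S.wobs B lam χ s))
      - inner 𝕜 (S.obs B φ) (S.obs B χ)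
      + 2 * (lam : 𝕜) * ∫ s in Ioi (0 : ℝ), inner 𝕜 (S.wobs B lam φ s) (S.wobs B lam χ s) = 0 := by
  have hI : ∀ α β : S.DomAdj, IntegrableOn
      (fun s => inner 𝕜 (S.wobs B lam α s) (S.wobs B lam β s)) (Ioi 0) := fun α β =>
    integrable_inner_of_memLp (memLp_wobs B hS hlam α) (memLp_wobs B hS hlam β)
  have hd : ∀ s : ℝ, HasDerivAt (fun s => inner 𝕜 (S.wobs B lam φ s) (S.wobs B lam χ s))
      (-(2 * (lam : 𝕜) * inner 𝕜 (S.wobs B lam φ s) (S.wobs B lam χ s))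
        - inner 𝕜 (S.wobs B lam φ s) (S.wobs B lam χ' s)
        - inner 𝕜 (S.wobs B lam φ' s) (S.wobs B lam χ s)) s := fun s => by
    refine ((hasDerivAt_wobs h s).inner 𝕜 (hasDerivAt_wobs h' s)).congr_deriv ?_
    simp only [inner_sub_left, inner_sub_right, inner_neg_left, inner_neg_right, inner_smul_left,
      inner_smul_right, RCLike.conj_ofReal]
    ring
  have i1 : IntegrableOn
      (fun s => -(2 * (lam : 𝕜) * inner 𝕜 (S.wobs B lam φ s) (S.wobs B lam χ s))) (Ioi 0) :=
    ((hI φ χ).const_mul _).neg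
  have i2 : IntegrableOn (fun s => -(2 * (lam : 𝕜) * inner 𝕜 (S.wobs B lam φ s) (S.wobs B lam χ s))
      - inner 𝕜 (S.wobs B lam φ s) (S.wobs B lam χ' s)) (Ioi 0) := i1.sub (hI φ χ')
  have h1 := integral_Ioi_of_hasDerivAt_of_tendsto (a := 0)
    (hd 0).continuousAt.continuousWithinAt (fun s _ => hd s)
    (i2.sub (hI φ' χ)) (tendsto_inner_wobs hS hlam φ χ)
  rw [integral_sub i2 (hI φ' χ), integral_sub i1 (hI φ χ'), integral_neg, integral_const_mul] at h1
  have h0 : ∀ α : S.DomAdj, S.wobs B lam α 0 = S.obs B α := fun α => by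
    simp [wobs, op_zero_apply]
  rw [h0, h0] at h1
  linear_combination -h1

/-- The Lyapunov identity of the weighted Gramian `G* G`. -/
theorem gramian_identity (hS : ∀ t, ‖S.op t‖ ≤ M * Real.exp (κ * |t|)) (hlam : κ < lam)
    {G : H →L[𝕜] Lp U 2 (volume.restrict (Ioi (0 : ℝ)))}
    (hG : ∀ φ : S.DomAdj, G (S.vec φ) = (memLp_wobs B hS hlam φ).toLp _) (φ χ : S.DomAdj) :
    inner 𝕜 (G (S.vec φ)) (G (S.adjGen χ)) + inner 𝕜 (G (S.adjGen φ)) (G (S.vec χ))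
      - inner 𝕜 (S.obs B φ) (S.obs B χ) + 2 * (lam : 𝕜) * inner 𝕜 (G (S.vec φ)) (G (S.vec χ))
      = 0 := by
  have hv := S.continuous_vec
  have ha := S.continuous_adjGen
  have hGc := G.continuous
  have hob := (S.obs B).continuous
  let E : S.DomAdj → S.DomAdj → 𝕜 := fun φ χ =>
    inner 𝕜 (G (S.vec φ)) (G (S.adjGen χ)) + inner 𝕜 (G (S.adjGen φ)) (G (S.vec χ))
      - inner 𝕜 (S.obs B φ) (S.obs B χ) + 2 * (lam : 𝕜) * inner 𝕜 (G (S.vec φ)) (G (S.vec χ))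
  change E φ χ = 0
  -- E is continuous in each variable for the graph norm, so it suffices to treat smooth φ and then
  -- smooth χ.
  refine S.domGroup.dense_domain.induction (P := fun φ => E φ χ = 0) (fun φ hφ => ?_)
    (isClosed_eq (by fun_prop) continuous_const) φ
  refine S.domGroup.dense_domain.induction (P := fun χ => E φ χ = 0) (fun χ hχ => ?_)
    (isClosed_eq (by fun_prop) continuous_const) χ
  obtain ⟨φ', hφ'⟩ := hφ
  obtain ⟨χ', hχ'⟩ := hχ
  simp only [E, hφ'.adjGen_eq_vec, hχ'.adjGen_eq_vec, hG, inner_toLp]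
  exact integral_inner_wobs_of_hasGen hS hlam hφ' hχ'

end Gramian

/-! ### Exact controllability and the lower bound for the observation map. -/

section Observability

variable {𝕜 H U : Type*} [RCLike 𝕜]
  [NormedAddCommGroup H] [InnerProductSpace 𝕜 H] [NormedSpace ℝ H] [IsScalarTower ℝ 𝕜 H]
  [CompleteSpace H]
  [NormedAddCommGroup U] [InnerProductSpace 𝕜 U]
  [CompleteSpace U]
variable {S : C0Group 𝕜 H} {M κ lam : ℝ} {B : U →L[𝕜] S.DomAdjDual}

theorem DistDeriv.sub_eq_integral_of_mem {T : ℝ} {F h : ℝ → 𝕜} (hd : DistDeriv T F h)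
    (hF : ContinuousOn F (Icc 0 T)) (hh : IntegrableOn h (Ioo 0 T)) {a b : ℝ}
    (ha : a ∈ Icc 0 T) (hb : b ∈ Icc 0 T) : F b - F a = ∫ t in a..b, h t := by
  rcases le_total a b with hab | hab
  · exact hd.sub_eq_integral hF hh ha.1 hab hb.2
  · rw [intervalIntegral.integral_symm, ← hd.sub_eq_integral hF hh hb.1 hab ha.2, neg_sub]

/-- Variation of constants for weak solutions of the controlled equation, tested with smooth
vectors. -/
theorem IsWeakSol.inner_eq_integral {T : ℝ} (hT : 0 < T) {y₀ : H} {u : ℝ → U} {y : ℝ → H}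
    (hu : MemLp u 2 (volume.restrict (Ioo 0 T)))
    (hy : S.IsWeakSol B T y₀ (fun _ => 0) u y) {φ : S.DomAdj} {φ' : S.DomAdj}
    (hφ : S.domGroup.HasGen φ φ') :
    inner 𝕜 (S.vec φ) (y T) = inner 𝕜 (S.vec (S.domGroup.op T φ)) y₀
      + ∫ s in (0 : ℝ)..T, inner 𝕜 (S.obs B (S.domGroup.op (T - s) φ)) (u s) := by
  obtain ⟨hyc, hy0, hyw⟩ := hy
  set a : ℝ → S.DomAdj := fun s => S.domGroup.op (T - s) φ with ha
  have had : ∀ s, HasDerivAt a (-S.domGroup.op (T - s) φ') s := fun s => by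
    have h1 := (hφ.hasDerivAt (T - s)).scomp s ((hasDerivAt_id s).const_sub T)
    rw [neg_one_smul] at h1
    exact h1
  have hac : Continuous a := continuous_iff_continuousAt.2 fun s => (had s).continuousAt
  have hgen : ∀ s, S.adjGen (a s) = S.vec (S.domGroup.op (T - s) φ') := fun s =>
    (S.domGroup.hasGen_op (T - s) hφ).adjGen_eq_vec
  have huB : ∀ b : ℝ → S.DomAdj, Continuous b →
      IntegrableOn (fun s => inner 𝕜 (S.obs B (b s)) (u s)) (Ioo 0 T) := fun b hb =>
    integrable_inner_of_memLp
      (memLp_of_continuousOn_Icc ((S.obs B).continuous.comp hb).continuousOn) hu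
  have hyi : ∀ x : H, IntegrableOn (fun s => inner 𝕜 x (y s)) (Ioo 0 T) := fun x =>
    ContinuousOn.integrableOn_Ioo (continuousOn_const.inner hyc)
  have hII : ∀ {g : ℝ → 𝕜}, IntegrableOn g (Ioo 0 T) →
      ∀ {c d : ℝ}, c ∈ Icc 0 T → d ∈ Icc 0 T → IntervalIntegrable g volume c d :=
    fun hg _ _ hc hd => intervalIntegrable_of_integrableOn_Ioo hg hc hd
  have hweak : ∀ (χ : S.DomAdj) {c d : ℝ}, c ∈ Icc 0 T → d ∈ Icc 0 T →
      inner 𝕜 (S.vec χ) (y d) - inner 𝕜 (S.vec χ) (y c)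
        = inner 𝕜 (S.adjGen χ) (∫ σ in c..d, y σ)
          + ∫ σ in c..d, inner 𝕜 (S.obs B χ) (u σ) := by
    intro χ c d hc hd
    have h1 := (hyw χ).sub_eq_integral_of_mem (continuousOn_const.inner hyc) (by
      simp only [inner_zero_right, add_zero, ← inner_obs]
      exact (hyi _).add (huB _ continuous_const)) hc hd
    rw [h1]
    simp only [inner_zero_right, add_zero, ← inner_obs]
    rw [intervalIntegral.integral_add (hII (hyi _) hc hd) (hII (huB _ continuous_const) hc hd)]
    congr 1
    exact (innerSL 𝕜 (S.adjGen χ)).intervalIntegral_comp_comm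
      (hyc.mono (uIcc_subset_Icc_of_mem hc hd)).intervalIntegrable
  -- The claim is that P is constant. As u is only square integrable, neither of its two terms need
  -- be differentiable at every point; their difference is.
  set P : ℝ → 𝕜 := fun t => inner 𝕜 (S.vec (a t)) (y t)
    - ∫ s in (0 : ℝ)..t, inner 𝕜 (S.obs B (a s)) (u s) with hP
  have h0m : (0 : ℝ) ∈ Icc 0 T := ⟨le_rfl, hT.le⟩
  have hPc : ContinuousOn P (Icc 0 T) := by
    refine ((S.continuous_vec.comp hac).continuousOn.inner hyc).sub ?_
    have := intervalIntegral.continuousOn_primitive_interval (μ := volume) (a := 0) (b := T)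
      (f := fun s => inner 𝕜 (S.obs B (a s)) (u s))
      (by rw [uIcc_of_le hT.le]; exact (integrableOn_Icc_iff_integrableOn_Ioo).2 (huB a hac))
    rwa [uIcc_of_le hT.le] at this
  have hui : IntegrableOn (fun s => ‖u s‖) (Ioo 0 T) := (hu.integrable one_le_two).norm
  -- Lipschitz continuity holds in the norm of D(A*), which is what is needed to apply B*.
  obtain ⟨L, hL⟩ : ∃ L : ℝ, ∀ s ∈ Icc 0 T, ∀ t ∈ Icc 0 T, ‖a t - a s‖ ≤ L * |t - s| := by
    obtain ⟨C, hC⟩ := (isCompact_Icc (a := (0 : ℝ)) (b := T)).exists_bound_of_continuousOn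
      (f := fun s => S.domGroup.op (T - s) φ')
      ((S.domGroup.continuous_op φ').comp (by fun_prop : Continuous fun s : ℝ => T - s)).continuousOn
    refine ⟨C, fun s hs t ht => ?_⟩
    have := (convex_Icc (0 : ℝ) T).norm_image_sub_le_of_norm_hasDerivWithin_le
      (fun x _ => (had x).hasDerivWithinAt) (fun x hx => by rw [norm_neg]; exact hC x hx) hs ht
    rwa [Real.norm_eq_abs] at this
  have hPd : ∀ s ∈ Ioo 0 T, HasDerivAt P 0 s := by
    intro s hs
    have hsm : s ∈ Icc 0 T := ⟨hs.1.le, hs.2.le⟩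
    have hnhds : Icc 0 T ∈ 𝓝 s := Icc_mem_nhds hs.1 hs.2
    -- The error from freezing the moving test vector in the control term. It is at most ‖B*‖ L |t -
    -- s| times the integral of ‖u‖ between s and t, hence o(|t - s|).
    set R : ℝ → 𝕜 := fun t => ∫ σ in s..t, inner 𝕜 (S.obs B (a t - a σ)) (u σ) with hR
    have hdec : ∀ t ∈ Icc 0 T, P t = P s + (inner 𝕜 (S.vec (a t - a s)) (y s)
        + inner 𝕜 (S.adjGen (a t)) (∫ σ in s..t, y σ) + R t) := by
      intro t ht
      have h1 := hweak (a t) hsm ht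
      have h2 := intervalIntegral.integral_interval_sub_left (hII (huB a hac) h0m ht)
        (hII (huB a hac) h0m hsm)
      have h3 : R t = (∫ σ in s..t, inner 𝕜 (S.obs B (a t)) (u σ))
          - ∫ σ in s..t, inner 𝕜 (S.obs B (a σ)) (u σ) := by
        rw [hR, ← intervalIntegral.integral_sub (hII (huB _ continuous_const) hsm ht)
          (hII (huB a hac) hsm ht)]
        simp only [map_sub, inner_sub_left]
      simp only [hP]
      rw [h3, vec_sub, inner_sub_left]
      linear_combination h1 - h2
    have hd1 : HasDerivAt (fun t => inner 𝕜 (S.vec (a t - a s)) (y s))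
        (inner 𝕜 (S.vec (-S.domGroup.op (T - s) φ')) (y s)) s := by
      have h1 : HasDerivAt (fun t => S.vec (a t - a s)) (S.vec (-S.domGroup.op (T - s) φ')) s :=
        (S.vecL.restrictScalars ℝ).hasFDerivAt.comp_hasDerivAt s ((had s).sub_const _)
      have h2 := h1.inner 𝕜 (hasDerivAt_const s (y s))
      simpa using h2
    have hd2 : HasDerivAt (fun t => inner 𝕜 (S.adjGen (a t)) (∫ σ in s..t, y σ))
        (inner 𝕜 (S.adjGen (a s)) (y s)) s := by
      have h1 : HasDerivAt (fun t => S.adjGen (a t)) (S.adjGen (-S.domGroup.op (T - s) φ')) s :=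
        (S.adjGenL.restrictScalars ℝ).hasFDerivAt.comp_hasDerivAt s (had s)
      have h2 : HasDerivAt (fun t => ∫ σ in s..t, y σ) (y s) s :=
        intervalIntegral.integral_hasDerivAt_right (by simp)
          (ContinuousOn.stronglyMeasurableAtFilter isOpen_Ioo (hyc.mono Ioo_subset_Icc_self) s hs)
          (hyc.continuousAt hnhds)
      have h3 := h1.inner 𝕜 h2
      simpa using h3
    have hd3 : HasDerivAt R 0 s := by
      have hRs : R s = 0 := by simp [hR]
      set V : ℝ → ℝ := fun t => ∫ σ in s..t, ‖u σ‖ with hV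
      have hVt : Tendsto V (𝓝 s) (𝓝 0) := by
        have h1 := intervalIntegral.continuousOn_primitive_interval' (μ := volume)
          (f := fun σ => ‖u σ‖) (a := s) (b₁ := 0) (b₂ := T) (intervalIntegrable_of_integrableOn_Ioo hui h0m ⟨hT.le, le_rfl⟩)
          (by rwa [uIcc_of_le hT.le])
        rw [uIcc_of_le hT.le] at h1
        have h2 := (h1.continuousAt hnhds).tendsto
        simpa [hV] using h2
      have hb : ∀ᶠ t in 𝓝 s, ‖R t‖ ≤ (‖S.obs B‖ * L) * ‖(t - s) * V t‖ := by
        filter_upwards [hnhds] with t ht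
        have h1 : ‖R t‖ ≤ |∫ σ in s..t, (‖S.obs B‖ * L * |t - s|) * ‖u σ‖| := by
          refine intervalIntegral.norm_integral_le_abs_of_norm_le ?_
            ((intervalIntegrable_of_integrableOn_Ioo hui hsm ht).const_mul _)
          refine (ae_restrict_iff' measurableSet_uIoc).2 (Eventually.of_forall fun σ hσ => ?_)
          refine (norm_inner_le_norm _ _).trans (mul_le_mul_of_nonneg_right ?_ (norm_nonneg _))
          have hσ' := uIoc_subset_uIcc hσ
          refine (ContinuousLinearMap.le_opNorm _ _).trans ?_
          rw [mul_assoc]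
          gcongr
          have h2 := hL σ (uIcc_subset_Icc_of_mem hsm ht hσ') t ht
          have h3 : |t - σ| ≤ |t - s| := Set.abs_sub_right_of_mem_uIcc hσ'
          have hL0 : 0 ≤ L := by
            have := (norm_nonneg _).trans (hL 0 h0m T ⟨hT.le, le_rfl⟩)
            rw [sub_zero, abs_of_pos hT] at this
            exact nonneg_of_mul_nonneg_left this hT
          exact h2.trans (mul_le_mul_of_nonneg_left h3 hL0)
        rw [intervalIntegral.integral_const_mul, abs_mul] at h1
        refine h1.trans ?_
        have hL0 : 0 ≤ L := by
          have := (norm_nonneg _).trans (hL 0 h0m T ⟨hT.le, le_rfl⟩)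
          rw [sub_zero, abs_of_pos hT] at this
          exact nonneg_of_mul_nonneg_left this hT
        rw [abs_mul, abs_mul, abs_abs, abs_of_nonneg (S.obs B).opNorm_nonneg, abs_of_nonneg hL0, norm_mul,
          Real.norm_eq_abs, Real.norm_eq_abs, mul_assoc]
      rw [hasDerivAt_iff_isLittleO, hRs]
      simp only [smul_zero, sub_zero]
      refine (Asymptotics.IsBigO.of_bound _ hb).trans_isLittleO ?_
      have := (Asymptotics.isBigO_refl (fun t : ℝ => t - s) (𝓝 s)).mul_isLittleO
        ((Asymptotics.isLittleO_one_iff ℝ).2 hVt)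
      simpa using this
    have hd := (((hd1.add hd2).add hd3).const_add (P s))
    have hz : inner 𝕜 (S.vec (-S.domGroup.op (T - s) φ')) (y s) + inner 𝕜 (S.adjGen (a s)) (y s) + 0
        = 0 := by
      rw [hgen, ← vecL_apply, map_neg, inner_neg_left, vecL_apply]
      ring
    rw [hz] at hd
    refine hd.congr_of_eventuallyEq ?_
    filter_upwards [hnhds] with t ht
    exact hdec t ht
  have hfin := intervalIntegral.integral_eq_sub_of_hasDerivAt_of_le hT.le hPc hPd (by simp)
  rw [intervalIntegral.integral_zero] at hfin
  simp only [hP, ha, sub_self, sub_zero, intervalIntegral.integral_same, op_zero_apply, hy0] at hfin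
  linear_combination -hfin

/-- Exact controllability gives the coercivity of the Gramian. -/
theorem ExactlyControllable.exists_le_norm (hctrl : S.ExactlyControllable B)
    (hS : ∀ t, ‖S.op t‖ ≤ M * Real.exp (κ * |t|)) (hlam : κ < lam)
    {G : H →L[𝕜] Lp U 2 (volume.restrict (Ioi (0 : ℝ)))}
    (hG : ∀ φ : S.DomAdj, G (S.vec φ) = (memLp_wobs B hS hlam φ).toLp _) :
    ∃ C : ℝ, 0 < C ∧ ∀ x : H, ‖x‖ ≤ C * ‖G x‖ := by
  obtain ⟨T, hT, hc⟩ := hctrl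
  -- Duality argument: steering 0 to y₁ represents ⟪S(-T)* φ, y₁⟫ as an L² pairing of G φ with a
  -- function depending only on y₁. Uniform boundedness over ‖G φ‖ ≤ 1 then bounds S(-T)* φ.
  have hbdd : ∀ y₁ : H, ∃ C, ∀ φ : {φ : S.DomAdj //
      φ ∈ S.domGroup.generator.domain ∧ ‖G (S.vec φ)‖ ≤ 1},
      ‖innerSL 𝕜 (S.vec (S.domGroup.op (-T) φ.1)) y₁‖ ≤ C := by
    intro y₁
    obtain ⟨u, hu, y, hy, hyT⟩ := hc 0 y₁
    -- The factor e^{lam s} cancels the weight in G, and extension by zero reduces the infinite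
    -- horizon to (0, T).
    set w : ℝ → U := fun s => (Ioo 0 T).indicator (fun s => ((Real.exp (lam * s) : ℝ) : 𝕜) • u s) s
      with hw
    have hexp : Continuous fun s : ℝ => ((Real.exp (lam * s) : ℝ) : 𝕜) :=
      RCLike.continuous_ofReal.comp (by fun_prop)
    have hw2 : MemLp w 2 (volume.restrict (Ioi 0)) := by
      rw [hw, memLp_indicator_iff_restrict measurableSet_Ioo,
        Measure.restrict_restrict measurableSet_Ioo, inter_eq_left.2 fun t ht => ht.1]
      obtain ⟨C, hC⟩ := (isCompact_Icc (a := (0 : ℝ)) (b := T)).exists_bound_of_continuousOn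
        hexp.continuousOn
      refine (hu.norm.const_mul C).mono (hexp.aestronglyMeasurable.smul hu.1) ?_
      refine (ae_restrict_iff' measurableSet_Ioo).2 (Eventually.of_forall fun s hs => ?_)
      have h1 := hC s (Ioo_subset_Icc_self hs)
      rw [norm_smul, norm_mul, norm_norm]
      exact mul_le_mul_of_nonneg_right (h1.trans (le_abs_self C)) (norm_nonneg _)
    refine ⟨‖hw2.toLp w‖, fun ⟨φ, ⟨φ', hφ'⟩, hφ1⟩ => ?_⟩
    have h1 := hy.inner_eq_integral hT hu (S.domGroup.hasGen_op (-T) hφ')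
    rw [inner_zero_right, zero_add, hyT] at h1
    have h2 : inner 𝕜 (S.vec (S.domGroup.op (-T) φ)) y₁ = inner 𝕜 (G (S.vec φ)) (hw2.toLp w) := by
      rw [h1, hG, inner_toLp, intervalIntegral.integral_of_le hT.le, integral_Ioc_eq_integral_Ioo]
      have h3 : ∀ s, inner 𝕜 (S.wobs B lam φ s) (w s) = (Ioo 0 T).indicator
          (fun s => inner 𝕜 (S.obs B (S.domGroup.op (T - s) (S.domGroup.op (-T) φ))) (u s)) s := by
        intro s
        by_cases hs : s ∈ Ioo 0 T
        · rw [hw]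
          simp only [indicator_of_mem hs, wobs]
          rw [inner_smul_left, inner_smul_right, RCLike.conj_ofReal, ← mul_assoc,
            ← RCLike.ofReal_mul, ← Real.exp_add, ← op_add_apply]
          rw [show -lam * s + lam * s = 0 by ring, show T - s + -T = -s by ring, Real.exp_zero,
            RCLike.ofReal_one, one_mul]
        · rw [hw]
          simp only [indicator_of_notMem hs, inner_zero_right]
      simp only [h3]
      rw [setIntegral_indicator measurableSet_Ioo, inter_eq_right.2 fun t ht => ht.1]
    rw [innerSL_apply_apply, h2]
    exact (norm_inner_le_norm _ _).trans (mul_le_of_le_one_left (norm_nonneg _) hφ1)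
  obtain ⟨C₀, hC₀⟩ := banach_steinhaus hbdd
  -- S(T)* recovers φ from S(-T)* φ at the cost of ‖S(T)‖; the summand 1 makes C positive.
  set C : ℝ := ‖S.op T‖ * max C₀ 0 + 1 with hCdef
  have hC1 : 0 < C := by positivity
  have key : ∀ φ ∈ S.domGroup.generator.domain, ‖G (S.vec φ)‖ ≤ 1 → ‖S.vec φ‖ ≤ C := by
    intro φ hφ h1
    have h2 := hC₀ ⟨φ, hφ, h1⟩
    rw [innerSL_apply_norm] at h2
    have h3 : S.vec φ = S.dual.op T (S.vec (S.domGroup.op (-T) φ)) := by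
      rw [vec_domGroup, op_op_neg]
    rw [h3]
    refine (ContinuousLinearMap.le_opNorm _ _).trans ?_
    rw [norm_dual_op]
    have : ‖S.op T‖ * ‖S.vec (S.domGroup.op (-T) φ)‖ ≤ ‖S.op T‖ * max C₀ 0 := by
      gcongr
      exact h2.trans (le_max_left _ _)
    linarith
  have key2 : ∀ φ ∈ S.domGroup.generator.domain, ‖S.vec φ‖ ≤ C * ‖G (S.vec φ)‖ := by
    intro φ hφ
    refine le_of_forall_pos_le_add fun e he => ?_
    -- The summand e / C allows division even when G φ = 0, and costs exactly e after multiplication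
    -- by C.
    set N : ℝ := ‖G (S.vec φ)‖ + e / C with hN
    have hN0 : 0 < N := by positivity
    have hn : ‖(((N⁻¹ : ℝ)) : 𝕜)‖ = N⁻¹ := by
      rw [RCLike.norm_ofReal, abs_of_pos (inv_pos.2 hN0)]
    have h1 := key ((((N⁻¹ : ℝ)) : 𝕜) • φ) (Submodule.smul_mem _ _ hφ) (by
      rw [vec_smul, _root_.map_smul, norm_smul, hn, inv_mul_le_iff₀ hN0, mul_one, hN]
      have : 0 < e / C := by positivity
      linarith)
    rw [vec_smul, norm_smul, hn, inv_mul_le_iff₀ hN0, hN] at h1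
    calc _ ≤ _ := h1
      _ = _ := by field_simp
  refine ⟨C, hC1, fun x => ?_⟩
  have hGc := G.continuous
  have hv := S.continuous_vec
  refine S.denseRange_vec.induction_on (p := fun x => ‖x‖ ≤ C * ‖G x‖) x
    (isClosed_le (by fun_prop) (by fun_prop)) fun φ => ?_
  exact S.domGroup.dense_domain.induction (P := fun φ => ‖S.vec φ‖ ≤ C * ‖G (S.vec φ)‖) key2
    (isClosed_le (by fun_prop) (by fun_prop)) φ

end Observability

/-! ### The operator Q. -/

section Riccati

variable {𝕜 H U : Type*} [RCLike 𝕜]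
  [NormedAddCommGroup H] [InnerProductSpace 𝕜 H] [NormedSpace ℝ H] [IsScalarTower ℝ 𝕜 H]
  [CompleteSpace H]
  [NormedAddCommGroup U] [InnerProductSpace 𝕜 U] [NormedSpace ℝ U] [IsScalarTower ℝ 𝕜 U]
  [CompleteSpace U]
variable {S : C0Group 𝕜 H} {M κ lam : ℝ} {B : U →L[𝕜] S.DomAdjDual}

open ContinuousLinearMap in
/-- The solution `Q` of `A Q + Q A* - B B* + 2 lam Q = 0`. -/
theorem exists_riccati (hB : S.Admissible B) (hctrl : S.ExactlyControllable B) (hM : 1 ≤ M)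
    (hS : ∀ t, ‖S.op t‖ ≤ M * Real.exp (κ * |t|)) (hlam : κ < lam) (hlam0 : 0 ≤ lam) :
    ∃ Q : H ≃L[𝕜] H, IsCoercive (Q : H →L[𝕜] H) ∧
      S.RiccatiIdentity B lam (Q : H →L[𝕜] H) 0 (ContinuousLinearMap.id 𝕜 U) := by
  obtain ⟨G, hG⟩ := exists_observation_map hB hM hS hlam hlam0
  obtain ⟨C, hC, hGC⟩ := hctrl.exists_le_norm hS hlam hG
  set Q₀ : H →L[𝕜] H := (adjoint G).comp G with hQ₀
  have hin : ∀ x y, inner 𝕜 (Q₀ x) y = inner 𝕜 (G x) (G y) := fun x y => adjoint_inner_left G y (G x)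
  have hin' : ∀ x y, inner 𝕜 x (Q₀ y) = inner 𝕜 (G x) (G y) := fun x y =>
    adjoint_inner_right G x (G y)
  have hco : ∀ x, (C⁻¹) ^ 2 * ‖x‖ ^ 2 ≤ ‖G x‖ ^ 2 := fun x => by
    rw [← mul_pow]
    refine pow_le_pow_left₀ (by positivity) ?_ 2
    rw [inv_mul_le_iff₀ hC]
    exact hGC x
  -- Lax–Milgram: the lower bound on G makes G* G coercive, hence invertible.
  have hu : IsUnit Q₀ := by
    refine isUnit_of_forall_le_norm_inner_map Q₀ (c := Real.toNNReal ((C⁻¹) ^ 2))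
      (Real.toNNReal_pos.2 (by positivity)) fun x => ?_
    rw [hin, inner_self_eq_norm_sq_to_K, norm_pow, RCLike.norm_ofReal, abs_norm, mul_comm,
      Real.coe_toNNReal _ (by positivity)]
    exact hco x
  refine ⟨ContinuousLinearEquiv.ofUnit hu.unit, ?_, ?_⟩
  · change IsCoercive Q₀
    refine ⟨fun x y => (hin x y).trans (hin' x y).symm, (C⁻¹) ^ 2, by positivity, fun x => ?_⟩
    rw [hin, inner_self_eq_norm_sq]
    exact hco x
  · change S.RiccatiIdentity B lam Q₀ 0 (ContinuousLinearMap.id 𝕜 U)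
    intro φ χ
    have := gramian_identity hS hlam hG φ χ
    simp only [hin, hin', _root_.zero_apply, _root_.map_zero, inner_zero_left, add_zero,
      ContinuousLinearMap.id_apply]
    exact this

end Riccati

/-! ### Classical derivatives as distributional ones. -/

section Classical

variable {𝕜 : Type*} [RCLike 𝕜]

/-- Integration by parts; the boundary terms vanish with the test function. -/
theorem distDeriv_of_hasDerivAt {T : ℝ} {F h : ℝ → 𝕜} (hF : ContinuousOn F (Icc 0 T))
    (hh : ContinuousOn h (Icc 0 T)) (hd : ∀ t ∈ Ioo 0 T, HasDerivAt F (h t) t) :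
    DistDeriv T F h := by
  intro ψ hψ
  rcases le_or_gt T 0 with hT | hT
  · simp [Ioo_eq_empty_of_le hT]
  have hψc : Continuous fun t => ((ψ t : ℝ) : 𝕜) := RCLike.continuous_ofReal.comp hψ.1.continuous
  have hψ'c : Continuous fun t => ((deriv ψ t : ℝ) : 𝕜) :=
    RCLike.continuous_ofReal.comp (hψ.1.continuous_deriv (by simp))
  have hψ0 : ∀ t, t ∉ Ioo 0 T → ψ t = 0 := fun t ht => by
    by_contra hc
    exact ht (hψ.2.2 (subset_tsupport ψ hc))
  have i1 : IntegrableOn (fun t => ((deriv ψ t : ℝ) : 𝕜) * F t) (Ioo 0 T) :=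
    ContinuousOn.integrableOn_Ioo (hψ'c.continuousOn.mul hF)
  have i2 : IntegrableOn (fun t => ((ψ t : ℝ) : 𝕜) * h t) (Ioo 0 T) :=
    ContinuousOn.integrableOn_Ioo (hψc.continuousOn.mul hh)
  have h0m : (0 : ℝ) ∈ Icc 0 T := ⟨le_rfl, hT.le⟩
  have hTm : T ∈ Icc 0 T := ⟨hT.le, le_rfl⟩
  have key := intervalIntegral.integral_eq_sub_of_hasDerivAt_of_le hT.le
    (f := fun t => ((ψ t : ℝ) : 𝕜) * F t)
    (f' := fun t => ((deriv ψ t : ℝ) : 𝕜) * F t + ((ψ t : ℝ) : 𝕜) * h t)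
    (hψc.continuousOn.mul hF) (fun t ht => ?_)
    (intervalIntegrable_of_integrableOn_Ioo (i1.add i2) h0m hTm)
  · rw [intervalIntegral.integral_of_le hT.le, integral_Ioc_eq_integral_Ioo, integral_add i1 i2,
      hψ0 0 (by simp), hψ0 T (by simp)] at key
    simp only [RCLike.ofReal_zero, zero_mul, sub_zero] at key
    linear_combination -key
  · have h1 : HasDerivAt (fun t => ((ψ t : ℝ) : 𝕜)) ((deriv ψ t : ℝ) : 𝕜) t :=
      (RCLike.ofRealCLM (K := 𝕜)).hasFDerivAt.comp_hasDerivAt t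
        ((hψ.1.differentiable (by simp)).differentiableAt.hasDerivAt)
    exact h1.mul (hd t ht)

theorem DistDeriv.sub {T : ℝ} {F F' h h' : ℝ → 𝕜} (hd : DistDeriv T F h) (hd' : DistDeriv T F' h')
    (hF : IntegrableOn F (Ioo 0 T)) (hF' : IntegrableOn F' (Ioo 0 T))
    (hh : IntegrableOn h (Ioo 0 T)) (hh' : IntegrableOn h' (Ioo 0 T)) :
    DistDeriv T (fun t => F t - F' t) (fun t => h t - h' t) := by
  intro ψ hψ
  have hb : ∀ χ : ℝ → ℝ, Continuous χ → HasCompactSupport χ → ∀ {G : ℝ → 𝕜},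
      IntegrableOn G (Ioo 0 T) → IntegrableOn (fun t => ((χ t : ℝ) : 𝕜) * G t) (Ioo 0 T) := by
    intro χ hχ hχs G hG
    obtain ⟨C, hC⟩ := hχ.bounded_above_of_compact_support hχs
    refine Integrable.bdd_mul hG (RCLike.continuous_ofReal.comp hχ).aestronglyMeasurable
      (c := C) (Eventually.of_forall fun t => ?_)
    rw [RCLike.norm_ofReal]
    exact hC t
  have hψd := hψ.1.continuous_deriv (by simp)
  simp only [mul_sub]
  rw [integral_sub (hb _ hψd hψ.2.1.deriv hF) (hb _ hψd hψ.2.1.deriv hF'),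
    integral_sub (hb _ hψ.1.continuous hψ.2.1 hh) (hb _ hψ.1.continuous hψ.2.1 hh'), neg_sub,
    ← hd ψ hψ, ← hd' ψ hψ]
  ring

end Classical

/-! ### The adjoint equation z' = -A* z - g. -/

section Adjoint

variable {𝕜 H : Type*} [RCLike 𝕜] [NormedAddCommGroup H] [InnerProductSpace 𝕜 H]
  [NormedSpace ℝ H] [IsScalarTower ℝ 𝕜 H] [CompleteSpace H]
variable {S : C0Group 𝕜 H} {T : ℝ}

theorem IsAdjWeakSol.distDeriv {g z : ℝ → H} (hz : S.IsAdjWeakSol T g z) {x l : H}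
    (h : S.HasGen x l) : DistDeriv T (fun t => inner 𝕜 x (z t))
      (fun t => -inner 𝕜 l (z t) - inner 𝕜 x (g t)) := by
  have := hz.2 ⟨x, l, h⟩
  rwa [generator_eq S h] at this

theorem IsAdjWeakSol.sub {g g' z z' : ℝ → H} (hz : S.IsAdjWeakSol T g z)
    (hz' : S.IsAdjWeakSol T g' z') (hg : ContinuousOn g (Icc 0 T))
    (hg' : ContinuousOn g' (Icc 0 T)) :
    S.IsAdjWeakSol T (fun t => g t - g' t) (fun t => z t - z' t) := by
  refine ⟨hz.1.sub hz'.1, fun x => ?_⟩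
  have hi : ∀ (y : H) {a : ℝ → H}, ContinuousOn a (Icc 0 T) →
      IntegrableOn (fun t => inner 𝕜 y (a t)) (Ioo 0 T) := fun y a ha =>
    ContinuousOn.integrableOn_Ioo (continuousOn_const.inner ha)
  have := (hz.2 x).sub (hz'.2 x) (hi _ hz.1) (hi _ hz'.1) ((hi _ hz.1).neg.sub (hi _ hg))
    ((hi _ hz'.1).neg.sub (hi _ hg'))
  convert this using 2
  · rw [inner_sub_right]
  · rw [inner_sub_right, inner_sub_right]; ring

/-- Variation of constants for the adjoint equation. -/
theorem IsAdjWeakSol.dual_op_sub {g z : ℝ → H} (hz : S.IsAdjWeakSol T g z)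
    (hg : ContinuousOn g (Icc 0 T)) {s t : ℝ} (hs : 0 ≤ s) (hst : s ≤ t) (ht : t ≤ T) :
    S.dual.op t (z t) - S.dual.op s (z s) = -∫ τ in s..t, S.dual.op τ (g τ) := by
  rw [S.mild_of_weak hz.1 hg.neg (fun x l h => ?_) hs hst ht, ← intervalIntegral.integral_neg]
  · simp only [Pi.neg_apply, map_neg]
  · convert hz.distDeriv h using 2
    rw [Pi.neg_apply, inner_neg_right, sub_eq_add_neg]

/-- Variation of constants run backwards from T. The final value appears because B* z is defined by
density with respect to z(T) and g. -/
theorem exists_norm_le_of_isAdjWeakSol (S : C0Group 𝕜 H) (T : ℝ) :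
    ∃ C : ℝ, 1 ≤ C ∧ ∀ g z : ℝ → H, S.IsAdjWeakSol T g z → ContinuousOn g (Icc 0 T) →
      ∀ s ∈ Icc 0 T, ‖z s‖ ≤ C * (‖z T‖ + ∫ t in Ioo 0 T, ‖g t‖) := by
  obtain ⟨M, hM, hb⟩ := S.dual.exists_norm_op_le_of_abs_le |T|
  have hM0 : 0 ≤ M := by linarith
  refine ⟨M * M, one_le_mul_of_one_le_of_one_le hM hM, fun g z hz hg s hs => ?_⟩
  have h1 := hz.dual_op_sub hg hs.1 hs.2 le_rfl
  have hT : 0 ≤ T := hs.1.trans hs.2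
  have habs : ∀ t ∈ Icc 0 T, |t| ≤ |T| := fun t ht => by
    rw [abs_of_nonneg ht.1, abs_of_nonneg hT]; exact ht.2
  have h2 : z s = S.dual.op (-s) (S.dual.op T (z T) + ∫ τ in s..T, S.dual.op τ (g τ)) := by
    have : S.dual.op T (z T) + ∫ τ in s..T, S.dual.op τ (g τ) = S.dual.op s (z s) := by
      rw [sub_eq_iff_eq_add] at h1
      rw [h1]; abel
    rw [this, op_neg_op]
  have hgi : IntegrableOn (fun t => ‖g t‖) (Ioo 0 T) := ContinuousOn.integrableOn_Ioo hg.norm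
  have h3 : ‖∫ τ in s..T, S.dual.op τ (g τ)‖ ≤ M * ∫ t in Ioo 0 T, ‖g t‖ := by
    rw [intervalIntegral.integral_of_le hs.2, integral_Ioc_eq_integral_Ioo, ← integral_const_mul]
    refine (norm_integral_le_integral_norm _).trans ?_
    have hsub : Ioo s T ⊆ Ioo 0 T := Ioo_subset_Ioo_left hs.1
    refine (setIntegral_mono_set (t := Ioo 0 T) ?_ ?_ hsub.eventuallyLE).trans
      (setIntegral_mono_on ?_ (hgi.const_mul M) measurableSet_Ioo fun t ht => ?_)
    · exact ContinuousOn.integrableOn_Ioo (S.dual.continuousOn_op continuousOn_id hg).norm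
    · exact Eventually.of_forall fun _ => norm_nonneg _
    · exact ContinuousOn.integrableOn_Ioo (S.dual.continuousOn_op continuousOn_id hg).norm
    · exact (ContinuousLinearMap.le_opNorm _ _).trans (mul_le_mul_of_nonneg_right
        (hb t (habs t (Ioo_subset_Icc_self ht))) (norm_nonneg _))
  rw [h2]
  refine (ContinuousLinearMap.le_opNorm _ _).trans ?_
  rw [mul_assoc]
  refine mul_le_mul (hb _ (by rw [abs_neg]; exact habs s hs)) ?_ (norm_nonneg _) hM0
  refine (norm_add_le _ _).trans ?_
  rw [mul_add]
  refine add_le_add ((ContinuousLinearMap.le_opNorm _ _).trans ?_) h3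
  exact mul_le_mul_of_nonneg_right (hb T le_rfl) (norm_nonneg _)

/-- Weak solutions with values in `D(A*)` are classical. -/
theorem IsAdjWeakSol.hasDerivAt_vec {e d : ℝ → S.DomAdj}
    (hd : S.IsAdjWeakSol T (fun t => S.vec (e t)) (fun t => S.vec (d t)))
    (hec : ContinuousOn e (Icc 0 T)) (hdc : ContinuousOn d (Icc 0 T)) {t : ℝ} (ht : t ∈ Ioo 0 T) :
    HasDerivAt (fun t => S.vec (d t)) (-S.adjGen (d t) - S.vec (e t)) t := by
  have hT : 0 ≤ T := (ht.1.trans ht.2).le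
  set h : ℝ → H := fun t => -S.adjGen (d t) - S.vec (e t) with hh
  have hhc : ContinuousOn h (Icc 0 T) :=
    (S.continuous_adjGen.comp_continuousOn hdc).neg.sub (S.continuous_vec.comp_continuousOn hec)
  -- As d takes values in D(A*), the operator A on the test vector can be moved to d; density of
  -- D(A) then gives a vector-valued identity with continuous integrand.
  have key : ∀ t ∈ Icc 0 T, S.vec (d t) = S.vec (d 0) + ∫ s in (0 : ℝ)..t, h s := by
    intro t ht
    rw [← sub_eq_iff_eq_add']
    refine S.dense_domain.eq_of_inner_right (𝕜 := 𝕜) fun x hx => ?_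
    obtain ⟨l, hl⟩ := hx
    have h1 := (hd.distDeriv hl).sub_eq_integral (continuousOn_const.inner hd.1)
      (ContinuousOn.integrableOn_Ioo ((continuousOn_const.inner hd.1).neg.sub
        (continuousOn_const.inner (S.continuous_vec.comp_continuousOn hec)))) le_rfl ht.1 ht.2
    have hint : IntervalIntegrable h volume 0 t :=
      intervalIntegrable_of_integrableOn_Ioo (ContinuousOn.integrableOn_Ioo hhc) ⟨le_rfl, hT⟩ ht
    rw [inner_sub_right, h1, ← innerSL_apply_apply 𝕜 x (∫ s in (0 : ℝ)..t, h s),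
      ← (innerSL 𝕜 x).intervalIntegral_comp_comm hint]
    refine intervalIntegral.integral_congr fun s _ => ?_
    have h2 := hl.inner_adjGen (d s)
    simp only [innerSL_apply_apply, hh, inner_sub_right, inner_neg_right]
    rw [← inner_conj_symm l, ← h2, inner_conj_symm]
  have h1 : HasDerivAt (fun t => S.vec (d 0) + ∫ τ in (0 : ℝ)..t, h τ) (h t) t := by
    refine HasDerivAt.const_add _ (intervalIntegral.integral_hasDerivAt_right
      (intervalIntegrable_of_integrableOn_Ioo (ContinuousOn.integrableOn_Ioo hhc) ⟨le_rfl, hT⟩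
        (Ioo_subset_Icc_self ht)) ?_ ?_)
    · exact ContinuousOn.stronglyMeasurableAtFilter isOpen_Ioo (hhc.mono Ioo_subset_Icc_self) t ht
    · exact hhc.continuousAt (Icc_mem_nhds ht.1 ht.2)
  refine h1.congr_of_eventuallyEq ?_
  filter_upwards [Icc_mem_nhds ht.1 ht.2] with s hs
  exact key s hs

end Adjoint

/-! ### The energy identity and the resulting observation estimate. -/

section Energy

variable {𝕜 H U : Type*} [RCLike 𝕜]
  [NormedAddCommGroup H] [InnerProductSpace 𝕜 H] [NormedSpace ℝ H] [IsScalarTower ℝ 𝕜 H]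
  [CompleteSpace H]
  [NormedAddCommGroup U] [InnerProductSpace 𝕜 U] [CompleteSpace U]
variable {S : C0Group 𝕜 H} {lam T : ℝ} {B : U →L[𝕜] S.DomAdjDual} {Q : H →L[𝕜] H}

/-- The energy estimate for strong solutions of the adjoint equation. -/
theorem exists_integral_obs_le (hQ : Q.IsSymmetric)
    (hric : S.RiccatiIdentity B lam Q 0 (ContinuousLinearMap.id 𝕜 U)) (hlam : 0 ≤ lam)
    (hT : 0 < T) :
    ∃ C : ℝ, 0 ≤ C ∧ ∀ e d : ℝ → S.DomAdj, ContinuousOn e (Icc 0 T) → ContinuousOn d (Icc 0 T) →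
      S.IsAdjWeakSol T (fun t => S.vec (e t)) (fun t => S.vec (d t)) →
      ∫ t in Ioo 0 T, ‖S.obs B (d t)‖ ^ 2
        ≤ (C * (‖S.vec (d T)‖ + ∫ t in Ioo 0 T, ‖S.vec (e t)‖)) ^ 2 := by
  obtain ⟨C₀, hC₀, hb⟩ := S.exists_norm_le_of_isAdjWeakSol T
  -- With D bounding both ‖d‖ and the L¹ norm of e, the two endpoint energies contribute 2 ‖Q‖ D²,
  -- the source term 2 ‖Q‖ D², and the damping term 2 lam T ‖Q‖ D².
  refine ⟨Real.sqrt (‖Q‖ * (4 + 2 * lam * T)) * C₀, by positivity, fun e d hec hdc hd => ?_⟩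
  have hve : ContinuousOn (fun t => S.vec (e t)) (Icc 0 T) := S.continuous_vec.comp_continuousOn hec
  have hvd : ContinuousOn (fun t => S.vec (d t)) (Icc 0 T) := S.continuous_vec.comp_continuousOn hdc
  set N : ℝ := ∫ t in Ioo 0 T, ‖S.vec (e t)‖ with hN
  have hN0 : 0 ≤ N := integral_nonneg fun _ => norm_nonneg _
  set D : ℝ := C₀ * (‖S.vec (d T)‖ + N) with hD
  have hD0 : 0 ≤ D := by positivity
  have hND : N ≤ D := by
    have : N ≤ ‖S.vec (d T)‖ + N := le_add_of_nonneg_left (norm_nonneg _)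
    exact this.trans (le_mul_of_one_le_left (by positivity) hC₀)
  have hdD : ∀ t ∈ Icc 0 T, ‖S.vec (d t)‖ ≤ D := hb _ _ hd hve
  set q : ℝ → ℝ := fun t => RCLike.re (inner 𝕜 (Q (S.vec (d t))) (S.vec (d t))) with hq
  set r : ℝ → ℝ := fun t => 2 * lam * q t
    - 2 * RCLike.re (inner 𝕜 (Q (S.vec (d t))) (S.vec (e t))) with hr
  have hQd : ContinuousOn (fun t => Q (S.vec (d t))) (Icc 0 T) := Q.continuous.comp_continuousOn hvd
  have hqc : ContinuousOn q (Icc 0 T) := RCLike.continuous_re.comp_continuousOn (hQd.inner hvd)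
  have hrc : ContinuousOn r (Icc 0 T) := (continuousOn_const.mul hqc).sub
    (continuousOn_const.mul (RCLike.continuous_re.comp_continuousOn (hQd.inner hve)))
  have hoc : ContinuousOn (fun t => ‖S.obs B (d t)‖ ^ 2) (Icc 0 T) :=
    ((S.obs B).continuous.comp_continuousOn hdc).norm.pow 2
  -- The Riccati identity evaluated at the pair (d, d) replaces the A* terms of the derivative by
  -- the observation and the energy.
  have hder : ∀ t ∈ Ioo 0 T, HasDerivAt q (r t - ‖S.obs B (d t)‖ ^ 2) t := by
    intro t ht
    have h1 := hd.hasDerivAt_vec hec hdc ht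
    have h2 : HasDerivAt (fun t => Q (S.vec (d t))) (Q (-S.adjGen (d t) - S.vec (e t))) t :=
      (Q.restrictScalars ℝ).hasFDerivAt.comp_hasDerivAt t h1
    have h3 := (RCLike.reCLM (K := 𝕜)).hasFDerivAt.comp_hasDerivAt t (h2.inner 𝕜 h1)
    refine h3.congr_deriv ?_
    have h4 := congrArg RCLike.re (hric (d t) (d t))
    have hs : ∀ x y, inner 𝕜 (Q x) y = inner 𝕜 x (Q y) := hQ
    have h5 : ∀ x : H, RCLike.re (inner 𝕜 x (Q (S.vec (d t))))
        = RCLike.re (inner 𝕜 (Q (S.vec (d t))) x) := fun x => inner_re_symm _ _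
    have h6 : RCLike.re (inner 𝕜 (S.obs B (d t)) (S.obs B (d t))) = ‖S.obs B (d t)‖ ^ 2 :=
      inner_self_eq_norm_sq _
    have h7 : RCLike.re (2 * (lam : 𝕜) * inner 𝕜 (Q (S.vec (d t))) (S.vec (d t))) = 2 * lam * q t := by
      rw [show (2 : 𝕜) * (lam : 𝕜) = ((2 * lam : ℝ) : 𝕜) by push_cast; ring, RCLike.re_ofReal_mul]
    simp only [ContinuousLinearMap.id_apply, _root_.zero_apply, inner_zero_left, add_zero,
      _root_.map_add, map_sub, _root_.map_zero] at h4
    rw [h7, h6, h5] at h4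
    simp only [RCLike.reCLM_apply, _root_.map_add]
    rw [hs (-S.adjGen (d t) - S.vec (e t))]
    rw [inner_sub_left, inner_sub_right, inner_neg_left, inner_neg_right, map_sub, map_sub, map_neg,
      map_neg, h5, h5]
    simp only [hr]
    linarith
  have hoi := ContinuousOn.integrableOn_Ioo hoc
  have hri := ContinuousOn.integrableOn_Ioo hrc
  have h0m : (0 : ℝ) ∈ Icc 0 T := ⟨le_rfl, hT.le⟩
  have hTm : T ∈ Icc 0 T := ⟨hT.le, le_rfl⟩
  have hftc := intervalIntegral.integral_eq_sub_of_hasDerivAt_of_le hT.le hqc hder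
    (intervalIntegrable_of_integrableOn_Ioo (hri.sub hoi) h0m hTm)
  rw [intervalIntegral.integral_of_le hT.le, integral_Ioc_eq_integral_Ioo, integral_sub hri hoi]
    at hftc
  have hqb : ∀ t ∈ Icc 0 T, |q t| ≤ ‖Q‖ * D ^ 2 := fun t ht => by
    refine (RCLike.abs_re_le_norm _).trans ((norm_inner_le_norm _ _).trans ?_)
    rw [sq, ← mul_assoc]
    have h1 := hdD t ht
    refine mul_le_mul ((ContinuousLinearMap.le_opNorm _ _).trans ?_) h1 (norm_nonneg _)
      (by positivity)
    gcongr
  have hrb : ∫ t in Ioo 0 T, r t ≤ 2 * lam * T * (‖Q‖ * D ^ 2) + 2 * (‖Q‖ * D) * N := by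
    have hei : IntegrableOn (fun t => ‖S.vec (e t)‖) (Ioo 0 T) :=
      ContinuousOn.integrableOn_Ioo hve.norm
    have hci : IntegrableOn (fun _ : ℝ => 2 * lam * (‖Q‖ * D ^ 2)) (Ioo 0 T) :=
      ContinuousOn.integrableOn_Ioo continuousOn_const
    have h1 : ∫ t in Ioo 0 T, r t
        ≤ ∫ t in Ioo 0 T, (2 * lam * (‖Q‖ * D ^ 2) + 2 * (‖Q‖ * D) * ‖S.vec (e t)‖) := by
      refine setIntegral_mono_on hri (hci.add (hei.const_mul _)) measurableSet_Ioo fun t ht => ?_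
      have ht' := Ioo_subset_Icc_self ht
      have h2 := (abs_le.1 (hqb t ht')).2
      have h3 : -RCLike.re (inner 𝕜 (Q (S.vec (d t))) (S.vec (e t))) ≤ ‖Q‖ * D * ‖S.vec (e t)‖ := by
        refine (neg_le_abs _).trans ((RCLike.abs_re_le_norm _).trans
          ((norm_inner_le_norm _ _).trans ?_))
        refine mul_le_mul_of_nonneg_right ((ContinuousLinearMap.le_opNorm _ _).trans ?_)
          (norm_nonneg _)
        have := hdD t ht'
        gcongr
      have h4 : 2 * lam * q t ≤ 2 * lam * (‖Q‖ * D ^ 2) :=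
        mul_le_mul_of_nonneg_left h2 (by positivity)
      simp only [hr]
      linarith
    rw [integral_add hci (hei.const_mul _), setIntegral_const, integral_const_mul,
      Real.volume_real_Ioo_of_le hT.le, sub_zero, smul_eq_mul] at h1
    linarith
  have hq0 := (abs_le.1 (hqb 0 h0m)).2
  have hqT := (abs_le.1 (hqb T hTm)).1
  have hQD : 2 * (‖Q‖ * D) * N ≤ 2 * (‖Q‖ * D ^ 2) := by
    have : ‖Q‖ * D * N ≤ ‖Q‖ * D * D := by gcongr
    nlinarith
  rw [mul_assoc, ← hD, mul_pow, Real.sq_sqrt (by positivity)]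
  linarith

end Energy

/-! ### L¹ norms as integrals. -/

section L1

theorem toReal_eLpNorm_one {X E : Type*} [MeasurableSpace X] {μ : Measure X} [NormedAddCommGroup E]
    {g : X → E} (hg : AEStronglyMeasurable g μ) :
    (eLpNorm g 1 μ).toReal = ∫ x, ‖g x‖ ∂μ := by
  rw [eLpNorm_one_eq_lintegral_enorm, integral_norm_eq_lintegral_enorm hg]

theorem tendsto_integral_norm_of_eLpNorm_one {X E : Type*} [MeasurableSpace X] {μ : Measure X}
    [NormedAddCommGroup E] {g : ℕ → X → E} (hg : ∀ n, AEStronglyMeasurable (g n) μ)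
    (h : Tendsto (fun n => eLpNorm (g n) 1 μ) atTop (𝓝 0)) :
    Tendsto (fun n => ∫ x, ‖g n x‖ ∂μ) atTop (𝓝 0) := by
  have := (ENNReal.tendsto_toReal ENNReal.zero_ne_top).comp h
  exact this.congr fun n => toReal_eLpNorm_one (hg n)

end L1

/-! ### Approximation of adjoint solutions by solutions with values in D(A*). -/

section Smoothing

variable {𝕜 H : Type*} [RCLike 𝕜] [NormedAddCommGroup H] [InnerProductSpace 𝕜 H]
  [NormedSpace ℝ H] [IsScalarTower ℝ 𝕜 H] [CompleteSpace H]
variable {S : C0Group 𝕜 H} {T : ℝ}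

theorem HasGen.avg {x l : H} (h : S.HasGen x l) (ε : ℝ) : S.HasGen (S.avg ε x) (S.avg ε l) := by
  have h1 := S.hasGen_avg ε x
  have h2 := h.op_sub_eq_integral 0 ε
  rw [op_zero_apply] at h2
  rwa [h2] at h1

/-- An average of z tested with x is z tested with an average of x, and averages commute with the
generator. -/
theorem IsAdjWeakSol.smooth {g z : ℝ → H} (hz : S.IsAdjWeakSol T g z) (ε : ℝ) :
    S.IsAdjWeakSol T (fun t => S.vec (S.smooth ε (g t))) (fun t => S.vec (S.smooth ε (z t))) := by
  refine ⟨(S.dual.avg ε).continuous.comp_continuousOn hz.1, fun x => ?_⟩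
  have h1 := S.generator_spec x
  have := hz.distDeriv (h1.avg ε)
  simpa only [vec_smooth, inner_dual_avg] using this

/-- The averages converge strongly along ε = 1 / (n + 1), so uniform boundedness applies; the bound
supplies the dominating function in the L¹ convergence below. -/
theorem exists_norm_avg_le (S : C0Group 𝕜 H) :
    ∃ C : ℝ, ∀ n : ℕ, ‖S.avg (1 / ((n : ℝ) + 1))‖ ≤ C :=
  banach_steinhaus fun x => by
    obtain ⟨C, hC⟩ := ((S.tendsto_avg x).comp tendsto_inv_succ_ne).norm.bddAbove_range
    exact ⟨C, fun n => hC ⟨n, rfl⟩⟩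

theorem tendsto_eLpNorm_avg_sub (S : C0Group 𝕜 H) {g : ℝ → H} (hg : ContinuousOn g (Icc 0 T)) :
    Tendsto (fun n : ℕ => eLpNorm (fun t => S.avg (1 / ((n : ℝ) + 1)) (g t) - g t) 1
      (volume.restrict (Ioo 0 T))) atTop (𝓝 0) := by
  obtain ⟨C, hC⟩ := S.exists_norm_avg_le
  have hgi : IntegrableOn (fun t => ‖g t‖) (Ioo 0 T) := ContinuousOn.integrableOn_Ioo hg.norm
  have h1 := tendsto_lintegral_norm_of_dominated_convergence (μ := volume.restrict (Ioo 0 T))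
    (F := fun (n : ℕ) t => S.avg (1 / ((n : ℝ) + 1)) (g t)) (f := g) (bound := fun t => C * ‖g t‖)
    (fun n => (ContinuousOn.integrableOn_Ioo
      ((S.avg _).continuous.comp_continuousOn hg)).aestronglyMeasurable)
    (hgi.const_mul C).2
    (fun n => Eventually.of_forall fun t => (ContinuousLinearMap.le_opNorm _ _).trans
      (mul_le_mul_of_nonneg_right (hC n) (norm_nonneg _)))
    (Eventually.of_forall fun t => (S.tendsto_avg (g t)).comp tendsto_inv_succ_ne)
  simpa only [eLpNorm_one_eq_lintegral_enorm, ofReal_norm] using h1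

end Smoothing

/-! ### Existence and uniqueness of B* z in L². -/

section Obs

variable {𝕜 H U : Type*} [RCLike 𝕜]
  [NormedAddCommGroup H] [InnerProductSpace 𝕜 H] [NormedSpace ℝ H] [IsScalarTower ℝ 𝕜 H]
  [CompleteSpace H]
  [NormedAddCommGroup U] [InnerProductSpace 𝕜 U] [CompleteSpace U]
variable {S : C0Group 𝕜 H} {lam T : ℝ} {B : U →L[𝕜] S.DomAdjDual} {Q : H →L[𝕜] H}

theorem exists_eLpNorm_obs_le (hQ : Q.IsSymmetric)
    (hric : S.RiccatiIdentity B lam Q 0 (ContinuousLinearMap.id 𝕜 U)) (hlam : 0 ≤ lam)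
    (hT : 0 < T) :
    ∃ C : ℝ, 0 ≤ C ∧ ∀ e d : ℝ → S.DomAdj, ContinuousOn e (Icc 0 T) → ContinuousOn d (Icc 0 T) →
      S.IsAdjWeakSol T (fun t => S.vec (e t)) (fun t => S.vec (d t)) →
      eLpNorm (fun t => S.obs B (d t)) 2 (volume.restrict (Ioo 0 T))
        ≤ ENNReal.ofReal (C * (‖S.vec (d T)‖ + ∫ t in Ioo 0 T, ‖S.vec (e t)‖)) := by
  obtain ⟨C, hC, h⟩ := exists_integral_obs_le hQ hric hlam hT
  refine ⟨C, hC, fun e d he hd hw => ?_⟩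
  have hm : MemLp (fun t => S.obs B (d t)) 2 (volume.restrict (Ioo 0 T)) :=
    memLp_of_continuousOn_Icc ((S.obs B).continuous.comp_continuousOn hd)
  have h1 := h e d he hd hw
  rw [← norm_sq_toLp 𝕜 hm] at h1
  have hN : 0 ≤ ∫ t in Ioo 0 T, ‖S.vec (e t)‖ := integral_nonneg fun _ => norm_nonneg _
  have h2 := le_of_sq_le_sq h1 (by positivity)
  rw [Lp.norm_toLp] at h2
  rw [← ENNReal.ofReal_toReal hm.2.ne]
  exact ENNReal.ofReal_le_ofReal h2

theorem aestronglyMeasurable_of_continuousOn_Icc {E : Type*} [NormedAddCommGroup E] {g : ℝ → E}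
    (hg : ContinuousOn g (Icc 0 T)) : AEStronglyMeasurable g (volume.restrict (Ioo 0 T)) :=
  (ContinuousOn.integrableOn_Ioo hg).aestronglyMeasurable

/-- `B* z` is well defined. -/
theorem IsObs.ae_eq (hQ : Q.IsSymmetric)
    (hric : S.RiccatiIdentity B lam Q 0 (ContinuousLinearMap.id 𝕜 U)) (hlam : 0 ≤ lam)
    (hT : 0 < T) {g g' z z' : ℝ → H} {v v' : ℝ → U} (h : S.IsObs B T g z v)
    (h' : S.IsObs B T g' z' v') (hg : ContinuousOn g (Icc 0 T)) (hgg : EqOn g g' (Icc 0 T))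
    (hzz : z T = z' T) : v =ᵐ[volume.restrict (Ioo 0 T)] v' := by
  obtain ⟨C, hC, hb⟩ := exists_eLpNorm_obs_le hQ hric hlam hT
  obtain ⟨hv, gn, zn, hgn, hzn, hw, hzT, hgL, hvL⟩ := h
  obtain ⟨hv', gn', zn', hgn', hzn', hw', hzT', hgL', hvL'⟩ := h'
  have hc : ∀ {a : ℝ → S.DomAdj}, ContinuousOn a (Icc 0 T) →
      ContinuousOn (fun t => S.vec (a t)) (Icc 0 T) := fun ha => S.continuous_vec.comp_continuousOn ha
  have hg' : ContinuousOn g' (Icc 0 T) := hg.congr fun t ht => (hgg ht).symm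
  have hgL'' : Tendsto (fun n => eLpNorm (fun t => S.vec (gn' n t) - g t) 1
      (volume.restrict (Ioo 0 T))) atTop (𝓝 0) := by
    refine hgL'.congr fun n => eLpNorm_congr_ae ?_
    refine (ae_restrict_iff' measurableSet_Ioo).2 (Eventually.of_forall fun t ht => ?_)
    simp only [hgg (Ioo_subset_Icc_self ht)]
  have hmem : ∀ {a : ℝ → S.DomAdj}, ContinuousOn a (Icc 0 T) →
      AEStronglyMeasurable (fun t => S.vec (a t) - g t) (volume.restrict (Ioo 0 T)) := fun ha =>
    aestronglyMeasurable_of_continuousOn_Icc ((hc ha).sub hg)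
  have hobs : ∀ {a : ℝ → S.DomAdj}, ContinuousOn a (Icc 0 T) →
      AEStronglyMeasurable (fun t => S.obs B (a t)) (volume.restrict (Ioo 0 T)) := fun ha =>
    aestronglyMeasurable_of_continuousOn_Icc ((S.obs B).continuous.comp_continuousOn ha)
  have he : Tendsto (fun n => ∫ t in Ioo 0 T, ‖S.vec (gn n t - gn' n t)‖) atTop (𝓝 0) := by
    refine tendsto_integral_norm_of_eLpNorm_one
      (fun n => aestronglyMeasurable_of_continuousOn_Icc (hc ((hgn n).sub (hgn' n)))) ?_
    have h1 := hgL.add hgL''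
    rw [add_zero] at h1
    refine tendsto_of_tendsto_of_tendsto_of_le_of_le tendsto_const_nhds h1 (fun _ => zero_le)
      fun n => ?_
    refine le_trans (eLpNorm_congr_ae (Eventually.of_forall fun t => ?_)).le
      (eLpNorm_sub_le (hmem (hgn n)) (hmem (hgn' n)) le_rfl)
    simp only [vec_sub, Pi.sub_apply, sub_sub_sub_cancel_right]
  -- The difference of the two approximations solves the adjoint equation with final value and
  -- source tending to 0, so the energy estimate applies.
  have hd : Tendsto (fun n => eLpNorm (fun t => S.obs B (zn n t - zn' n t)) 2
      (volume.restrict (Ioo 0 T))) atTop (𝓝 0) := by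
    have h1 : Tendsto (fun n => ENNReal.ofReal (C * (‖S.vec (zn n T - zn' n T)‖
        + ∫ t in Ioo 0 T, ‖S.vec (gn n t - gn' n t)‖))) atTop (𝓝 0) := by
      have h2 := (hzT.sub hzT').norm
      rw [hzz, sub_self, norm_zero] at h2
      have h3 := ENNReal.tendsto_ofReal ((h2.add he).const_mul C)
      simpa [vec_sub] using h3
    refine tendsto_of_tendsto_of_tendsto_of_le_of_le tendsto_const_nhds h1 (fun _ => zero_le)
      fun n => ?_
    refine hb (fun t => gn n t - gn' n t) (fun t => zn n t - zn' n t) ((hgn n).sub (hgn' n))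
      ((hzn n).sub (hzn' n)) ?_
    exact (hw n).sub (hw' n) (hc (hgn n)) (hc (hgn' n))
  have hfin : Tendsto (fun n => eLpNorm (fun t => S.obs B (zn n t) - v t) 2 (volume.restrict (Ioo 0 T))
      + eLpNorm (fun t => S.obs B (zn n t - zn' n t)) 2 (volume.restrict (Ioo 0 T))
      + eLpNorm (fun t => S.obs B (zn' n t) - v' t) 2 (volume.restrict (Ioo 0 T))) atTop (𝓝 0) := by
    simpa using (hvL.add hd).add hvL'
  have hle : eLpNorm (fun t => v t - v' t) 2 (volume.restrict (Ioo 0 T)) ≤ 0 := by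
    refine ge_of_tendsto hfin (Eventually.of_forall fun n => ?_)
    have e : (fun t => v t - v' t) = -(fun t => S.obs B (zn n t) - v t)
        + (fun t => S.obs B (zn n t - zn' n t)) + fun t => S.obs B (zn' n t) - v' t := by
      funext t
      simp only [Pi.add_apply, Pi.neg_apply, map_sub]
      abel
    have m1 := (hobs (hzn n)).sub hv.1
    have m2 := hobs ((hzn n).sub (hzn' n))
    rw [e]
    refine (eLpNorm_add_le (m1.neg.add m2) ((hobs (hzn' n)).sub hv'.1) one_le_two).trans ?_
    refine add_le_add_left ((eLpNorm_add_le m1.neg m2 one_le_two).trans ?_) _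
    rw [eLpNorm_neg]
    exact le_rfl
  have h0 := (eLpNorm_eq_zero_iff (hv.1.sub hv'.1) two_ne_zero).1 (le_antisymm hle zero_le)
  filter_upwards [h0] with t ht
  exact sub_eq_zero.1 ht

/-- `B* z` exists. -/
theorem exists_isObs (hQ : Q.IsSymmetric)
    (hric : S.RiccatiIdentity B lam Q 0 (ContinuousLinearMap.id 𝕜 U)) (hlam : 0 ≤ lam)
    (hT : 0 < T) {g z : ℝ → H} (hz : S.IsAdjWeakSol T g z) (hg : ContinuousOn g (Icc 0 T)) :
    ∃ v : ℝ → U, S.IsObs B T g z v := by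
  obtain ⟨C, hC, hb⟩ := exists_eLpNorm_obs_le hQ hric hlam hT
  set J : ℕ → H →L[𝕜] S.DomAdj := fun n => S.smooth (1 / ((n : ℝ) + 1)) with hJ
  have hgn : ∀ n, ContinuousOn (fun t => J n (g t)) (Icc 0 T) := fun n =>
    (J n).continuous.comp_continuousOn hg
  have hzn : ∀ n, ContinuousOn (fun t => J n (z t)) (Icc 0 T) := fun n =>
    (J n).continuous.comp_continuousOn hz.1
  have hw : ∀ n, S.IsAdjWeakSol T (fun t => S.vec (J n (g t))) (fun t => S.vec (J n (z t))) :=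
    fun n => hz.smooth _
  have hzT : Tendsto (fun n => S.vec (J n (z T))) atTop (𝓝 (z T)) :=
    (S.dual.tendsto_avg (z T)).comp tendsto_inv_succ_ne
  have hgL : Tendsto (fun n => eLpNorm (fun t => S.vec (J n (g t)) - g t) 1
      (volume.restrict (Ioo 0 T))) atTop (𝓝 0) := S.dual.tendsto_eLpNorm_avg_sub hg
  have hc : ∀ {a : ℝ → S.DomAdj}, ContinuousOn a (Icc 0 T) →
      ContinuousOn (fun t => S.vec (a t)) (Icc 0 T) := fun ha => S.continuous_vec.comp_continuousOn ha
  have hgI : Tendsto (fun n => ∫ t in Ioo 0 T, ‖S.vec (J n (g t)) - g t‖) atTop (𝓝 0) :=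
    tendsto_integral_norm_of_eLpNorm_one
      (fun n => aestronglyMeasurable_of_continuousOn_Icc ((hc (hgn n)).sub hg)) hgL
  -- The energy estimate bounds the L² distance of the n-th and m-th observations by α n + α m, so
  -- they form a Cauchy sequence.
  set α : ℕ → ℝ := fun n => C * (‖S.vec (J n (z T)) - z T‖
    + ∫ t in Ioo 0 T, ‖S.vec (J n (g t)) - g t‖) with hα
  have hα0 : Tendsto α atTop (𝓝 0) := by
    have h1 := (tendsto_iff_norm_sub_tendsto_zero.1 hzT)
    simpa using (h1.add hgI).const_mul C
  have hm : ∀ n, MemLp (fun t => S.obs B (J n (z t))) 2 (volume.restrict (Ioo 0 T)) := fun n =>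
    memLp_of_continuousOn_Icc ((S.obs B).continuous.comp_continuousOn (hzn n))
  have hdist : ∀ n m, dist ((hm n).toLp _) ((hm m).toLp _) ≤ α n + α m := by
    intro n m
    have h1 := hb (fun t => J n (g t) - J m (g t)) (fun t => J n (z t) - J m (z t))
      ((hgn n).sub (hgn m)) ((hzn n).sub (hzn m)) ((hw n).sub (hw m) (hc (hgn n)) (hc (hgn m)))
    have h2 : ‖S.vec (J n (z T) - J m (z T))‖ ≤ ‖S.vec (J n (z T)) - z T‖ + ‖S.vec (J m (z T)) - z T‖ := by
      rw [vec_sub, ← sub_sub_sub_cancel_right _ _ (z T)]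
      exact norm_sub_le _ _
    have hi : ∀ k, IntegrableOn (fun t => ‖S.vec (J k (g t)) - g t‖) (Ioo 0 T) := fun k =>
      ContinuousOn.integrableOn_Ioo ((hc (hgn k)).sub hg).norm
    have h3 : ∫ t in Ioo 0 T, ‖S.vec (J n (g t) - J m (g t))‖
        ≤ (∫ t in Ioo 0 T, ‖S.vec (J n (g t)) - g t‖) + ∫ t in Ioo 0 T, ‖S.vec (J m (g t)) - g t‖ := by
      rw [← integral_add (hi n) (hi m)]
      refine integral_mono (ContinuousOn.integrableOn_Ioo (hc ((hgn n).sub (hgn m))).norm)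
        ((hi n).add (hi m)) fun t => ?_
      simp only
      rw [vec_sub, ← sub_sub_sub_cancel_right _ _ (g t)]
      exact norm_sub_le _ _
    rw [dist_eq_norm, ← MemLp.toLp_sub, Lp.norm_toLp]
    refine ENNReal.toReal_le_of_le_ofReal ?_ ?_
    · have hI : ∀ k, 0 ≤ ∫ t in Ioo 0 T, ‖S.vec (J k (g t)) - g t‖ := fun k =>
        integral_nonneg fun _ => norm_nonneg _
      have := hI n
      have := hI m
      simp only [hα]
      positivity
    · have e : ((fun t => S.obs B (J n (z t))) - fun t => S.obs B (J m (z t)))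
          = fun t => S.obs B (J n (z t) - J m (z t)) := by
        funext t; rw [map_sub]; rfl
      rw [e]
      refine h1.trans (ENNReal.ofReal_le_ofReal ?_)
      simp only [hα]
      rw [← mul_add]
      exact mul_le_mul_of_nonneg_left (by linarith) hC
  have hcauchy : CauchySeq fun n => (hm n).toLp _ := by
    rw [Metric.cauchySeq_iff]
    intro ε hε
    obtain ⟨N, hN⟩ := eventually_atTop.1 (hα0.eventually_lt_const (half_pos hε))
    exact ⟨N, fun m hm' n hn' => (hdist m n).trans_lt (by linarith [hN m hm', hN n hn'])⟩
  obtain ⟨v, hv⟩ := cauchySeq_tendsto_of_complete hcauchy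
  refine ⟨v, Lp.memLp v, fun n t => J n (g t), fun n t => J n (z t), hgn, hzn, hw, hzT, hgL, ?_⟩
  rw [← Lp.toLp_coeFn v (Lp.memLp v), Lp.tendsto_Lp_iff_tendsto_eLpNorm''] at hv
  exact hv

end Obs

/-! ### Q carries adjoint solutions to controlled solutions. -/

section ClosedLoop

variable {𝕜 H U : Type*} [RCLike 𝕜]
  [NormedAddCommGroup H] [InnerProductSpace 𝕜 H] [NormedSpace ℝ H] [IsScalarTower ℝ 𝕜 H]
  [CompleteSpace H]
  [NormedAddCommGroup U] [InnerProductSpace 𝕜 U] [CompleteSpace U]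
variable {S : C0Group 𝕜 H} {lam T : ℝ} {B : U →L[𝕜] S.DomAdjDual} {Q : H →L[𝕜] H}

theorem integrableOn_test_mul_inner {E : Type*} [NormedAddCommGroup E] [InnerProductSpace 𝕜 E]
    {c : ℝ → E} (hc : IntegrableOn c (Ioo 0 T)) {χ : ℝ → ℝ} (hχ : Continuous χ)
    (hχs : HasCompactSupport χ) (x : E) :
    IntegrableOn (fun t => ((χ t : ℝ) : 𝕜) * inner 𝕜 x (c t)) (Ioo 0 T) := by
  obtain ⟨C, hC⟩ := hχ.bounded_above_of_compact_support hχs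
  refine Integrable.bdd_mul (hc.const_inner x) (RCLike.continuous_ofReal.comp hχ).aestronglyMeasurable
    (c := C) (Eventually.of_forall fun t => ?_)
  rw [RCLike.norm_ofReal]
  exact hC t

theorem tendsto_integral_test_mul {E : Type*} [NormedAddCommGroup E] [InnerProductSpace 𝕜 E]
    {a : ℕ → ℝ → E} {b : ℝ → E} (ha : ∀ n, IntegrableOn (a n) (Ioo 0 T))
    (hb : IntegrableOn b (Ioo 0 T)) {χ : ℝ → ℝ} (hχ : Continuous χ) (hχs : HasCompactSupport χ)
    (h : Tendsto (fun n => eLpNorm (fun t => a n t - b t) 1 (volume.restrict (Ioo 0 T))) atTop (𝓝 0))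
    (x : E) :
    Tendsto (fun n => ∫ t in Ioo 0 T, ((χ t : ℝ) : 𝕜) * inner 𝕜 x (a n t)) atTop
      (𝓝 (∫ t in Ioo 0 T, ((χ t : ℝ) : 𝕜) * inner 𝕜 x (b t))) := by
  obtain ⟨C, hC⟩ := hχ.bounded_above_of_compact_support hχs
  refine tendsto_integral_of_L1' _ (integrableOn_test_mul_inner hb hχ hχs x).aestronglyMeasurable
    (Eventually.of_forall fun n => integrableOn_test_mul_inner (ha n) hχ hχs x) ?_
  have h1 := ENNReal.Tendsto.const_mul (a := ENNReal.ofReal (C * ‖x‖)) h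
    (Or.inr ENNReal.ofReal_ne_top)
  rw [mul_zero] at h1
  refine tendsto_of_tendsto_of_tendsto_of_le_of_le tendsto_const_nhds h1 (fun _ => zero_le)
    fun n => ?_
  refine eLpNorm_le_mul_eLpNorm_of_ae_le_mul (Eventually.of_forall fun t => ?_) 1
  rw [Pi.sub_apply, ← mul_sub, ← inner_sub_right, norm_mul, RCLike.norm_ofReal, mul_assoc]
  exact mul_le_mul (hC t) (norm_inner_le_norm _ _) (norm_nonneg _) ((norm_nonneg _).trans (hC t))

/-- If `z` solves the adjoint equation then `Q z` solves the controlled equation, the control being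
`-B* z`. -/
theorem IsObs.isWeakSol (hQ : Q.IsSymmetric)
    (hric : S.RiccatiIdentity B lam Q 0 (ContinuousLinearMap.id 𝕜 U))
    {g z h : ℝ → H} {v : ℝ → U} (hz : S.IsAdjWeakSol T g z) (hg : ContinuousOn g (Icc 0 T))
    (hv : S.IsObs B T g z v)
    (hh : ∀ t, h t = (2 * (lam : 𝕜)) • Q (z t) - Q (g t)) :
    S.IsWeakSol B T (Q (z 0)) h (fun t => -v t) (fun t => Q (z t)) := by
  obtain ⟨hvm, gn, zn, hgn, hzn, hw, hzT, hgL, hvL⟩ := hv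
  refine ⟨Q.continuous.comp_continuousOn hz.1, rfl, fun φ ψ hψ => ?_⟩
  have hs : ∀ x y, inner 𝕜 (Q x) y = inner 𝕜 x (Q y) := hQ
  have hc : ∀ {a : ℝ → S.DomAdj}, ContinuousOn a (Icc 0 T) →
      ContinuousOn (fun t => S.vec (a t)) (Icc 0 T) := fun ha => S.continuous_vec.comp_continuousOn ha
  have hgI : Tendsto (fun n => ∫ t in Ioo 0 T, ‖S.vec (gn n t) - g t‖) atTop (𝓝 0) :=
    tendsto_integral_norm_of_eLpNorm_one
      (fun n => aestronglyMeasurable_of_continuousOn_Icc ((hc (hgn n)).sub hg)) hgL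
  have hzL : Tendsto (fun n => eLpNorm (fun t => S.vec (zn n t) - z t) 1
      (volume.restrict (Ioo 0 T))) atTop (𝓝 0) := by
    obtain ⟨C, hC, hb⟩ := S.exists_norm_le_of_isAdjWeakSol T
    have h0 : Tendsto (fun n => ENNReal.ofReal (C * (‖S.vec (zn n T) - z T‖
        + ∫ t in Ioo 0 T, ‖S.vec (gn n t) - g t‖)) * volume (Ioo 0 T)) atTop (𝓝 0) := by
      have h1 := ENNReal.tendsto_ofReal
        (((tendsto_iff_norm_sub_tendsto_zero.1 hzT).add hgI).const_mul C)
      have h2 := ENNReal.Tendsto.mul_const (b := volume (Ioo 0 T)) h1 (Or.inr (by simp))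
      simpa using h2
    refine tendsto_of_tendsto_of_tendsto_of_le_of_le tendsto_const_nhds h0 (fun _ => zero_le)
      fun n => ?_
    have h1 := hb _ _ ((hw n).sub hz (hc (hgn n)) hg) ((hc (hgn n)).sub hg)
    rw [eLpNorm_one_eq_lintegral_enorm, ← setLIntegral_const]
    refine setLIntegral_mono' measurableSet_Ioo fun t ht => ?_
    rw [← ofReal_norm]
    exact ENNReal.ofReal_le_ofReal (h1 t (Ioo_subset_Icc_self ht))
  -- On a bounded interval L² convergence implies L¹ convergence, which is enough against bounded
  -- test functions.
  have hoL : Tendsto (fun n => eLpNorm (fun t => S.obs B (zn n t) - v t) 1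
      (volume.restrict (Ioo 0 T))) atTop (𝓝 0) := by
    have h0 := ENNReal.Tendsto.mul_const
      (b := (volume.restrict (Ioo 0 T)) univ ^ (1 / (1 : ENNReal).toReal - 1 / (2 : ENNReal).toReal))
      hvL (Or.inr (ENNReal.rpow_ne_top_of_nonneg (by norm_num) (by simp)))
    rw [zero_mul] at h0
    refine tendsto_of_tendsto_of_tendsto_of_le_of_le tendsto_const_nhds h0 (fun _ => zero_le)
      fun n => ?_
    exact eLpNorm_le_eLpNorm_mul_rpow_measure_univ one_le_two
      ((aestronglyMeasurable_of_continuousOn_Icc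
        ((S.obs B).continuous.comp_continuousOn (hzn n))).sub hvm.1)
  have hi : ∀ {a : ℝ → H}, ContinuousOn a (Icc 0 T) → IntegrableOn a (Ioo 0 T) := fun ha =>
    ContinuousOn.integrableOn_Ioo ha
  have hψd := hψ.1.continuous_deriv (by simp)
  have hψc := hψ.1.continuous
  have hvi : IntegrableOn v (Ioo 0 T) := hvm.integrable one_le_two
  have hoi : ∀ n, IntegrableOn (fun t => S.obs B (zn n t)) (Ioo 0 T) := fun n =>
    ContinuousOn.integrableOn_Ioo ((S.obs B).continuous.comp_continuousOn (hzn n))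
  set p := Q (S.vec φ) with hp
  -- The fixed vector of H collecting the terms of the Riccati identity that do not involve A* zn.
  -- After the substitution below, every term is continuous under L¹ limits of zn, gn and B* zn.
  set x₁ := Q (S.adjGen φ) + (2 * (lam : 𝕜)) • p with hx₁
  have hx : ∀ y, inner 𝕜 x₁ y = inner 𝕜 (S.adjGen φ) (Q y) + 2 * (lam : 𝕜) * inner 𝕜 p y := by
    intro y
    rw [hx₁, inner_add_left, inner_smul_left, hs, map_mul, RCLike.conj_ofReal, map_ofNat]
  -- For D(A*)-valued solutions the equation holds classically, and the Riccati identity at (φ, zn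
  -- t) rewrites -⟪Q φ, A* zn⟫ as ⟪x₁, zn⟫ - ⟪B* φ, B* zn⟫.
  have hn : ∀ n, -∫ t in Ioo 0 T, ((deriv ψ t : ℝ) : 𝕜) * inner 𝕜 p (S.vec (zn n t))
      = (∫ t in Ioo 0 T, ((ψ t : ℝ) : 𝕜) * inner 𝕜 x₁ (S.vec (zn n t)))
        - (∫ t in Ioo 0 T, ((ψ t : ℝ) : 𝕜) * inner 𝕜 p (S.vec (gn n t)))
        - ∫ t in Ioo 0 T, ((ψ t : ℝ) : 𝕜) * inner 𝕜 (S.obs B φ) (S.obs B (zn n t)) := by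
    intro n
    have hd : DistDeriv T (fun t => inner 𝕜 p (S.vec (zn n t)))
        (fun t => inner 𝕜 p (-S.adjGen (zn n t) - S.vec (gn n t))) := by
      refine distDeriv_of_hasDerivAt (continuousOn_const.inner (hc (hzn n)))
        (continuousOn_const.inner
          (((S.continuous_adjGen.comp_continuousOn (hzn n)).neg).sub (hc (hgn n)))) fun t ht => ?_
      have h1 := ((hw n).hasDerivAt_vec (hgn n) (hzn n) ht)
      exact ((innerSL 𝕜 p).restrictScalars ℝ).hasFDerivAt.comp_hasDerivAt t h1
    rw [hd ψ hψ, ← integral_sub, ← integral_sub]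
    · refine setIntegral_congr_fun measurableSet_Ioo fun t _ => ?_
      have h1 := hric φ (zn n t)
      simp only [_root_.zero_apply, inner_zero_left, add_zero, ContinuousLinearMap.id_apply] at h1
      simp only [hx, inner_sub_right, inner_neg_right]
      linear_combination (-(ψ t : ℝ) : 𝕜) * h1
    · exact (integrableOn_test_mul_inner (hi (hc (hzn n))) hψc hψ.2.1 x₁).sub
        (integrableOn_test_mul_inner (hi (hc (hgn n))) hψc hψ.2.1 p)
    · exact integrableOn_test_mul_inner (hoi n) hψc hψ.2.1 _
    · exact integrableOn_test_mul_inner (hi (hc (hzn n))) hψc hψ.2.1 x₁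
    · exact integrableOn_test_mul_inner (hi (hc (hgn n))) hψc hψ.2.1 p
  have hl := (tendsto_integral_test_mul (𝕜 := 𝕜) (fun n => hi (hc (hzn n))) (hi hz.1) hψd
    hψ.2.1.deriv hzL p).neg
  have hr := ((tendsto_integral_test_mul (𝕜 := 𝕜) (fun n => hi (hc (hzn n))) (hi hz.1) hψc
    hψ.2.1 hzL x₁).sub (tendsto_integral_test_mul (𝕜 := 𝕜) (fun n => hi (hc (hgn n))) (hi hg) hψc
    hψ.2.1 hgL p)).sub (tendsto_integral_test_mul (𝕜 := 𝕜) hoi hvi hψc hψ.2.1 hoL (S.obs B φ))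
  have he := tendsto_nhds_unique hl (hr.congr fun n => (hn n).symm)
  have e1 : ∀ t, inner 𝕜 (S.vec φ) (Q (z t)) = inner 𝕜 p (z t) := fun t => (hs _ _).symm
  simp only [e1]
  rw [he, ← integral_sub, ← integral_sub]
  · refine setIntegral_congr_fun measurableSet_Ioo fun t _ => ?_
    simp only [hx, hh, ← S.inner_obs, inner_sub_right, inner_neg_right, inner_smul_right, ← hs]
    ring
  · exact (integrableOn_test_mul_inner (hi hz.1) hψc hψ.2.1 x₁).sub
      (integrableOn_test_mul_inner (hi hg) hψc hψ.2.1 p)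
  · exact integrableOn_test_mul_inner hvi hψc hψ.2.1 _
  · exact integrableOn_test_mul_inner (hi hz.1) hψc hψ.2.1 x₁
  · exact integrableOn_test_mul_inner (hi hg) hψc hψ.2.1 p

end ClosedLoop

/-! ### Grönwall's inequality and local uniqueness. -/

section Gronwall

/-- The integral form of Grönwall's inequality. -/
theorem le_mul_exp_of_le_add_mul_integral {φ : ℝ → ℝ} {a K T : ℝ} (hφ : ContinuousOn φ (Icc 0 T))
    (hK : 0 ≤ K) (h : ∀ t ∈ Icc 0 T, φ t ≤ a + K * ∫ s in (0 : ℝ)..t, φ s) :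
    ∀ t ∈ Icc 0 T, φ t ≤ a * Real.exp (K * t) := by
  intro t ht
  have hT : 0 ≤ T := ht.1.trans ht.2
  -- A continuous extension to the whole line, whose primitive is differentiable everywhere.
  set θ : ℝ → ℝ := IccExtend hT (domRestrict (Icc 0 T) φ) with hθ
  have hθc : Continuous θ := (continuousOn_iff_continuous_domRestrict.1 hφ).Icc_extend'
  have hθe : ∀ s ∈ Icc 0 T, θ s = φ s := fun s hs => by
    rw [hθ, IccExtend_of_mem hT _ hs, domRestrict_apply]
  have hi : ∀ s ∈ Icc 0 T, ∫ τ in (0 : ℝ)..s, φ τ = ∫ τ in (0 : ℝ)..s, θ τ := fun s hs => by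
    refine intervalIntegral.integral_congr fun τ hτ => (hθe τ ?_).symm
    rw [uIcc_of_le hs.1] at hτ
    exact ⟨hτ.1, hτ.2.trans hs.2⟩
  have hd : ∀ s, HasDerivAt (fun s => a + K * ∫ τ in (0 : ℝ)..s, θ τ) (K * θ s) s := fun s =>
    ((intervalIntegral.integral_hasDerivAt_right (hθc.intervalIntegrable _ _)
      (hθc.stronglyMeasurableAtFilter _ _) hθc.continuousAt).const_mul K).const_add a
  have hb := le_gronwallBound_of_liminf_deriv_right_le (δ := a) (K := K) (ε := 0)
    (continuous_iff_continuousAt.2 fun s => (hd s).continuousAt).continuousOn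
    (fun s _ r hr => (hd s).hasDerivWithinAt.liminf_right_slope_le hr) (by simp)
    (fun s hs => by
      have hs' := Ico_subset_Icc_self hs
      rw [add_zero, ← hi s hs', hθe s hs']
      exact mul_le_mul_of_nonneg_left (h s hs') hK) t ht
  rw [gronwallBound_ε0, sub_zero, ← hi t ht] at hb
  exact (h t ht).trans hb

variable {E : Type*} [NormedAddCommGroup E] [NormedSpace ℝ E]

theorem norm_integral_le_mul_integral_norm {h : ℝ → E} {θ : ℝ → ℝ} {C t : ℝ} (ht : 0 ≤ t)
    (hθ : ContinuousOn θ (Icc 0 t)) (hh : ∀ s ∈ Ioo 0 t, ‖h s‖ ≤ C * θ s) :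
    ‖∫ s in (0 : ℝ)..t, h s‖ ≤ C * ∫ s in (0 : ℝ)..t, θ s := by
  rw [intervalIntegral.integral_of_le ht, intervalIntegral.integral_of_le ht,
    integral_Ioc_eq_integral_Ioo, integral_Ioc_eq_integral_Ioo, ← integral_const_mul]
  exact norm_integral_le_of_norm_le ((ContinuousOn.integrableOn_Ioo hθ).const_mul C)
    ((ae_restrict_iff' measurableSet_Ioo).2 (Eventually.of_forall hh))

/-- If the difference of two curves satisfies Grönwall's inequality as long as the second curve
stays in a ball which contains the first one, then the curves agree. -/
theorem eqOn_of_norm_sub_le_mul_integral {a b : ℝ → E} {K T ρ : ℝ} (ha : ContinuousOn a (Icc 0 T))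
    (hb : ContinuousOn b (Icc 0 T)) (hK : 0 ≤ K) (haρ : ∀ t ∈ Icc 0 T, ‖a t‖ < ρ)
    (h : ∀ t ∈ Icc 0 T, (∀ s ∈ Ico 0 t, ‖b s‖ < ρ) →
      ‖a t - b t‖ ≤ K * ∫ s in (0 : ℝ)..t, ‖a s - b s‖) :
    EqOn a b (Icc 0 T) := by
  have key : ∀ τ ∈ Icc 0 T, (∀ s ∈ Ico 0 τ, ‖b s‖ < ρ) → a τ = b τ := by
    intro τ hτ hbτ
    have hs : Icc 0 τ ⊆ Icc 0 T := Icc_subset_Icc_right hτ.2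
    have h1 := le_mul_exp_of_le_add_mul_integral (φ := fun t => ‖a t - b t‖) (a := 0)
      ((ha.sub hb).norm.mono hs) hK (fun t ht => by
        rw [zero_add]
        exact h t (hs ht) fun s hst => hbτ s ⟨hst.1, hst.2.trans_le ht.2⟩) τ ⟨hτ.1, le_rfl⟩
    rw [zero_mul] at h1
    exact sub_eq_zero.1 (norm_le_zero_iff.1 h1)
  have hlt : ∀ t ∈ Icc 0 T, ‖b t‖ < ρ := by
    by_contra! hcon
    obtain ⟨t₀, ht₀, hbt₀⟩ := hcon
    have hcpt : IsCompact (Icc 0 T ∩ (fun t => ‖b t‖) ⁻¹' Ici ρ) :=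
      isCompact_Icc.of_isClosed_subset (hb.norm.preimage_isClosed_of_isClosed isClosed_Icc isClosed_Ici)
        inter_subset_left
    -- At the first exit time τ of b, smallness is needed only strictly before τ, so the curves
    -- still agree at τ; there ‖b τ‖ = ‖a τ‖ < ρ, a contradiction.
    obtain ⟨τ, ⟨hτ, hτρ⟩, hmin⟩ := hcpt.exists_isLeast ⟨t₀, ht₀, hbt₀⟩
    have h1 := key τ hτ fun s hs => by
      by_contra! hsρ
      exact absurd (hmin ⟨⟨hs.1, hs.2.le.trans hτ.2⟩, hsρ⟩) (not_le.2 hs.2)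
    have h2 := haρ τ hτ
    rw [h1] at h2
    exact absurd h2 (not_lt.2 hτρ)
  exact fun t ht => key t ht fun s hs => hlt s ⟨hs.1, hs.2.le.trans ht.2⟩

end Gronwall

/-! ### Radial truncation. -/

section Truncation

variable {E : Type*} [NormedAddCommGroup E] [NormedSpace ℝ E]

/-- The radial retraction onto the closed ball of radius `ρ`. -/
noncomputable def radialRetraction (ρ : ℝ) (x : E) : E := (ρ / max ρ ‖x‖) • x

theorem norm_radialRetraction {ρ : ℝ} (hρ : 0 < ρ) (x : E) :
    ‖radialRetraction ρ x‖ = ρ / max ρ ‖x‖ * ‖x‖ := by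
  rw [radialRetraction, norm_smul, Real.norm_of_nonneg (by positivity)]

theorem norm_radialRetraction_le {ρ : ℝ} (hρ : 0 < ρ) (x : E) : ‖radialRetraction ρ x‖ ≤ ρ := by
  have hm : 0 < max ρ ‖x‖ := lt_max_of_lt_left hρ
  rw [norm_radialRetraction hρ, div_mul_eq_mul_div, div_le_iff₀ hm]
  exact mul_le_mul_of_nonneg_left (le_max_right _ _) hρ.le

theorem norm_radialRetraction_le_norm {ρ : ℝ} (hρ : 0 < ρ) (x : E) :
    ‖radialRetraction ρ x‖ ≤ ‖x‖ := by
  have hm : 0 < max ρ ‖x‖ := lt_max_of_lt_left hρ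
  rw [norm_radialRetraction hρ]
  exact mul_le_of_le_one_left (norm_nonneg _) ((div_le_one hm).2 (le_max_left _ _))

theorem radialRetraction_of_norm_le {ρ : ℝ} (hρ : 0 < ρ) {x : E} (hx : ‖x‖ ≤ ρ) :
    radialRetraction ρ x = x := by
  rw [radialRetraction, max_eq_left hx, div_self hρ.ne', one_smul]

/-- Changing the vector and changing the scalar factor each cost at most ‖x - y‖. -/
theorem norm_radialRetraction_sub_le {ρ : ℝ} (hρ : 0 < ρ) (x y : E) :
    ‖radialRetraction ρ x - radialRetraction ρ y‖ ≤ 2 * ‖x - y‖ := by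
  have hx : 0 < max ρ ‖x‖ := lt_max_of_lt_left hρ
  have hy : 0 < max ρ ‖y‖ := lt_max_of_lt_left hρ
  have e : radialRetraction ρ x - radialRetraction ρ y
      = (ρ / max ρ ‖x‖) • (x - y) + (ρ / max ρ ‖x‖ - ρ / max ρ ‖y‖) • y := by
    rw [radialRetraction, radialRetraction, smul_sub, sub_smul]
    abel
  have h1 : ρ / max ρ ‖x‖ ≤ 1 := (div_le_one hx).2 (le_max_left _ _)
  have h2 : |ρ / max ρ ‖x‖ - ρ / max ρ ‖y‖| * ‖y‖ ≤ ‖x - y‖ := by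
    have e2 : ρ / max ρ ‖x‖ - ρ / max ρ ‖y‖
        = ρ / max ρ ‖x‖ * ((max ρ ‖y‖ - max ρ ‖x‖) / max ρ ‖y‖) := by
      field_simp
    have h3 : |max ρ ‖y‖ - max ρ ‖x‖| ≤ ‖x - y‖ := by
      rw [max_comm ρ, max_comm ρ, norm_sub_rev]
      refine (abs_max_sub_max_le_abs ‖y‖ ‖x‖ ρ).trans ?_
      exact abs_norm_sub_norm_le _ _
    rw [e2, abs_mul, abs_of_pos (div_pos hρ hx), abs_div, abs_of_pos hy, mul_assoc]
    refine (mul_le_of_le_one_left (by positivity) h1).trans ?_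
    rw [div_mul_eq_mul_div, div_le_iff₀ hy]
    exact mul_le_mul h3 (le_max_right _ _) (norm_nonneg _) (norm_nonneg _)
  rw [e, two_mul]
  refine (norm_add_le _ _).trans (add_le_add ?_ ?_)
  · rw [norm_smul, Real.norm_of_nonneg (by positivity)]
    exact mul_le_of_le_one_left (norm_nonneg _) h1
  · rw [norm_smul, Real.norm_eq_abs]
    exact h2

end Truncation

/-! ### Global solutions of ordinary differential equations. -/

section GlobalODE

variable {E : Type*} [NormedAddCommGroup E] [NormedSpace ℝ E] [CompleteSpace E]

/-- Global existence for a bounded Lipschitz vector field. -/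
theorem exists_eq_add_integral {F : ℝ → E → E} (hF : Continuous (Function.uncurry F)) (x₀ : E)
    (hlip : ∀ T : ℝ, ∃ K : NNReal, ∀ t ∈ Icc 0 T, LipschitzWith K (F t))
    (hbd : ∀ T : ℝ, ∃ L : NNReal, ∀ t ∈ Icc 0 T, ∀ x, ‖F t x‖ ≤ L) :
    ∃ p : ℝ → E, ContinuousOn p (Ici 0) ∧
      ∀ t, 0 ≤ t → p t = x₀ + ∫ τ in (0 : ℝ)..t, F τ (p τ) := by
  have hex : ∀ n : ℕ, ∃ p : ℝ → E, ContinuousOn p (Icc 0 (n : ℝ)) ∧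
      ∀ t ∈ Icc 0 (n : ℝ), p t = x₀ + ∫ τ in (0 : ℝ)..t, F τ (p τ) := by
    intro n
    obtain ⟨K, hK⟩ := hlip n
    obtain ⟨L, hL⟩ := hbd n
    have hn : (0 : ℝ) ≤ n := Nat.cast_nonneg n
    -- The field is bounded by L everywhere, so a ball of radius L n cannot be left before time n
    -- and one application covers [0, n].
    have hpl : IsPicardLindelof F (⟨0, le_rfl, hn⟩ : Icc (0 : ℝ) n) x₀ (L * n) 0 L K :=
      { lipschitzOnWith := fun t ht => (hK t ht).lipschitzOnWith
        continuousOn := fun x _ =>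
          (hF.comp (continuous_id.prodMk continuous_const)).continuousOn
        norm_le := fun t ht x _ => hL t ht x
        mul_max_le := by simp [hn] }
    obtain ⟨p, hp0, hp⟩ := hpl.exists_eq_forall_mem_Icc_hasDerivWithinAt₀
    have hpc : ContinuousOn p (Icc 0 (n : ℝ)) := fun t ht => (hp t ht).continuousWithinAt
    refine ⟨p, hpc, fun t ht => ?_⟩
    have hsub : Icc 0 t ⊆ Icc 0 (n : ℝ) := Icc_subset_Icc_right ht.2
    have h1 := intervalIntegral.integral_eq_sub_of_hasDeriv_right_of_le ht.1 (hpc.mono hsub)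
      (f' := fun τ => F τ (p τ)) (fun s hs => ?_) ?_
    · rw [h1, hp0, add_sub_cancel]
    · exact (hp s (hsub (Ioo_subset_Icc_self hs))).mono_of_mem_nhdsWithin
        (mem_of_superset (Icc_mem_nhds hs.1 (hs.2.trans_le ht.2)
          |> mem_nhdsWithin_of_mem_nhds) subset_rfl)
    · exact ((hF.comp_continuousOn (continuousOn_id.prodMk (hpc.mono hsub))).intervalIntegrable_of_Icc
        ht.1)
  choose p hpc hp using hex
  have hcoh : ∀ {m n : ℕ}, m ≤ n → EqOn (p m) (p n) (Icc 0 (m : ℝ)) := by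
    intro m n hmn
    obtain ⟨K, hK⟩ := hlip m
    have hmn' : Icc 0 (m : ℝ) ⊆ Icc 0 (n : ℝ) := Icc_subset_Icc_right (by exact_mod_cast hmn)
    obtain ⟨ρ, hρ⟩ := isCompact_Icc.exists_bound_of_continuousOn (hpc m)
    -- The Lipschitz bound is global in space, so the radius only has to exceed the norm of `p m`.
    refine eqOn_of_norm_sub_le_mul_integral (K := K) (ρ := ρ + 1) (hpc m) ((hpc n).mono hmn')
      K.2 (fun t ht => by linarith [hρ t ht]) fun t ht _ => ?_
    have hsub : Icc 0 t ⊆ Icc 0 (m : ℝ) := Icc_subset_Icc_right ht.2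
    have hI : ∀ {q : ℝ → E}, ContinuousOn q (Icc 0 (m : ℝ)) →
        IntervalIntegrable (fun τ => F τ (q τ)) volume 0 t := fun hq =>
      (hF.comp_continuousOn (continuousOn_id.prodMk (hq.mono hsub))).intervalIntegrable_of_Icc ht.1
    rw [hp m t ht, hp n t (hmn' ht), add_sub_add_left_eq_sub,
      ← intervalIntegral.integral_sub (hI (hpc m)) (hI ((hpc n).mono hmn'))]
    refine norm_integral_le_mul_integral_norm ht.1
      (((hpc m).sub ((hpc n).mono hmn')).norm.mono hsub) fun s hs => ?_
    have := (hK s (hsub (Ioo_subset_Icc_self hs))).dist_le_mul (p m s) (p n s)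
    rwa [dist_eq_norm, dist_eq_norm] at this
  have hq : ∀ n : ℕ, ∀ t ∈ Icc 0 (n : ℝ), p ⌈t⌉₊ t = p n t := fun n t ht =>
    hcoh (Nat.ceil_le.2 ht.2) ⟨ht.1, Nat.le_ceil t⟩
  -- By coherence, the value at t may be read off from the solution on any interval [0, n]
  -- containing t.
  refine ⟨fun t => p ⌈t⌉₊ t, fun t ht => ?_, fun t ht => ?_⟩
  · obtain ⟨n, hn⟩ := exists_nat_gt t
    have h1 : ContinuousWithinAt (fun t => p ⌈t⌉₊ t) (Icc 0 (n : ℝ)) t :=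
      ((hpc n).congr fun s hs => hq n s hs) t ⟨ht, hn.le⟩
    refine h1.mono_of_mem_nhdsWithin ?_
    rw [← Ici_inter_Iic]
    exact inter_mem self_mem_nhdsWithin (mem_nhdsWithin_of_mem_nhds (Iic_mem_nhds hn))
  · refine (hp _ t ⟨ht, Nat.le_ceil t⟩).trans (congrArg (x₀ + ·) ?_)
    refine intervalIntegral.integral_congr fun τ hτ => ?_
    rw [uIcc_of_le ht] at hτ
    exact congrArg (F τ) (hq ⌈t⌉₊ τ ⟨hτ.1, hτ.2.trans (Nat.le_ceil t)⟩).symm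

end GlobalODE

/-! ### The semilinear equation for w: existence and decay. -/

section Semilinear

variable {𝕜 H : Type*} [RCLike 𝕜]
  [NormedAddCommGroup H] [InnerProductSpace 𝕜 H] [NormedSpace ℝ H] [IsScalarTower ℝ 𝕜 H]
  [CompleteSpace H]

theorem op_real_smul (S : C0Group 𝕜 H) (t c : ℝ) (x : H) : S.op t (c • x) = c • S.op t x := by
  rw [RCLike.real_smul_eq_coe_smul (K := 𝕜) c x, RCLike.real_smul_eq_coe_smul (K := 𝕜) c (S.op t x),
    _root_.map_smul]

/-- The variation of constants formula defines a weak solution of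
`w' = -A* w - 2 lam w + k`. -/
theorem isAdjWeakSol_of_eq (S : C0Group 𝕜 H) {lam T : ℝ} {w₀ : H} {k w : ℝ → H}
    (hk : ContinuousOn k (Ici 0)) (hw : ContinuousOn w (Ici 0))
    (he : ∀ t, 0 ≤ t → w t = Real.exp (-(2 * lam * t)) •
      S.dual.op (-t) (w₀ + ∫ τ in (0 : ℝ)..t, Real.exp (2 * lam * τ) • S.dual.op τ (k τ))) :
    S.IsAdjWeakSol T (fun t => (2 * (lam : 𝕜)) • w t - k t) w := by
  have hsub : Icc 0 T ⊆ Ici 0 := Icc_subset_Ici_self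
  refine ⟨hw.mono hsub, fun x => ?_⟩
  have hi : ∀ (y : H) {a : ℝ → H}, ContinuousOn a (Ici 0) →
      ContinuousOn (fun t => inner 𝕜 y (a t)) (Icc 0 T) := fun y a ha =>
    continuousOn_const.inner (ha.mono hsub)
  set m : ℝ → H := fun τ => Real.exp (2 * lam * τ) • S.dual.op τ (k τ) with hm
  have hmc : ContinuousOn m (Ici 0) :=
    (Real.continuous_exp.comp (continuous_const.mul continuous_id)).continuousOn.smul
      (S.dual.continuousOn_op continuousOn_id hk)
  set p : ℝ → H := fun t => w₀ + ∫ τ in (0 : ℝ)..t, m τ with hp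
  -- Moving S(-t)* onto the test vector leaves only differentiable factors when that vector lies in
  -- D(A): an exponential, an orbit in the domain and a primitive.
  have hin : ∀ (y : H) {t : ℝ}, 0 ≤ t →
      inner 𝕜 y (w t) = Real.exp (-(2 * lam * t)) • inner 𝕜 (S.op (-t) y) (p t) := fun y t ht => by
    rw [he t ht, inner_smul_right_eq_smul, inner_dual_op_right]
  refine distDeriv_of_hasDerivAt (hi _ hw)
    (((hi _ hw).neg).sub (hi _ ((hw.const_smul _).sub hk))) fun t ht => ?_
  have hpd : HasDerivAt p (m t) t := by
    refine HasDerivAt.const_add _ (intervalIntegral.integral_hasDerivAt_right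
      ((hmc.mono Icc_subset_Ici_self).intervalIntegrable_of_Icc ht.1.le) ?_ ?_)
    · exact ContinuousOn.stronglyMeasurableAtFilter isOpen_Ioi (hmc.mono Ioi_subset_Ici_self) t ht.1
    · exact hmc.continuousAt (Ici_mem_nhds ht.1)
  have hxd := (S.generator_spec x).rev.hasDerivAt t
  have hed : HasDerivAt (fun t => Real.exp (-(2 * lam * t)))
      (Real.exp (-(2 * lam * t)) * -(2 * lam)) t := by
    have h1 : HasDerivAt (fun t : ℝ => -(2 * lam * t)) (-(2 * lam)) t := by
      have h2 := ((hasDerivAt_id t).const_mul (2 * lam)).neg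
      rw [mul_one] at h2
      exact h2
    exact h1.exp
  have hd := hed.smul (hxd.inner 𝕜 hpd)
  refine (hd.congr_of_eventuallyEq ?_).congr_deriv ?_
  · filter_upwards [Ioi_mem_nhds ht.1] with s hs
    exact hin _ (le_of_lt hs)
  · have h1 : inner 𝕜 (S.op (-t) (x : H)) (m t)
        = Real.exp (2 * lam * t) • inner 𝕜 (x : H) (k t) := by
      rw [hm]
      simp only
      rw [inner_smul_right_eq_smul, inner_dual_op_right, op_op_neg]
    have h2 : ((Real.exp (-(2 * lam * t)) : ℝ) : 𝕜) * ((Real.exp (2 * lam * t) : ℝ) : 𝕜) = 1 := by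
      rw [← RCLike.ofReal_mul, ← Real.exp_add, neg_add_cancel, Real.exp_zero, RCLike.ofReal_one]
    simp only [rev_op, map_neg, inner_neg_left, h1, inner_sub_right, inner_smul_right,
      hin _ ht.1.le, RCLike.real_smul_eq_coe_mul, RCLike.ofReal_mul, RCLike.ofReal_ofNat]
    linear_combination inner 𝕜 (x : H) (k t) * h2

/-- Global weak solutions of `w' = -A* w - 2 lam w + N(w)` for bounded Lipschitz `N`. -/
theorem exists_isAdjWeakSol (S : C0Group 𝕜 H) (lam : ℝ) {N : H → H} {K L : NNReal}
    (hN : LipschitzWith K N) (hL : ∀ x, ‖N x‖ ≤ L) (w₀ : H) :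
    ∃ w : ℝ → H, ContinuousOn w (Ici 0) ∧
      ∀ t, 0 ≤ t → w t = Real.exp (-(2 * lam * t)) •
        S.dual.op (-t) (w₀ + ∫ τ in (0 : ℝ)..t, Real.exp (2 * lam * τ) • S.dual.op τ (N (w τ))) := by
  -- Substituting w = W(t, p) removes the unbounded generator: p satisfies p' = F(t, p), with F
  -- bounded and Lipschitz on compact time intervals.
  set W : ℝ → H → H := fun t p => Real.exp (-(2 * lam * t)) • S.dual.op (-t) p with hW
  set F : ℝ → H → H := fun t p => Real.exp (2 * lam * t) • S.dual.op t (N (W t p)) with hF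
  have hexp : ∀ c : ℝ, Continuous fun q : ℝ × H => Real.exp (c * q.1) := fun c =>
    Real.continuous_exp.comp (continuous_const.mul continuous_fst)
  have hop : ∀ {a : ℝ × H → ℝ} {b : ℝ × H → H}, Continuous a → Continuous b →
      Continuous fun q => S.dual.op (a q) (b q) := fun {a b} ha hb =>
    continuousOn_univ.1 (S.dual.continuousOn_op ha.continuousOn hb.continuousOn)
  have hWc : Continuous fun q : ℝ × H => W q.1 q.2 := by
    have h1 := hop continuous_fst.neg continuous_snd
    have h2 : Continuous fun q : ℝ × H => Real.exp (-(2 * lam * q.1)) := by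
      simpa only [neg_mul] using hexp (-(2 * lam))
    exact h2.smul h1
  have hFc : Continuous fun q : ℝ × H => F q.1 q.2 := by
    have h1 := hop continuous_fst (hN.continuous.comp hWc)
    exact (hexp (2 * lam)).smul h1
  have hb : ∀ T : ℝ, ∃ C : NNReal, ∀ t ∈ Icc 0 T, Real.exp (2 * lam * t) ≤ C ∧
      Real.exp (-(2 * lam * t)) ≤ C ∧ ‖S.dual.op t‖ ≤ C ∧ ‖S.dual.op (-t)‖ ≤ C := by
    intro T
    obtain ⟨M, hM, hMb⟩ := S.dual.exists_norm_op_le_of_abs_le T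
    refine ⟨(M + Real.exp (2 * |lam| * T)).toNNReal, fun t ht => ?_⟩
    have hT : |t| ≤ T := by rw [abs_of_nonneg ht.1]; exact ht.2
    have h1 : 2 * |lam| * t ≤ 2 * |lam| * T := mul_le_mul_of_nonneg_left ht.2 (by positivity)
    have h2 : |lam * t| = |lam| * t := by rw [abs_mul, abs_of_nonneg ht.1]
    have h3 := le_abs_self (lam * t)
    have h4 := neg_abs_le (lam * t)
    have h5 := Real.exp_pos (2 * |lam| * T)
    rw [Real.coe_toNNReal _ (by positivity)]
    refine ⟨?_, ?_, ?_, ?_⟩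
    · linarith [Real.exp_le_exp.2 (show 2 * lam * t ≤ 2 * |lam| * T by linarith)]
    · linarith [Real.exp_le_exp.2 (show -(2 * lam * t) ≤ 2 * |lam| * T by linarith)]
    · linarith [hMb t hT]
    · linarith [hMb (-t) (by rwa [abs_neg])]
  have hFl : ∀ T : ℝ, ∃ K' : NNReal, ∀ t ∈ Icc 0 T, LipschitzWith K' (F t) := by
    intro T
    obtain ⟨C, hC⟩ := hb T
    refine ⟨C * (C * (K * (C * C))), fun t ht => LipschitzWith.of_dist_le_mul fun x y => ?_⟩
    obtain ⟨h1, h2, h3, h4⟩ := hC t ht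
    have h5 : ‖W t x - W t y‖ ≤ C * (C * ‖x - y‖) := by
      simp only [hW]
      rw [← smul_sub, ← map_sub, norm_smul, Real.norm_of_nonneg (Real.exp_pos _).le]
      exact mul_le_mul h2 ((S.dual.op (-t)).le_of_opNorm_le h4 _) (norm_nonneg _) C.2
    have h6 := hN.dist_le_mul (W t x) (W t y)
    rw [dist_eq_norm, dist_eq_norm] at *
    simp only [hF]
    rw [← smul_sub, ← map_sub, norm_smul, Real.norm_of_nonneg (Real.exp_pos _).le]
    have e : ((C * (C * (K * (C * C))) : NNReal) : ℝ) * ‖x - y‖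
        = C * (C * (K * (C * (C * ‖x - y‖)))) := by
      push_cast
      ring
    rw [e]
    refine mul_le_mul h1 (((S.dual.op t).le_of_opNorm_le h3 _).trans ?_) (norm_nonneg _) C.2
    exact mul_le_mul_of_nonneg_left (h6.trans (mul_le_mul_of_nonneg_left h5 K.2)) C.2
  have hFb : ∀ T : ℝ, ∃ L' : NNReal, ∀ t ∈ Icc 0 T, ∀ x, ‖F t x‖ ≤ L' := by
    intro T
    obtain ⟨C, hC⟩ := hb T
    refine ⟨C * (C * L), fun t ht x => ?_⟩
    obtain ⟨h1, h2, h3, h4⟩ := hC t ht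
    simp only [hF]
    rw [norm_smul, Real.norm_of_nonneg (Real.exp_pos _).le]
    push_cast
    exact mul_le_mul h1 (((S.dual.op t).le_of_opNorm_le h3 _).trans
      (mul_le_mul_of_nonneg_left (hL _) C.2)) (norm_nonneg _) C.2
  obtain ⟨p, hpc, hp⟩ := exists_eq_add_integral (F := F) hFc w₀ hFl hFb
  refine ⟨fun t => W t (p t), hWc.comp_continuousOn (continuousOn_id.prodMk hpc), fun t ht => ?_⟩
  simp only
  conv_lhs => rw [hp t ht]

/-- Exponential decay of the solutions of `w' = -A* w - 2 lam w + N(w)`. -/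
theorem norm_le_of_eq (S : C0Group 𝕜 H) {lam M κ η : ℝ} (hM : 1 ≤ M) (hη : 0 ≤ η)
    (hS : ∀ t, ‖S.op t‖ ≤ M * Real.exp (κ * |t|)) {k w : ℝ → H} {w₀ : H}
    (hkc : ContinuousOn k (Ici 0)) (hwc : ContinuousOn w (Ici 0))
    (hk : ∀ t, 0 ≤ t → ‖k t‖ ≤ η * ‖w t‖)
    (he : ∀ t, 0 ≤ t → w t = Real.exp (-(2 * lam * t)) •
      S.dual.op (-t) (w₀ + ∫ τ in (0 : ℝ)..t, Real.exp (2 * lam * τ) • S.dual.op τ (k τ)))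
    {t : ℝ} (ht : 0 ≤ t) :
    ‖w t‖ ≤ M * ‖w₀‖ * Real.exp (-(2 * lam - κ - M * η) * t) := by
  have hM0 : 0 ≤ M := zero_le_one.trans hM
  -- With this weight the exponential kernel of the variation of constants formula becomes the
  -- constant M η, as Grönwall's inequality requires.
  set φ : ℝ → ℝ := fun t => Real.exp ((2 * lam - κ) * t) * ‖w t‖ with hφ
  have hφc : ContinuousOn φ (Ici 0) :=
    (Real.continuous_exp.comp (continuous_const.mul continuous_id)).continuousOn.mul hwc.norm
  have hmc : ContinuousOn (fun τ => Real.exp (2 * lam * τ) • S.dual.op τ (k τ)) (Ici 0) :=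
    (Real.continuous_exp.comp (continuous_const.mul continuous_id)).continuousOn.smul
      (S.dual.continuousOn_op continuousOn_id hkc)
  have hbound : ∀ s ∈ Icc 0 t, φ s ≤ M * ‖w₀‖ + M * η * ∫ τ in (0 : ℝ)..s, φ τ := by
    intro s hs
    have h1 : ‖S.dual.op (-s) w₀‖ ≤ M * Real.exp (κ * s) * ‖w₀‖ := by
      refine (S.dual.op (-s)).le_of_opNorm_le ?_ _
      have := hS (-s)
      rwa [abs_neg, abs_of_nonneg hs.1, ← norm_dual_op] at this
    have h2 : ‖∫ τ in (0 : ℝ)..s, S.dual.op (-s) (Real.exp (2 * lam * τ) • S.dual.op τ (k τ))‖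
        ≤ M * η * Real.exp (κ * s) * ∫ τ in (0 : ℝ)..s, φ τ := by
      refine norm_integral_le_mul_integral_norm hs.1 (hφc.mono Icc_subset_Ici_self) fun τ hτ => ?_
      rw [op_real_smul, ← op_add_apply, norm_smul, Real.norm_of_nonneg (Real.exp_pos _).le]
      have h3 : ‖S.dual.op (-s + τ)‖ ≤ M * Real.exp (κ * (s - τ)) := by
        have := hS (-s + τ)
        rwa [← norm_dual_op, show -s + τ = -(s - τ) by ring, abs_neg,
          abs_of_nonneg (sub_nonneg.2 hτ.2.le), ← show -s + τ = -(s - τ) by ring] at this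
      have h4 : ‖S.dual.op (-s + τ) (k τ)‖ ≤ M * Real.exp (κ * (s - τ)) * (η * ‖w τ‖) :=
        ((S.dual.op (-s + τ)).le_of_opNorm_le h3 _).trans
          (mul_le_mul_of_nonneg_left (hk τ hτ.1.le) (by positivity))
      have h5 : Real.exp (2 * lam * τ) * Real.exp (κ * (s - τ))
          = Real.exp (κ * s) * Real.exp ((2 * lam - κ) * τ) := by
        rw [← Real.exp_add, ← Real.exp_add]
        congr 1
        ring
      calc Real.exp (2 * lam * τ) * ‖S.dual.op (-s + τ) (k τ)‖
          ≤ Real.exp (2 * lam * τ) * (M * Real.exp (κ * (s - τ)) * (η * ‖w τ‖)) :=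
            mul_le_mul_of_nonneg_left h4 (Real.exp_pos _).le
        _ = M * η * (Real.exp (2 * lam * τ) * Real.exp (κ * (s - τ))) * ‖w τ‖ := by ring
        _ = M * η * Real.exp (κ * s) * φ τ := by rw [h5, hφ]; ring
    have h6 : Real.exp ((2 * lam - κ) * s) * Real.exp (-(2 * lam * s)) * Real.exp (κ * s) = 1 := by
      rw [← Real.exp_add, ← Real.exp_add, ← Real.exp_zero]
      congr 1
      ring
    have h7 : ‖w s‖ ≤ Real.exp (-(2 * lam * s)) * (M * Real.exp (κ * s) * ‖w₀‖
        + M * η * Real.exp (κ * s) * ∫ τ in (0 : ℝ)..s, φ τ) := by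
      rw [he s hs.1, norm_smul, Real.norm_of_nonneg (Real.exp_pos _).le, _root_.map_add,
        ← (S.dual.op (-s)).intervalIntegral_comp_comm
          ((hmc.mono Icc_subset_Ici_self).intervalIntegrable_of_Icc hs.1)]
      exact mul_le_mul_of_nonneg_left ((norm_add_le _ _).trans (add_le_add h1 h2))
        (Real.exp_pos _).le
    calc φ s ≤ Real.exp ((2 * lam - κ) * s) * (Real.exp (-(2 * lam * s)) *
          (M * Real.exp (κ * s) * ‖w₀‖ + M * η * Real.exp (κ * s) * ∫ τ in (0 : ℝ)..s, φ τ)) :=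
          mul_le_mul_of_nonneg_left h7 (Real.exp_pos _).le
      _ = (Real.exp ((2 * lam - κ) * s) * Real.exp (-(2 * lam * s)) * Real.exp (κ * s)) *
          (M * ‖w₀‖ + M * η * ∫ τ in (0 : ℝ)..s, φ τ) := by ring
      _ = _ := by rw [h6, one_mul]
  have h := le_mul_exp_of_le_add_mul_integral (hφc.mono Icc_subset_Ici_self)
    (mul_nonneg hM0 hη) hbound t ⟨ht, le_rfl⟩
  calc ‖w t‖ = Real.exp (-((2 * lam - κ) * t)) * φ t := by
        rw [hφ]
        simp only
        rw [← mul_assoc, ← Real.exp_add, neg_add_cancel, Real.exp_zero, one_mul]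
    _ ≤ Real.exp (-((2 * lam - κ) * t)) * (M * ‖w₀‖ * Real.exp (M * η * t)) :=
        mul_le_mul_of_nonneg_left h (Real.exp_pos _).le
    _ = M * ‖w₀‖ * (Real.exp (-((2 * lam - κ) * t)) * Real.exp (M * η * t)) := by ring
    _ = _ := by
        rw [← Real.exp_add]
        congr 2
        ring

end Semilinear

/-! ### Small data: existence with decay, and uniqueness for both equations. -/

section Uniqueness

variable {𝕜 H U : Type*} [RCLike 𝕜]
  [NormedAddCommGroup H] [InnerProductSpace 𝕜 H] [NormedSpace ℝ H] [IsScalarTower ℝ 𝕜 H]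
  [CompleteSpace H]
  [NormedAddCommGroup U] [InnerProductSpace 𝕜 U] [CompleteSpace U]
variable {S : C0Group 𝕜 H}

/-- Small solutions of `w' = -A* w - 2 lam w + N(w)` exist and decay exponentially. -/
theorem exists_isAdjWeakSol_decay (S : C0Group 𝕜 H) {lam M κ η ρ L : ℝ} (hM : 1 ≤ M) (hη : 0 ≤ η)
    (hS : ∀ t, ‖S.op t‖ ≤ M * Real.exp (κ * |t|)) {N : H → H} (hρ : 0 < ρ) (hL : 0 ≤ L)
    (hN : ∀ x, ‖x‖ ≤ ρ → ‖N x‖ ≤ η * ‖x‖)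
    (hlip : ∀ x y, ‖x‖ ≤ ρ → ‖y‖ ≤ ρ → ‖N x - N y‖ ≤ L * ‖x - y‖)
    (hrate : 0 ≤ 2 * lam - κ - M * η) {w₀ : H} (hw₀ : M * ‖w₀‖ < ρ) :
    ∃ w : ℝ → H, ContinuousOn w (Ici 0) ∧ w 0 = w₀ ∧
      (∀ T, S.IsAdjWeakSol T (fun t => (2 * (lam : 𝕜)) • w t - N (w t)) w) ∧
      (∀ t, 0 ≤ t → ‖w t‖ < ρ) ∧
      ∀ t, 0 ≤ t → ‖w t‖ ≤ M * ‖w₀‖ * Real.exp (-(2 * lam - κ - M * η) * t) := by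
  -- The truncated nonlinearity N ∘ P is bounded and globally Lipschitz and still satisfies ‖N (P
  -- x)‖ ≤ η ‖x‖ for all x. The decay estimate therefore holds for the truncated equation and keeps
  -- w in the ball where P is the identity.
  set P : H → H := radialRetraction ρ with hP
  have hP1 : ∀ x, ‖P x‖ ≤ ρ := norm_radialRetraction_le hρ
  have hNP : ∀ x, ‖N (P x)‖ ≤ η * ‖x‖ := fun x => (hN _ (hP1 x)).trans
    (mul_le_mul_of_nonneg_left (norm_radialRetraction_le_norm hρ x) hη)
  have hlipP : LipschitzWith (L * 2).toNNReal fun x => N (P x) := by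
    refine LipschitzWith.of_dist_le_mul fun x y => ?_
    rw [Real.coe_toNNReal _ (by positivity), dist_eq_norm, dist_eq_norm, mul_assoc]
    exact (hlip _ _ (hP1 x) (hP1 y)).trans
      (mul_le_mul_of_nonneg_left (norm_radialRetraction_sub_le hρ x y) hL)
  have hbd : ∀ x, ‖N (P x)‖ ≤ ((η * ρ).toNNReal : ℝ) := fun x => by
    rw [Real.coe_toNNReal _ (by positivity)]
    exact (hN _ (hP1 x)).trans (mul_le_mul_of_nonneg_left (hP1 x) hη)
  obtain ⟨w, hwc, hw⟩ := S.exists_isAdjWeakSol lam hlipP hbd w₀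
  have hkc : ContinuousOn (fun t => N (P (w t))) (Ici 0) := hlipP.continuous.comp_continuousOn hwc
  have hdec : ∀ t, 0 ≤ t → ‖w t‖ ≤ M * ‖w₀‖ * Real.exp (-(2 * lam - κ - M * η) * t) := fun t ht =>
    S.norm_le_of_eq hM hη hS hkc hwc (fun s _ => hNP (w s)) hw ht
  have hlt : ∀ t, 0 ≤ t → ‖w t‖ < ρ := fun t ht => by
    refine ((hdec t ht).trans (mul_le_of_le_one_right (by positivity) ?_)).trans_lt hw₀
    exact Real.exp_le_one_iff.2 (by nlinarith)
  have hPw : ∀ t, 0 ≤ t → P (w t) = w t := fun t ht =>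
    radialRetraction_of_norm_le hρ (hlt t ht).le
  refine ⟨w, hwc, ?_, fun T => ?_, hlt, hdec⟩
  · rw [hw 0 le_rfl, intervalIntegral.integral_same, add_zero, neg_zero, op_zero_apply, mul_zero,
      neg_zero, Real.exp_zero, one_smul]
  · refine S.isAdjWeakSol_of_eq (k := fun t => N (w t)) (w₀ := w₀) ?_ hwc fun t ht => ?_
    · exact hkc.congr fun t ht => (congrArg N (hPw t ht)).symm
    · rw [hw t ht]
      congr 3
      refine intervalIntegral.integral_congr fun τ hτ => ?_
      rw [uIcc_of_le ht] at hτ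
      simp only [hPw τ hτ.1]

/-- Uniqueness for `w' = -A* w - 2 lam w + N(w)` with `N` locally Lipschitz near `0`. -/
theorem IsAdjWeakSol.eqOn {lam ρ L T : ℝ} {N : H → H} (hN : Continuous N) (hL : 0 ≤ L)
    (hlip : ∀ x y, ‖x‖ ≤ ρ → ‖y‖ ≤ ρ → ‖N x - N y‖ ≤ L * ‖x - y‖) {w w' : ℝ → H}
    (hw : S.IsAdjWeakSol T (fun t => (2 * (lam : 𝕜)) • w t - N (w t)) w)
    (hw' : S.IsAdjWeakSol T (fun t => (2 * (lam : 𝕜)) • w' t - N (w' t)) w')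
    (h0 : w 0 = w' 0) (hρ : ∀ t ∈ Icc 0 T, ‖w t‖ < ρ) : EqOn w w' (Icc 0 T) := by
  obtain ⟨M, hM, hMb⟩ := S.dual.exists_norm_op_le_of_abs_le T
  have hM0 : 0 ≤ M := zero_le_one.trans hM
  have hgc : ∀ {a : ℝ → H}, ContinuousOn a (Icc 0 T) →
      ContinuousOn (fun t => (2 * (lam : 𝕜)) • a t - N (a t)) (Icc 0 T) := fun ha =>
    (ha.const_smul _).sub (hN.comp_continuousOn ha)
  have hsub := hw.sub hw' (hgc hw.1) (hgc hw'.1)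
  -- Only w is known to be small; the first exit argument takes care of w'. The two factors M come
  -- from applying S(t)* inside the integral and inverting it outside.
  refine eqOn_of_norm_sub_le_mul_integral (K := M * (M * (‖2 * (lam : 𝕜)‖ + L))) (ρ := ρ) hw.1 hw'.1
    (by positivity) hρ fun t ht hb => ?_
  have h1 := hsub.dual_op_sub ((hgc hw.1).sub (hgc hw'.1)) le_rfl ht.1 ht.2
  rw [h0, sub_self, _root_.map_zero, sub_zero] at h1
  have h2 : ‖w t - w' t‖ ≤ M * ‖S.dual.op t (w t - w' t)‖ := by
    conv_lhs => rw [← S.dual.op_neg_op t (w t - w' t)]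
    exact (S.dual.op (-t)).le_of_opNorm_le (hMb _ (by rw [abs_neg, abs_of_nonneg ht.1]; exact ht.2)) _
  refine h2.trans ?_
  rw [h1, norm_neg, mul_assoc M]
  refine mul_le_mul_of_nonneg_left (norm_integral_le_mul_integral_norm ht.1
    ((hw.1.sub hw'.1).norm.mono (Icc_subset_Icc_right ht.2)) fun s hs => ?_) hM0
  have hsT : s ≤ T := hs.2.le.trans ht.2
  refine ((S.dual.op s).le_of_opNorm_le (hMb _ (by rw [abs_of_pos hs.1]; exact hsT)) _).trans ?_
  rw [mul_assoc]
  refine mul_le_mul_of_nonneg_left ?_ hM0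
  rw [sub_sub_sub_comm, ← smul_sub, add_mul, ← norm_smul]
  exact (norm_sub_le _ _).trans (add_le_add le_rfl
    (hlip _ _ (hρ s ⟨hs.1.le, hsT⟩).le (hb s ⟨hs.1.le, hs.2⟩).le))

/-- Uniqueness for `y' = A y + f(y) + B u` with `f` locally Lipschitz near `0`. -/
theorem IsWeakSol.eqOn {B : U →L[𝕜] S.DomAdjDual} {T r L : ℝ} {f : H → H} (hf : Continuous f)
    (hL : 0 ≤ L) (hlip : ∀ x y, ‖x‖ < r → ‖y‖ < r → ‖f x - f y‖ ≤ L * ‖x - y‖) {y₀ : H}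
    {y y' : ℝ → H} {u u' : ℝ → U} (hu : IntegrableOn u (Ioo 0 T))
    (huu : u =ᵐ[volume.restrict (Ioo 0 T)] u')
    (hy : S.IsWeakSol B T y₀ (fun t => f (y t)) u y)
    (hy' : S.IsWeakSol B T y₀ (fun t => f (y' t)) u' y')
    (hr : ∀ t ∈ Icc 0 T, ‖y t‖ < r) : EqOn y y' (Icc 0 T) := by
  obtain ⟨hyc, hy0, hyw⟩ := hy
  obtain ⟨hyc', hy0', hyw'⟩ := hy'
  obtain ⟨M, hM, hMb⟩ := S.exists_norm_op_le_of_abs_le T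
  have hM0 : 0 ≤ M := zero_le_one.trans hM
  have hfc : ∀ {a : ℝ → H}, ContinuousOn a (Icc 0 T) → ContinuousOn (fun t => f (a t)) (Icc 0 T) :=
    fun ha => hf.comp_continuousOn ha
  have hi : ∀ (x : H) {a : ℝ → H}, ContinuousOn a (Icc 0 T) →
      IntegrableOn (fun t => inner 𝕜 x (a t)) (Ioo 0 T) := fun x a ha =>
    ContinuousOn.integrableOn_Ioo (continuousOn_const.inner ha)
  have hBi : ∀ (φ : S.DomAdj) {a : ℝ → U}, IntegrableOn a (Ioo 0 T) →
      IntegrableOn (fun t => B (a t) φ) (Ioo 0 T) := fun φ a ha => by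
    simpa only [S.inner_obs, IntegrableOn] using ha.const_inner (𝕜 := 𝕜) (S.obs B φ)
  -- The controls agree almost everywhere, so B drops out of the equation for the difference.
  have hdist : ∀ φ : S.DomAdj, DistDeriv T (fun t => inner 𝕜 (S.vec φ) (y t - y' t))
      (fun t => inner 𝕜 (S.adjGen φ) (y t - y' t) + inner 𝕜 (S.vec φ) (f (y t) - f (y' t))) := by
    intro φ ψ hψ
    have h1 := (hyw φ).sub (hyw' φ) (hi _ hyc) (hi _ hyc')
      (((hi _ hyc).add (hi _ (hfc hyc))).add (hBi φ hu))
      (((hi _ hyc').add (hi _ (hfc hyc'))).add (hBi φ (hu.congr huu))) ψ hψ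
    simp only [inner_sub_right] at *
    rw [h1]
    refine integral_congr_ae ?_
    filter_upwards [huu] with t ht
    rw [ht]
    ring
  have hdc : ContinuousOn (fun t => y t - y' t) (Icc 0 T) := hyc.sub hyc'
  have hkc : ContinuousOn (fun t => f (y t) - f (y' t)) (Icc 0 T) := (hfc hyc).sub (hfc hyc')
  refine eqOn_of_norm_sub_le_mul_integral (K := M * (M * L)) (ρ := r) hyc hyc'
    (by positivity) hr fun t ht hb => ?_
  -- The equation d' = A d + k has the form d' = -K* d + k, where K = -A* generates t ↦ S(-t)*; the
  -- formula is then stated with the dual of this group, t ↦ S(-t).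
  have h1 := S.dual.rev.mild_of_weak hdc hkc (fun x l hxl => ?_) le_rfl ht.1 ht.2
  · have hop : ∀ τ x, S.dual.rev.dual.op τ x = S.op (-τ) x := fun τ x => by
      rw [dual_op, rev_op, ← dual_op, dual_dual_op]
    simp only [hop, hy0, hy0', sub_self, _root_.map_zero, sub_zero] at h1
    have h2 : ‖y t - y' t‖ ≤ M * ‖S.op (-t) (y t - y' t)‖ := by
      conv_lhs => rw [← S.op_op_neg t (y t - y' t)]
      exact (S.op t).le_of_opNorm_le (hMb _ (by rw [abs_of_nonneg ht.1]; exact ht.2)) _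
    refine h2.trans ?_
    rw [h1, mul_assoc M]
    refine mul_le_mul_of_nonneg_left (norm_integral_le_mul_integral_norm ht.1
      (hdc.norm.mono (Icc_subset_Icc_right ht.2)) fun s hs => ?_) hM0
    have hsT : s ≤ T := hs.2.le.trans ht.2
    refine ((S.op (-s)).le_of_opNorm_le
      (hMb _ (by rw [abs_neg, abs_of_pos hs.1]; exact hsT)) _).trans ?_
    rw [mul_assoc]
    exact mul_le_mul_of_nonneg_left
      (hlip _ _ (hr s ⟨hs.1.le, hsT⟩) (hb s ⟨hs.1.le, hs.2⟩)) hM0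
  · have h2 : S.dual.HasGen x (-l) := by
      simpa only [HasGen, rev_op, neg_neg] using hxl.rev
    have h3 := hdist (S.ofHasGen h2)
    simpa only [vec_ofHasGen, adjGen_ofHasGen, inner_neg_left] using h3

end Uniqueness

end C0Group

/-! ### Choice of the constants and assembly. -/

theorem mainTheorem11 {𝕜 H U : Type*} [RCLike 𝕜]
    [NormedAddCommGroup H] [InnerProductSpace 𝕜 H] [CompleteSpace H]
    [NormedAddCommGroup U] [InnerProductSpace 𝕜 U] [CompleteSpace U]
    (S : C0Group 𝕜 H) (B : U →L[𝕜] S.DomAdjDual)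
    (hB : S.Admissible B) (hctrl : S.ExactlyControllable B)
    (f : H → H) (hf : Continuous f)
    (hf_small : ∀ ε : ℝ, 0 < ε → ∃ δ : ℝ, 0 < δ ∧ ∀ x : H, ‖x‖ < δ → ‖f x‖ ≤ ε * ‖x‖)
    (hf_lip : ∃ r Λ : ℝ, 0 < r ∧ 0 < Λ ∧
      ∀ x y : H, ‖x‖ < r → ‖y‖ < r → ‖f x - f y‖ ≤ Λ * ‖x - y‖) :
    S.LocallyRapidlyStabilizable B f := by
  -- Real scalars, used for derivatives and integrals in time, are obtained by restriction from 𝕜.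
  let _ : NormedSpace ℝ H := NormedSpace.restrictScalars ℝ 𝕜 H
  have _ : IsScalarTower ℝ 𝕜 H := RestrictScalars.isScalarTower ℝ 𝕜 H
  let _ : NormedSpace ℝ U := NormedSpace.restrictScalars ℝ 𝕜 U
  have _ : IsScalarTower ℝ 𝕜 U := RestrictScalars.isScalarTower ℝ 𝕜 U
  intro γ hγ
  obtain ⟨M, κ, hM, hκ, hS⟩ := S.exists_growth
  have hM0 : 0 < M := zero_lt_one.trans_le hM
  obtain ⟨r, Λ, hr, hΛ, hlip⟩ := hf_lip
  -- The nonlinearity will be small with η = 1 / M, so the decay rate is 2 lam - κ - M η = κ + 2 γ +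
  -- 1 ≥ γ.
  set lam : ℝ := κ + γ + 1 with hlam
  obtain ⟨Q, hQ, hric⟩ := C0Group.exists_riccati hB hctrl hM hS
    (show κ < lam by linarith) (show 0 ≤ lam by linarith)
  have hlam0 : 0 ≤ lam := by linarith
  set q : ℝ := ‖(Q : H →L[𝕜] H)‖ with hq
  set q' : ℝ := ‖(Q.symm : H →L[𝕜] H)‖ with hq'
  have hq0 : 0 ≤ q := norm_nonneg _
  have hq'0 : 0 ≤ q' := norm_nonneg _
  have hQn : ∀ x, ‖Q x‖ ≤ q * ‖x‖ := fun x => (Q : H →L[𝕜] H).le_opNorm x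
  have hQ'n : ∀ x, ‖Q.symm x‖ ≤ q' * ‖x‖ := fun x => (Q.symm : H →L[𝕜] H).le_opNorm x
  -- Conjugating f with Q costs a factor q' q; this smallness gives Q⁻¹ f Q the bound 1 / M. Adding
  -- 1 here, and in ρ below, avoids division by zero.
  set e : ℝ := 1 / (M * (1 + q' * q)) with he
  have he0 : 0 < e := by positivity
  obtain ⟨δ, hδ, hsmall⟩ := hf_small e he0
  have hm : 0 < min r δ := lt_min hr hδ
  set ρ : ℝ := min r δ / (1 + q) with hρ
  have hρ0 : 0 < ρ := by positivity
  have hball : ∀ x : H, ‖x‖ ≤ ρ → ‖Q x‖ < min r δ := fun x hx => by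
    calc ‖Q x‖ ≤ q * ρ := (hQn x).trans (mul_le_mul_of_nonneg_left hx hq0)
      _ < (1 + q) * ρ := by linarith
      _ = min r δ := mul_div_cancel₀ _ (by positivity)
  set N : H → H := fun x => Q.symm (f (Q x)) with hN
  have hNc : Continuous N := Q.symm.continuous.comp (hf.comp Q.continuous)
  have hNsmall : ∀ x, ‖x‖ ≤ ρ → ‖N x‖ ≤ 1 / M * ‖x‖ := fun x hx => by
    calc ‖N x‖ ≤ q' * (e * (q * ‖x‖)) := (hQ'n _).trans (mul_le_mul_of_nonneg_left
          ((hsmall _ ((hball x hx).trans_le (min_le_right _ _))).trans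
            (mul_le_mul_of_nonneg_left (hQn x) he0.le)) hq'0)
      _ = 1 / M * (q' * q / (1 + q' * q)) * ‖x‖ := by
          rw [he]
          field_simp
      _ ≤ 1 / M * ‖x‖ := by
          refine mul_le_mul_of_nonneg_right (mul_le_of_le_one_right (by positivity) ?_)
            (norm_nonneg _)
          rw [div_le_one (by positivity)]
          linarith
  have hNlip : ∀ x y, ‖x‖ ≤ ρ → ‖y‖ ≤ ρ → ‖N x - N y‖ ≤ q' * (Λ * q) * ‖x - y‖ := by
    intro x y hx hy
    have h1 := hlip _ _ ((hball x hx).trans_le (min_le_left _ _))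
      ((hball y hy).trans_le (min_le_left _ _))
    rw [← map_sub] at h1
    calc ‖N x - N y‖ = ‖Q.symm (f (Q x) - f (Q y))‖ := by rw [map_sub]
      _ ≤ q' * (Λ * (q * ‖x - y‖)) := (hQ'n _).trans (mul_le_mul_of_nonneg_left
          (h1.trans (mul_le_mul_of_nonneg_left (hQn _) hΛ.le)) hq'0)
      _ = _ := by ring
  have hη : M * (1 / M) = 1 := mul_one_div_cancel hM0.ne'
  refine ⟨lam, Q, 0, ContinuousLinearMap.id 𝕜 U, by linarith, hQ,
    ContinuousLinearMap.isPositive_zero, ContinuousLinearMap.isPositive_one, hric,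
    -- The radius makes M ‖Q⁻¹ y₀‖ at most ρ / 2, hence less than ρ. The constant is the cost of
    -- passing to w, of its decay estimate and of coming back, plus 1 for positivity.
    ρ / (2 * (M * (1 + q'))), q * (M * q') + 1, by positivity, by positivity, fun y₀ hy₀ => ?_⟩
  have hw₀ : M * ‖Q.symm y₀‖ < ρ := by
    calc M * ‖Q.symm y₀‖ ≤ M * (q' * (ρ / (2 * (M * (1 + q'))))) :=
          mul_le_mul_of_nonneg_left ((hQ'n _).trans (mul_le_mul_of_nonneg_left hy₀ hq'0)) hM0.le
      _ = ρ / 2 * (q' / (1 + q')) := by field_simp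
      _ ≤ ρ / 2 := mul_le_of_le_one_right (by positivity)
          ((div_le_one (by positivity)).2 (by linarith))
      _ < ρ := half_lt_self hρ0
  obtain ⟨w, hwc, hw0, hw, hwρ, hwd⟩ := S.exists_isAdjWeakSol_decay (lam := lam) hM
    (show 0 ≤ 1 / M by positivity) hS hρ0 (by positivity) hNsmall hNlip (by linarith) hw₀
  have hgc : ∀ {T : ℝ} {a : ℝ → H}, ContinuousOn a (Icc 0 T) →
      ContinuousOn (fun t => (2 * (lam : 𝕜)) • a t - N (a t)) (Icc 0 T) := fun ha =>
    (ha.const_smul _).sub (hNc.comp_continuousOn ha)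
  have hsol : S.IsClosedLoopSol B f lam Q 0 (ContinuousLinearMap.id 𝕜 U) y₀ (fun t => Q (w t)) w := by
    refine ⟨hw0, fun T hT => ?_⟩
    simp only [_root_.zero_apply, add_zero, ContinuousLinearMap.id_apply]
    refine ⟨hw T, ?_⟩
    obtain ⟨v, hv⟩ := C0Group.exists_isObs hQ.1 hric hlam0 hT (hw T) (hgc (hw T).1)
    refine ⟨v, hv, ?_⟩
    have h1 := hv.isWeakSol (h := fun t => f (Q (w t))) hQ.1 hric (hw T) (hgc (hw T).1) fun t => by
      simp [hN]
    rw [hw0] at h1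
    simpa using h1
  refine ⟨fun t => Q (w t), w, hsol, fun y₂ w₂ h₂ => ?_, fun t _ => (Q.symm_apply_apply _).symm,
    fun t ht => ?_⟩
  · obtain ⟨h₂0, h₂⟩ := h₂
    -- The cascade: first w, then the observation almost everywhere, then y.
    have key : ∀ T : ℝ, 0 < T → EqOn w w₂ (Icc 0 T) ∧ EqOn (fun t => Q (w t)) y₂ (Icc 0 T) := by
      intro T hT
      obtain ⟨h2w, v₂, h2v, h2y⟩ := h₂ T hT
      obtain ⟨-, v, hv, hy⟩ := hsol.2 T hT
      simp only [_root_.zero_apply, add_zero, ContinuousLinearMap.id_apply] at h2w h2v h2y hv hy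
      have hww : EqOn w w₂ (Icc 0 T) := (hw T).eqOn hNc (by positivity) hNlip h2w
        (hw0.trans h₂0.symm) fun t ht => hwρ t ht.1
      have hvv := hv.ae_eq hQ.1 hric hlam0 hT h2v (hgc (hw T).1)
        (fun t ht => by simp only [hww ht]) (hww ⟨hT.le, le_rfl⟩)
      refine ⟨hww, hy.eqOn hf hΛ.le hlip (hv.1.neg.integrable one_le_two) ?_ h2y fun t ht =>
        (hball _ (hwρ t ht.1).le).trans_le (min_le_left _ _)⟩
      filter_upwards [hvv] with t ht
      exact congrArg Neg.neg ht
    have hmem : ∀ t : ℝ, 0 ≤ t → t ∈ Icc 0 (t + 1) := fun t ht => ⟨ht, by linarith⟩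
    exact ⟨fun t ht => ((key (t + 1) (by linarith [mem_Ici.1 ht])).2 (hmem t ht)).symm,
      fun t ht => ((key (t + 1) (by linarith [mem_Ici.1 ht])).1 (hmem t ht)).symm⟩
  · have h1 : Real.exp (-(2 * lam - κ - M * (1 / M)) * t) ≤ Real.exp (-γ * t) :=
      Real.exp_le_exp.2 (mul_le_mul_of_nonneg_right (by linarith) ht)
    calc ‖Q (w t)‖ ≤ q * (M * (q' * ‖y₀‖) * Real.exp (-γ * t)) := by
          refine (hQn _).trans (mul_le_mul_of_nonneg_left ((hwd t ht).trans ?_) hq0)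
          exact mul_le_mul (mul_le_mul_of_nonneg_left (hQ'n _) hM0.le) h1 (Real.exp_pos _).le
            (by positivity)
      _ = q * (M * q') * Real.exp (-γ * t) * ‖y₀‖ := by ring
      _ ≤ (q * (M * q') + 1) * Real.exp (-γ * t) * ‖y₀‖ := by
          gcongr
          linarith
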